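/- Let $\Bbbk$ be a commutative ring. All 2-supercategories below are $\Bbbk$-linear; coherence maps are even and need not be identities. A 2-supercategory $\mathfrak A$ has objects, 1-morphisms and 2-morphisms, the morphism categories $\mathcal Hom_{\mathfrak A}(\lambda,\mu)$ are supercategories, and horizontal composition satisfies the super interchange law $(vu)\circ(yx)=(-1)^{|u||y|}(v\circ y)(u\circ x)$. A 2-superfunctor $\mathbb R:\mathfrak A\to\mathfrak B$ has even coherence isomorphisms $c_{G,F}:(\mathbb RG)(\mathbb RF)\Rightarrow\mathbb R(GF)$ and $i_\lambda:1_{\mathbb R\lambda}\Rightarrow\mathbb R1_\lambda$. A 2-natural transformation $(X,x):\mathbb R\Rightarrow\mathbb S$ consists of 1-morphisms $X_\lambda:\mathbb R\lambda\to\mathbb S\lambda$ and even 2-morphisms $x_F:X_\mu(\mathbb RF)\Rightarrow(\mathbb SF)X_\lambda$, natural in $F:\lambda\to\mu$ and compatible with $c$ and $i$. A supermodification $\alpha:(X,x)\Rrightarrow(Y,y)$ consists of 2-morphisms $\alpha_\lambda:X_\lambda\Rightarrow Y_\lambda$ with $y_F\circ(\alpha_\mu(\mathbb RF))=((\mathbb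 SF)\alpha_\lambda)\circ x_F$. These form a 2-supercategory $\mathcal Hom(\mathfrak A,\mathfrak B)$; if $\mathfrak B$ is strict, 2-superfunctors and 2-natural transformations already form a category $\mathrm{Hom}(\mathfrak A,\mathfrak B)$. A 2-superequivalence is a 2-superfunctor that induces superequivalences on all morphism supercategories and for which each object of the target is superequivalent to one in its image. A $\Pi$-2-supercategory is a 2-supercategory $\mathfrak B$ with 1-morphisms $\pi_\lambda:\lambda\to\lambda$ and odd 2-isomorphisms $\zeta_\lambda:\pi_\lambda\Rightarrow 1_\lambda$ for all $\lambda$. For $F:\lambda\to\mu$ in $\mathfrak B$ put $\pi^0F=F$, $\pi^1F=\pi_\mu F$, and let $\zeta^aF:\pi^aF\Rightarrow F$ be the identity for $a=0$ and $\zeta_\mu F$ followed by the unit isomorphism for $a=1$. Let $\nu\mathfrak B$ be the underlying 2-supercategory; 2-superfunctors out of or into $\mathfrak B$ are those of $\nu\mathfrak B$. The $\Pi$-envelope $\mathfrak A_\pi$ of $\mathfrak A$ has the same objects, 1-morphisms $\Pi^aF$ ($a\in\mathbb Z/2$), and 2-morphisms $x_a^b:\Pi^aF\Rightarrow\Pi^bG$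 for $x:F\Rightarrow G$, of parity $|x|+a+b$, with $(\Pi^bG)(\Pi^aF)=\Pi^{a+b}(GF)$, $y_b^c\circ x_a^b=(y\circ x)_a^c$ and $y_b^d\,x_a^c=(-1)^{b|x|+|y|c+bc+ab}(yx)_{a+b}^{c+d}$; moreover $\pi_\lambda=\Pi^1 1_\lambda$ and $\zeta_\lambda=(1_{1_\lambda})_1^0$. Let $\mathbb J:\mathfrak A\to\mathfrak A_\pi$, $F\mapsto\Pi^0F$, $x\mapsto x_0^0$. For $\mathbb P:\mathfrak A\to\mathfrak A'$ let $\mathbb P_\pi(\Pi^aF)=\Pi^a(\mathbb PF)$, $\mathbb P_\pi(x_a^b)=(\mathbb Px)_a^b$, and for $(X,x):\mathbb P\Rightarrow\mathbb P'$ let $(X_\pi)_\lambda=\Pi^0X_\lambda$, $(x_\pi)_{\Pi^aF}=(x_F)_a^a$. For $\mathbb R:\mathfrak A\to\nu\mathfrak B$ let $\tilde{\mathbb R}:\mathfrak A_\pi\to\mathfrak B$ be given by $\tilde{\mathbb R}\lambda=\mathbb R\lambda$, $\tilde{\mathbb R}(\Pi^aF)=\pi^a(\mathbb RF)$, $\tilde{\mathbb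 R}(x_a^b)=(\zeta^b(\mathbb RG))^{-1}\circ\mathbb Rx\circ\zeta^a(\mathbb RF)$, with coherence maps $\tilde\imath=i$ and $\tilde c_{\Pi^bG,\Pi^aF}=(-1)^{ab}(\zeta^{a+b}\mathbb R(GF))^{-1}\circ c_{G,F}\circ(\zeta^b\mathbb RG)(\zeta^a\mathbb RF)$. For $(X,x):\mathbb R\Rightarrow\mathbb S$ let $\tilde X_\lambda=X_\lambda$ and $\tilde x_{\Pi^aF}=((\zeta^a\mathbb SF)X_\lambda)^{-1}\circ x_F\circ(X_\mu(\zeta^a\mathbb RF))$. **Theorem.** Let $\mathfrak A$ be a 2-supercategory and $\mathfrak B$ a $\Pi$-2-supercategory. 1. $\tilde{\mathbb R}\,\mathbb J=\mathbb R$ for every $\mathbb R:\mathfrak A\to\nu\mathfrak B$. For every $(X,x):\mathbb R\Rightarrow\mathbb S$, $(\tilde X,\tilde x)$ is the only 2-natural transformation $\tilde{\mathbb R}\Rightarrow\tilde{\mathbb S}$ with $\tilde X_\lambda=X_\lambda$ and $\tilde x_{\Pi^0F}=x_F$ for all $\lambda$, $F$. 2. $\mathbb R\mapsto\tilde{\mathbb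 R}$, $(X,x)\mapsto(\tilde X,\tilde x)$, together with the identity on components of supermodifications, is a 2-superequivalence $\mathcal Hom(\mathfrak A,\nu\mathfrak B)\to\mathcal Hom(\mathfrak A_\pi,\mathfrak B)$. The map $(X,x)\mapsto(\tilde X,\tilde x)$ is bijective from 2-natural transformations $\mathbb R\Rightarrow\mathbb S$ to 2-natural transformations $\tilde{\mathbb R}\Rightarrow\tilde{\mathbb S}$, and strictly preserves identities and composition. If $\mathfrak B$ is strict, $\mathbb R\mapsto\tilde{\mathbb R}$, $(X,x)\mapsto(\tilde X,\tilde x)$ is an equivalence of categories $\mathrm{Hom}(\mathfrak A,\nu\mathfrak B)\to\mathrm{Hom}(\mathfrak A_\pi,\mathfrak B)$. 3. $-_\pi$ is a strict 2-functor: it strictly preserves identities and composites of 2-superfunctors, identities and vertical composites of 2-natural transformations, and composites of 2-natural transformations with 2-superfunctors on either side. 4. (Naturality in $\mathfrak A$.) For $\mathbb P,\mathbb P':\mathfrak A_1\to\mathfrak A$, $X:\mathbb R\Rightarrow\mathbb S$ and $Z:\mathbb P\Rightarrow\mathbb P'$: $(\mathbb R\mathbb P)^\sim=\tilde{\mathbb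 R}\,\mathbb P_\pi$, $(X\mathbb P)^\sim=\tilde X\,\mathbb P_\pi$ and $(\mathbb RZ)^\sim=\tilde{\mathbb R}\,Z_\pi$. 5. (Naturality in $\mathfrak B$.) For every $\Pi$-2-supercategory $\mathfrak C$ and 2-superfunctor $\mathbb Q:\mathfrak B\to\mathfrak C$ there is a 2-natural transformation $\theta_{\mathbb Q,\mathbb R}:(\mathbb Q\mathbb R)^\sim\Rightarrow\mathbb Q\tilde{\mathbb R}$ with identity 1-morphisms and with component at $\Pi^aF$ equal, up to unit isomorphisms, to $(\mathbb Q(\zeta^a\mathbb RF))^{-1}\circ\zeta^a(\mathbb Q\mathbb RF)$. It is strong (its 2-morphism components are isomorphisms) and invertible in $\mathcal Hom(\mathfrak A_\pi,\mathfrak C)$ up to even isomorphism. For $X:\mathbb R\Rightarrow\mathbb S$ and $W:\mathbb Q\Rightarrow\mathbb Q'$, the unit isomorphisms are the components of supermodifications $(\mathbb Q\tilde X)\theta_{\mathbb Q,\mathbb R}\Rrightarrow\theta_{\mathbb Q,\mathbb S}(\mathbb QX)^\sim$ and $(W\tilde{\mathbb R})\theta_{\mathbb Q,\mathbb R}\Rrightarrow\theta_{\mathbb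 Q',\mathbb R}(W\mathbb R)^\sim$. In this sense the equivalences of part 2 are functorial in $\mathfrak A$ and $\mathfrak B$, and $-_\pi$ is left 2-adjoint to the forgetful 2-functor $\nu$. -/

import Mathlib

set_option linter.checkUnivs false
set_option linter.unusedVariables false

open CategoryTheory

universe t u v w u₁ v₁ w₁ u₂ v₂ w₂ u₃ v₃ w₃ u₄ v₄ w₄

namespace TwoSuper

/-- The sign `(-1)^p` attached to a parity `p ∈ ℤ/2`. -/
def sgn (p : ZMod 2) : ℤ := if p = 0 then 1 else -1

@[simp] theorem sgn_zero : sgn 0 = 1 := by decide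

theorem sgn_add (p q : ZMod 2) : sgn (p + q) = sgn p * sgn q := by
  revert p q; decide

theorem sgn_mul_self (p : ZMod 2) : sgn p * sgn p = 1 := by
  revert p; decide

/-- A supercategory over `k`: a `k`-linear category whose morphism spaces are superspaces
`(X ⟶ Y) = par X Y 0 ⊕ par X Y 1`, with even composition. -/
class Supercategory (k : Type t) [CommRing k] (C : Type u) [Category.{v} C] [Preadditive C]
    [Linear k C] where
  /-- `par X Y p` is the space of morphisms of parity `p`. -/
  par : ∀ X Y : C, ZMod 2 → Submodule k (X ⟶ Y)
  isCompl : ∀ X Y : C, IsCompl (par X Y 0) (par X Y 1)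
  id_mem : ∀ X : C, 𝟙 X ∈ par X X 0
  comp_mem : ∀ {X Y Z : C} {p q : ZMod 2} {f : X ⟶ Y} {g : Y ⟶ Z},
    f ∈ par X Y p → g ∈ par Y Z q → f ≫ g ∈ par X Z (p + q)

section Supercategory

variable (k : Type t) [CommRing k] {C : Type u} [Category.{v} C] [Preadditive C] [Linear k C]
  [Supercategory k C]

/-- `HasParity k p f` : the morphism `f` is homogeneous of parity `p`. -/
def HasParity (p : ZMod 2) {X Y : C} (f : X ⟶ Y) : Prop := f ∈ Supercategory.par (k := k) X Y p

variable {k}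

theorem HasParity.id (X : C) : HasParity k 0 (𝟙 X) := Supercategory.id_mem X

theorem HasParity.comp {X Y Z : C} {p q : ZMod 2} {f : X ⟶ Y} {g : Y ⟶ Z}
    (hf : HasParity k p f) (hg : HasParity k q g) : HasParity k (p + q) (f ≫ g) :=
  Supercategory.comp_mem hf hg

theorem HasParity.comp_even {X Y Z : C} {f : X ⟶ Y} {g : Y ⟶ Z}
    (hf : HasParity k 0 f) (hg : HasParity k 0 g) : HasParity k 0 (f ≫ g) := by
  simpa using hf.comp hg

theorem HasParity.zsmul {X Y : C} {p : ZMod 2} {f : X ⟶ Y} (hf : HasParity k p f) (n : ℤ) :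
    HasParity k p (n • f) :=
  zsmul_mem (S := Submodule k (X ⟶ Y)) hf n

theorem HasParity.congr {X Y : C} {p q : ZMod 2} {f : X ⟶ Y} (hf : HasParity k p f)
    (h : p = q) : HasParity k q f := h ▸ hf

theorem exists_decomp {X Y : C} (f : X ⟶ Y) :
    ∃ f₀ f₁ : X ⟶ Y, HasParity k 0 f₀ ∧ HasParity k 1 f₁ ∧ f = f₀ + f₁ := by
  have h : f ∈ Supercategory.par (k := k) X Y 0 ⊔ Supercategory.par X Y 1 := by
    rw [(Supercategory.isCompl X Y).sup_eq_top]; trivial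
  obtain ⟨a, ha, b, hb, rfl⟩ := Submodule.mem_sup.1 h
  exact ⟨a, b, ha, hb, rfl⟩

variable (k) in
theorem hom_induction {X Y : C} {P : (X ⟶ Y) → Prop} (f : X ⟶ Y)
    (h : ∀ (p : ZMod 2) (g : X ⟶ Y), HasParity k p g → P g)
    (hadd : ∀ a b, P a → P b → P (a + b)) : P f := by
  obtain ⟨a, b, ha, hb, rfl⟩ := exists_decomp (k := k) f
  exact hadd _ _ (h 0 a ha) (h 1 b hb)

theorem decomp_unique {X Y : C} {a b a' b' : X ⟶ Y} (ha : HasParity k 0 a)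
    (hb : HasParity k 1 b) (ha' : HasParity k 0 a') (hb' : HasParity k 1 b')
    (h : a + b = a' + b') : a = a' ∧ b = b' := by
  have h1 : a - a' = b' - b := by
    rw [sub_eq_sub_iff_add_eq_add, h]; abel
  have h2 : a - a' ∈ Supercategory.par (k := k) X Y 0 := sub_mem ha ha'
  have h3 : a - a' ∈ Supercategory.par (k := k) X Y 1 := h1 ▸ sub_mem hb' hb
  have h4 : a - a' = 0 :=
    Submodule.disjoint_def.1 (Supercategory.isCompl X Y).disjoint _ h2 h3
  refine ⟨sub_eq_zero.1 h4, ?_⟩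
  rw [h4] at h1
  exact (sub_eq_zero.1 h1.symm).symm

/-- The inverse of a homogeneous isomorphism is homogeneous of the same parity. -/
theorem HasParity.inv {X Y : C} {p : ZMod 2} (e : X ≅ Y) (he : HasParity k p e.hom) :
    HasParity k p e.inv := by
  obtain ⟨a, b, ha, hb, hab⟩ := exists_decomp (k := k) e.inv
  have h1 : e.inv ≫ e.hom = 𝟙 Y := e.inv_hom_id
  rw [hab, Preadditive.add_comp] at h1
  have key : ∀ q : ZMod 2, q = 0 ∨ q = 1 := by decide
  rcases key p with rfl | rfl
  · have := decomp_unique (k := k) (by simpa using ha.comp he) (by simpa using hb.comp he)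
      (HasParity.id Y) (zero_mem (Supercategory.par Y Y 1) : HasParity k 1 (0 : Y ⟶ Y))
      (by simpa using h1)
    have hb0 : b = 0 := by
      have := congrArg (· ≫ e.inv) this.2
      simpa using this
    rw [hab, hb0, add_zero]; exact ha
  · have := decomp_unique (k := k) (a := b ≫ e.hom) (b := a ≫ e.hom)
      ((hb.comp he).congr (by decide)) ((ha.comp he).congr (by decide))
      (HasParity.id Y) (zero_mem (Supercategory.par Y Y 1) : HasParity k 1 (0 : Y ⟶ Y))
      (by rw [add_comm]; simpa using h1)
    have ha0 : a = 0 := by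
      have := congrArg (· ≫ e.inv) this.2
      simpa using this
    rw [hab, ha0, zero_add]; exact hb

end Supercategory

/-- A superfunctor: a `k`-linear functor that preserves parities. -/
structure IsSuperfunctor (k : Type t) [CommRing k] {C : Type u₁} [Category.{v₁} C] [Preadditive C]
    [Linear k C] [Supercategory k C] {D : Type u₂} [Category.{v₂} D] [Preadditive D]
    [Linear k D] [Supercategory k D] (F : C ⥤ D) : Prop where
  map_add : ∀ {X Y : C} (f g : X ⟶ Y), F.map (f + g) = F.map f + F.map g
  map_smul : ∀ {X Y : C} (r : k) (f : X ⟶ Y), F.map (r • f) = r • F.map f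
  map_mem : ∀ {X Y : C} {p : ZMod 2} {f : X ⟶ Y}, HasParity k p f → HasParity k p (F.map f)

/-- A superfunctor `F` is a superequivalence if there is a superfunctor `G` in the other direction
such that `F G` and `G F` are isomorphic to identities via even supernatural transformations. -/
def IsSuperequivalence (k : Type t) [CommRing k] {C : Type u₁} [Category.{v₁} C] [Preadditive C]
    [Linear k C] [Supercategory k C] {D : Type u₂} [Category.{v₂} D] [Preadditive D]
    [Linear k D] [Supercategory k D] (F : C ⥤ D) : Prop :=
  IsSuperfunctor k F ∧ ∃ G : D ⥤ C, IsSuperfunctor k G ∧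
    (∃ e : F ⋙ G ≅ 𝟭 C, ∀ X, HasParity k 0 (e.hom.app X)) ∧
    (∃ e : G ⋙ F ≅ 𝟭 D, ∀ X, HasParity k 0 (e.hom.app X))

/-- A 2-supercategory over `k`. The composite of 1-morphisms `F : a → b` and `G : b → c` is
`comp G F`, and `hcomp y x : comp G F ⟶ comp K H` is the horizontal composite of 2-morphisms
`y : G ⟶ K` and `x : F ⟶ H`. Vertical composition is the composition in the morphism categories
(so `x ≫ u` is `u ∘ x`). The fields `hcomp`, `hcomp_mem`, `hcomp_id`, `interchange` say that
horizontal composition is a superfunctor `Hom(b, c) ⊠ Hom(a, b) → Hom(a, c)`. -/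
structure TwoSupercategory (k : Type t) [CommRing k] where
  Obj : Type u
  Hom : Obj → Obj → Type v
  [cat : ∀ a b, Category.{w} (Hom a b)]
  [preadditive : ∀ a b, Preadditive (Hom a b)]
  [linear : ∀ a b, Linear k (Hom a b)]
  [super : ∀ a b, Supercategory k (Hom a b)]
  one : ∀ a, Hom a a
  comp : ∀ {a b c}, Hom b c → Hom a b → Hom a c
  hcomp : ∀ {a b c} {G K : Hom b c} {F H : Hom a b},
    (G ⟶ K) →ₗ[k] (F ⟶ H) →ₗ[k] (comp G F ⟶ comp K H)
  hcomp_mem : ∀ {a b c} {G K : Hom b c} {F H : Hom a b} {p q : ZMod 2} {y : G ⟶ K} {x : F ⟶ H},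
    HasParity k p y → HasParity k q x → HasParity k (p + q) (hcomp y x)
  hcomp_id : ∀ {a b c} (G : Hom b c) (F : Hom a b), hcomp (𝟙 G) (𝟙 F) = 𝟙 (comp G F)
  interchange : ∀ {a b c} {G K N : Hom b c} {F H M : Hom a b} {p q : ZMod 2}
    (y : G ⟶ K) (v : K ⟶ N) (x : F ⟶ H) (u : H ⟶ M), HasParity k p u → HasParity k q y →
    hcomp y x ≫ hcomp v u = sgn (p * q) • hcomp (y ≫ v) (x ≫ u)
  assoc : ∀ {a b c d} (H : Hom c d) (G : Hom b c) (F : Hom a b),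
    comp (comp H G) F ≅ comp H (comp G F)
  assoc_mem : ∀ {a b c d} (H : Hom c d) (G : Hom b c) (F : Hom a b),
    HasParity k 0 (assoc H G F).hom
  assoc_naturality : ∀ {a b c d} {H H' : Hom c d} {G G' : Hom b c} {F F' : Hom a b}
    (z : H ⟶ H') (y : G ⟶ G') (x : F ⟶ F'),
    hcomp (hcomp z y) x ≫ (assoc H' G' F').hom = (assoc H G F).hom ≫ hcomp z (hcomp y x)
  lunit : ∀ {a b} (F : Hom a b), comp (one b) F ≅ F
  lunit_mem : ∀ {a b} (F : Hom a b), HasParity k 0 (lunit F).hom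
  lunit_naturality : ∀ {a b} {F G : Hom a b} (x : F ⟶ G),
    hcomp (𝟙 (one b)) x ≫ (lunit G).hom = (lunit F).hom ≫ x
  runit : ∀ {a b} (F : Hom a b), comp F (one a) ≅ F
  runit_mem : ∀ {a b} (F : Hom a b), HasParity k 0 (runit F).hom
  runit_naturality : ∀ {a b} {F G : Hom a b} (x : F ⟶ G),
    hcomp x (𝟙 (one a)) ≫ (runit G).hom = (runit F).hom ≫ x
  pentagon : ∀ {a b c d e} (K : Hom d e) (H : Hom c d) (G : Hom b c) (F : Hom a b),
    hcomp (assoc K H G).hom (𝟙 F) ≫ (assoc K (comp H G) F).hom ≫ hcomp (𝟙 K) (assoc H G F).hom =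
      (assoc (comp K H) G F).hom ≫ (assoc K H (comp G F)).hom
  triangle : ∀ {a b c} (G : Hom b c) (F : Hom a b),
    (assoc G (one b) F).hom ≫ hcomp (𝟙 G) (lunit F).hom = hcomp (runit G).hom (𝟙 F)

attribute [instance] TwoSupercategory.cat TwoSupercategory.preadditive TwoSupercategory.linear
  TwoSupercategory.super

namespace TwoSupercategory

variable {k : Type t} [CommRing k] (𝔄 : TwoSupercategory.{t, u, v, w} k)

variable {𝔄} {a b c d e : 𝔄.Obj}

theorem hcomp_comp_even_right {G K N : 𝔄.Hom b c} {F H M : 𝔄.Hom a b} (y : G ⟶ K) (v : K ⟶ N)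
    (x : F ⟶ H) (u : H ⟶ M) (hu : HasParity k 0 u) :
    𝔄.hcomp y x ≫ 𝔄.hcomp v u = 𝔄.hcomp (y ≫ v) (x ≫ u) := by
  refine hom_induction k (P := fun y : G ⟶ K =>
    𝔄.hcomp y x ≫ 𝔄.hcomp v u = 𝔄.hcomp (y ≫ v) (x ≫ u)) y ?_ ?_
  · intro p g hg
    rw [𝔄.interchange g v x u hu hg]; simp
  · intro f g hf hg
    simp [Preadditive.add_comp, hf, hg]

theorem hcomp_comp_even_left {G K N : 𝔄.Hom b c} {F H M : 𝔄.Hom a b} (y : G ⟶ K) (v : K ⟶ N)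
    (x : F ⟶ H) (u : H ⟶ M) (hy : HasParity k 0 y) :
    𝔄.hcomp y x ≫ 𝔄.hcomp v u = 𝔄.hcomp (y ≫ v) (x ≫ u) := by
  refine hom_induction k (P := fun u : H ⟶ M =>
    𝔄.hcomp y x ≫ 𝔄.hcomp v u = 𝔄.hcomp (y ≫ v) (x ≫ u)) u ?_ ?_
  · intro p g hg
    rw [𝔄.interchange y v x g hg hy]; simp
  · intro f g hf hg
    simp [Preadditive.comp_add, hf, hg]

theorem hcomp_mem_even {G K : 𝔄.Hom b c} {F H : 𝔄.Hom a b} {y : G ⟶ K} {x : F ⟶ H}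
    (hy : HasParity k 0 y) (hx : HasParity k 0 x) : HasParity k 0 (𝔄.hcomp y x) := by
  simpa using 𝔄.hcomp_mem hy hx

/-- The horizontal composite of two even 2-isomorphisms. -/
def hcompIso {G K : 𝔄.Hom b c} {F H : 𝔄.Hom a b} (y : G ≅ K) (x : F ≅ H)
    (hy : HasParity k 0 y.hom) (hx : HasParity k 0 x.hom) : 𝔄.comp G F ≅ 𝔄.comp K H where
  hom := 𝔄.hcomp y.hom x.hom
  inv := 𝔄.hcomp y.inv x.inv
  hom_inv_id := by rw [hcomp_comp_even_left _ _ _ _ hy]; simp [𝔄.hcomp_id]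
  inv_hom_id := by rw [hcomp_comp_even_left _ _ _ _ (HasParity.inv y hy)]; simp [𝔄.hcomp_id]

theorem whiskerL_comp (G : 𝔄.Hom b c) {F H M : 𝔄.Hom a b} (x : F ⟶ H) (u : H ⟶ M) :
    𝔄.hcomp (𝟙 G) (x ≫ u) = 𝔄.hcomp (𝟙 G) x ≫ 𝔄.hcomp (𝟙 G) u := by
  rw [hcomp_comp_even_left _ _ _ _ (HasParity.id G), Category.id_comp]

theorem whiskerR_comp {G K N : 𝔄.Hom b c} (F : 𝔄.Hom a b) (y : G ⟶ K) (v : K ⟶ N) :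
    𝔄.hcomp (y ≫ v) (𝟙 F) = 𝔄.hcomp y (𝟙 F) ≫ 𝔄.hcomp v (𝟙 F) := by
  rw [hcomp_comp_even_right _ _ _ _ (HasParity.id F), Category.id_comp]

theorem hcomp_eq {G K : 𝔄.Hom b c} {F H : 𝔄.Hom a b} (y : G ⟶ K) (x : F ⟶ H) :
    𝔄.hcomp y x = 𝔄.hcomp (𝟙 G) x ≫ 𝔄.hcomp y (𝟙 H) := by
  rw [hcomp_comp_even_right _ _ _ _ (HasParity.id H), Category.id_comp, Category.comp_id]

theorem whisker_exchange_even {G K : 𝔄.Hom b c} {F H : 𝔄.Hom a b} (y : G ⟶ K) (x : F ⟶ H)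
    (hy : HasParity k 0 y) :
    𝔄.hcomp (𝟙 G) x ≫ 𝔄.hcomp y (𝟙 H) = 𝔄.hcomp y (𝟙 F) ≫ 𝔄.hcomp (𝟙 K) x := by
  rw [← hcomp_eq, hcomp_comp_even_left _ _ _ _ hy, Category.id_comp, Category.comp_id]

theorem assoc_inv_naturality {H H' : 𝔄.Hom c d} {G G' : 𝔄.Hom b c} {F F' : 𝔄.Hom a b}
    (z : H ⟶ H') (y : G ⟶ G') (x : F ⟶ F') :
    𝔄.hcomp z (𝔄.hcomp y x) ≫ (𝔄.assoc H' G' F').inv =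
      (𝔄.assoc H G F).inv ≫ 𝔄.hcomp (𝔄.hcomp z y) x := by
  rw [Iso.comp_inv_eq, Category.assoc, 𝔄.assoc_naturality, Iso.inv_hom_id_assoc]

/-- Auxiliary: the objects of a 2-supercategory, seen as objects of the bicategory whose
2-morphisms are the even ones. It is used in proofs only. -/
structure Ev (𝔄 : TwoSupercategory.{t, u, v, w} k) where
  of : 𝔄.Obj

/-- Auxiliary: 1-morphisms of the bicategory of even 2-morphisms. -/
structure EvHom (𝔄 : TwoSupercategory.{t, u, v, w} k) (a b : Ev 𝔄) where
  of : 𝔄.Hom a.of b.of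

instance (a b : Ev 𝔄) : Category (EvHom 𝔄 a b) where
  Hom F G := {x : F.of ⟶ G.of // HasParity k 0 x}
  id F := ⟨𝟙 F.of, HasParity.id _⟩
  comp x y := ⟨x.1 ≫ y.1, x.2.comp_even y.2⟩

/-- Auxiliary: an even isomorphism as an isomorphism of even 2-morphisms. -/
def evIso {a b : Ev 𝔄} {F G : EvHom 𝔄 a b} (x : F.of ≅ G.of)
    (hx : HasParity k 0 x.hom) : F ≅ G where
  hom := ⟨x.hom, hx⟩
  inv := ⟨x.inv, HasParity.inv x hx⟩
  hom_inv_id := Subtype.ext x.hom_inv_id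
  inv_hom_id := Subtype.ext x.inv_hom_id

theorem hcomp_id_comp (G : 𝔄.Hom c d) (F : 𝔄.Hom b c) {x y : 𝔄.Hom a b} (f : x ⟶ y) :
    𝔄.hcomp (𝟙 (𝔄.comp G F)) f =
      (𝔄.assoc G F x).hom ≫ 𝔄.hcomp (𝟙 G) (𝔄.hcomp (𝟙 F) f) ≫ (𝔄.assoc G F y).inv := by
  rw [← 𝔄.hcomp_id, ← Category.assoc, Iso.eq_comp_inv, 𝔄.assoc_naturality]

theorem hcomp_comp_id (G : 𝔄.Hom b c) (F : 𝔄.Hom a b) {x y : 𝔄.Hom c d} (f : x ⟶ y) :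
    𝔄.hcomp f (𝟙 (𝔄.comp G F)) =
      (𝔄.assoc x G F).inv ≫ 𝔄.hcomp (𝔄.hcomp f (𝟙 G)) (𝟙 F) ≫ (𝔄.assoc y G F).hom := by
  rw [← 𝔄.hcomp_id, Iso.eq_inv_comp, 𝔄.assoc_naturality]

/-- Auxiliary: the bicategory of even 2-morphisms. -/
instance evBicategory (𝔄 : TwoSupercategory.{t, u, v, w} k) : Bicategory (Ev 𝔄) where
  Hom a b := EvHom 𝔄 a b
  id a := ⟨𝔄.one a.of⟩
  comp F G := ⟨𝔄.comp G.of F.of⟩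
  homCategory a b := inferInstance
  whiskerLeft F _ _ y := ⟨𝔄.hcomp y.1 (𝟙 F.of), hcomp_mem_even y.2 (HasParity.id _)⟩
  whiskerRight x H := ⟨𝔄.hcomp (𝟙 H.of) x.1, hcomp_mem_even (HasParity.id _) x.2⟩
  associator F G H := (evIso (G := ⟨_⟩) (F := ⟨_⟩) (𝔄.assoc H.of G.of F.of) (𝔄.assoc_mem _ _ _)).symm
  leftUnitor F := evIso (𝔄.runit F.of) (𝔄.runit_mem _)
  rightUnitor F := evIso (𝔄.lunit F.of) (𝔄.lunit_mem _)
  whiskerLeft_id F G := Subtype.ext (𝔄.hcomp_id _ _)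
  whiskerLeft_comp F _ _ _ x y := Subtype.ext (whiskerR_comp _ _ _)
  id_whiskerLeft x := Subtype.ext <| by
    exact (Iso.eq_comp_inv (𝔄.runit _)).2 (𝔄.runit_naturality _) |>.trans (Category.assoc _ _ _)
  comp_whiskerLeft F G _ _ x := Subtype.ext (hcomp_comp_id _ _ _)
  id_whiskerRight F G := Subtype.ext (𝔄.hcomp_id _ _)
  comp_whiskerRight x y F := Subtype.ext (whiskerL_comp _ _ _)
  whiskerRight_id x := Subtype.ext <| by
    exact (Iso.eq_comp_inv (𝔄.lunit _)).2 (𝔄.lunit_naturality _) |>.trans (Category.assoc _ _ _)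
  whiskerRight_comp x G H := Subtype.ext (hcomp_id_comp _ _ _)
  whisker_assoc F _ _ x H := Subtype.ext <| by
    change 𝔄.hcomp _ (𝔄.hcomp _ _) = (𝔄.assoc _ _ _).inv ≫ 𝔄.hcomp (𝔄.hcomp _ _) _ ≫ _
    rw [Iso.eq_inv_comp]; exact (𝔄.assoc_naturality _ _ _).symm
  whisker_exchange x y := Subtype.ext (whisker_exchange_even _ _ y.2).symm
  pentagon F G H K := Subtype.ext <| by
    change 𝔄.hcomp _ (𝔄.assoc _ _ _).inv ≫ (𝔄.assoc _ _ _).inv ≫ 𝔄.hcomp (𝔄.assoc _ _ _).inv _ =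
      (𝔄.assoc _ _ _).inv ≫ (𝔄.assoc _ _ _).inv
    have h := 𝔄.pentagon K.of H.of G.of F.of
    have h1 := congrArg Iso.inv (a₁ := hcompIso (𝔄.assoc K.of H.of G.of) (Iso.refl F.of)
        (𝔄.assoc_mem _ _ _) (HasParity.id _) ≪≫ 𝔄.assoc _ _ _ ≪≫
        hcompIso (Iso.refl K.of) (𝔄.assoc H.of G.of F.of) (HasParity.id _) (𝔄.assoc_mem _ _ _))
        (a₂ := 𝔄.assoc _ _ _ ≪≫ 𝔄.assoc _ _ _) (Iso.ext h)
    simpa [hcompIso] using h1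
  triangle F G := Subtype.ext <| by
    change (𝔄.assoc _ _ _).inv ≫ 𝔄.hcomp (𝔄.runit _).hom _ = 𝔄.hcomp _ (𝔄.lunit _).hom
    rw [Iso.inv_comp_eq]; exact (𝔄.triangle _ _).symm

end TwoSupercategory

/-- A 2-superfunctor between 2-supercategories. The fields from `map₂_id` to `map₂_mem` say that
it is given by superfunctors on the morphism supercategories; the coherence maps `c` are even
supernatural isomorphisms and the coherence maps `i` are even 2-isomorphisms. -/
structure TwoSuperfunctor {k : Type t} [CommRing k] (𝔄 : TwoSupercategory.{t, u₁, v₁, w₁} k)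
    (𝔅 : TwoSupercategory.{t, u₂, v₂, w₂} k) where
  obj : 𝔄.Obj → 𝔅.Obj
  map₁ : ∀ {a b}, 𝔄.Hom a b → 𝔅.Hom (obj a) (obj b)
  map₂ : ∀ {a b} {F G : 𝔄.Hom a b}, (F ⟶ G) → (map₁ F ⟶ map₁ G)
  map₂_id : ∀ {a b} (F : 𝔄.Hom a b), map₂ (𝟙 F) = 𝟙 (map₁ F)
  map₂_comp : ∀ {a b} {F G H : 𝔄.Hom a b} (x : F ⟶ G) (y : G ⟶ H),
    map₂ (x ≫ y) = map₂ x ≫ map₂ y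
  map₂_add : ∀ {a b} {F G : 𝔄.Hom a b} (x y : F ⟶ G), map₂ (x + y) = map₂ x + map₂ y
  map₂_smul : ∀ {a b} {F G : 𝔄.Hom a b} (r : k) (x : F ⟶ G), map₂ (r • x) = r • map₂ x
  map₂_mem : ∀ {a b} {F G : 𝔄.Hom a b} {p : ZMod 2} {x : F ⟶ G},
    HasParity k p x → HasParity k p (map₂ x)
  c : ∀ {a b d} (G : 𝔄.Hom b d) (F : 𝔄.Hom a b),
    𝔅.comp (map₁ G) (map₁ F) ≅ map₁ (𝔄.comp G F)
  c_mem : ∀ {a b d} (G : 𝔄.Hom b d) (F : 𝔄.Hom a b), HasParity k 0 (c G F).hom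
  c_naturality : ∀ {a b d} {G K : 𝔄.Hom b d} {F H : 𝔄.Hom a b} (y : G ⟶ K) (x : F ⟶ H),
    𝔅.hcomp (map₂ y) (map₂ x) ≫ (c K H).hom = (c G F).hom ≫ map₂ (𝔄.hcomp y x)
  i : ∀ a, 𝔅.one (obj a) ≅ map₁ (𝔄.one a)
  i_mem : ∀ a, HasParity k 0 (i a).hom
  assoc : ∀ {a b d e} (H : 𝔄.Hom d e) (G : 𝔄.Hom b d) (F : 𝔄.Hom a b),
    𝔅.hcomp (c H G).hom (𝟙 (map₁ F)) ≫ (c (𝔄.comp H G) F).hom ≫ map₂ (𝔄.assoc H G F).hom =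
      (𝔅.assoc (map₁ H) (map₁ G) (map₁ F)).hom ≫ 𝔅.hcomp (𝟙 (map₁ H)) (c G F).hom ≫
        (c H (𝔄.comp G F)).hom
  runit : ∀ {a b} (F : 𝔄.Hom a b),
    𝔅.hcomp (𝟙 (map₁ F)) (i a).hom ≫ (c F (𝔄.one a)).hom ≫ map₂ (𝔄.runit F).hom =
      (𝔅.runit (map₁ F)).hom
  lunit : ∀ {a b} (F : 𝔄.Hom a b),
    𝔅.hcomp (i b).hom (𝟙 (map₁ F)) ≫ (c (𝔄.one b) F).hom ≫ map₂ (𝔄.lunit F).hom =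
      (𝔅.lunit (map₁ F)).hom

namespace TwoSuperfunctor

variable {k : Type t} [CommRing k] {𝔄 : TwoSupercategory.{t, u₁, v₁, w₁} k}
  {𝔅 : TwoSupercategory.{t, u₂, v₂, w₂} k} {ℭ : TwoSupercategory.{t, u₃, v₃, w₃} k}

theorem map₂_zsmul (R : TwoSuperfunctor 𝔄 𝔅) {a b : 𝔄.Obj} {F G : 𝔄.Hom a b} (n : ℤ)
    (x : F ⟶ G) : R.map₂ (n • x) = n • R.map₂ x :=
  map_zsmul (AddMonoidHom.mk' (fun x : F ⟶ G => R.map₂ x) R.map₂_add) n x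

theorem assoc_inv_c (R : TwoSuperfunctor 𝔄 𝔅) {a b d e : 𝔄.Obj} (H : 𝔄.Hom d e) (G : 𝔄.Hom b d)
    (F : 𝔄.Hom a b) : (𝔅.assoc (R.map₁ H) (R.map₁ G) (R.map₁ F)).inv ≫
      𝔅.hcomp (R.c H G).hom (𝟙 (R.map₁ F)) ≫ (R.c (𝔄.comp H G) F).hom =
    𝔅.hcomp (𝟙 (R.map₁ H)) (R.c G F).hom ≫ (R.c H (𝔄.comp G F)).hom ≫
      R.map₂ (𝔄.assoc H G F).inv := by
  have h := R.assoc H G F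
  rw [Iso.inv_comp_eq, ← reassoc_of% h, ← R.map₂_comp, Iso.hom_inv_id, R.map₂_id,
    Category.comp_id]

/-- The image of a 2-isomorphism. -/
def mapIso (R : TwoSuperfunctor 𝔄 𝔅) {a b : 𝔄.Obj} {F G : 𝔄.Hom a b} (x : F ≅ G) :
    R.map₁ F ≅ R.map₁ G where
  hom := R.map₂ x.hom
  inv := R.map₂ x.inv
  hom_inv_id := by rw [← R.map₂_comp, x.hom_inv_id, R.map₂_id]
  inv_hom_id := by rw [← R.map₂_comp, x.inv_hom_id, R.map₂_id]

/-- The functor that a 2-superfunctor induces on a morphism supercategory. -/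
def homFunctor (R : TwoSuperfunctor 𝔄 𝔅) (a b : 𝔄.Obj) :
    𝔄.Hom a b ⥤ 𝔅.Hom (R.obj a) (R.obj b) where
  obj F := R.map₁ F
  map x := R.map₂ x
  map_id F := R.map₂_id F
  map_comp x y := R.map₂_comp x y

/-- The identity 2-superfunctor. -/
def id (𝔄 : TwoSupercategory.{t, u₁, v₁, w₁} k) : TwoSuperfunctor 𝔄 𝔄 where
  obj a := a
  map₁ F := F
  map₂ x := x
  map₂_id _ := rfl
  map₂_comp _ _ := rfl
  map₂_add _ _ := rfl
  map₂_smul _ _ := rfl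
  map₂_mem h := h
  c G F := Iso.refl _
  c_mem _ _ := HasParity.id _
  c_naturality y x := by simp
  i a := Iso.refl _
  i_mem _ := HasParity.id _
  assoc H G F := by simp [𝔄.hcomp_id]
  runit F := by simp [𝔄.hcomp_id]
  lunit F := by simp [𝔄.hcomp_id]

/-- The composite `Q ∘ R` of 2-superfunctors. -/
def comp (Q : TwoSuperfunctor 𝔅 ℭ) (R : TwoSuperfunctor 𝔄 𝔅) : TwoSuperfunctor 𝔄 ℭ where
  obj a := Q.obj (R.obj a)
  map₁ F := Q.map₁ (R.map₁ F)
  map₂ x := Q.map₂ (R.map₂ x)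
  map₂_id F := by rw [R.map₂_id, Q.map₂_id]
  map₂_comp x y := by rw [R.map₂_comp, Q.map₂_comp]
  map₂_add x y := by rw [R.map₂_add, Q.map₂_add]
  map₂_smul r x := by rw [R.map₂_smul, Q.map₂_smul]
  map₂_mem h := Q.map₂_mem (R.map₂_mem h)
  c G F := Q.c (R.map₁ G) (R.map₁ F) ≪≫ Q.mapIso (R.c G F)
  c_mem G F := (Q.c_mem _ _).comp_even (Q.map₂_mem (R.c_mem G F))
  c_naturality y x := by
    simp only [Iso.trans_hom, mapIso, Category.assoc]
    rw [← Q.map₂_comp, ← R.c_naturality, Q.map₂_comp, ← Category.assoc, ← Category.assoc,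
      Q.c_naturality]
  i a := Q.i (R.obj a) ≪≫ Q.mapIso (R.i a)
  i_mem a := (Q.i_mem _).comp_even (Q.map₂_mem (R.i_mem a))
  assoc H G F := by
    simp only [Iso.trans_hom, mapIso, TwoSupercategory.whiskerL_comp,
      TwoSupercategory.whiskerR_comp, Category.assoc]
    have h1 := Q.c_naturality (R.c H G).hom (𝟙 (R.map₁ F))
    have h2 := Q.c_naturality (𝟙 (R.map₁ H)) (R.c G F).hom
    rw [Q.map₂_id] at h1 h2
    have h3 := congrArg Q.map₂ (R.assoc H G F)
    rw [Q.map₂_comp, Q.map₂_comp, Q.map₂_comp, Q.map₂_comp] at h3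
    rw [reassoc_of% h1, h3, reassoc_of% Q.assoc, reassoc_of% h2]
  runit F := by
    simp only [Iso.trans_hom, mapIso, TwoSupercategory.whiskerL_comp, Category.assoc]
    have h2 := Q.c_naturality (𝟙 (R.map₁ F)) (R.i _).hom
    rw [Q.map₂_id] at h2
    rw [reassoc_of% h2, ← Q.map₂_comp, ← Q.map₂_comp, R.runit, Q.runit]
  lunit F := by
    simp only [Iso.trans_hom, mapIso, TwoSupercategory.whiskerR_comp, Category.assoc]
    have h2 := Q.c_naturality (R.i _).hom (𝟙 (R.map₁ F))
    rw [Q.map₂_id] at h2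
    rw [reassoc_of% h2, ← Q.map₂_comp, ← Q.map₂_comp, R.lunit, Q.lunit]

end TwoSuperfunctor

section BicategoryLemmas

open Bicategory

variable {B : Type u} [Bicategory.{w, v} B]

theorem bicat_vcomp_comp {ra rb rc sa sb sc ta tb tc : B}
    {rf : ra ⟶ rb} {rg : rb ⟶ rc} {rgf : ra ⟶ rc} (cr : rf ≫ rg ⟶ rgf)
    {sf : sa ⟶ sb} {sg : sb ⟶ sc} {sgf : sa ⟶ sc} (cs : sf ≫ sg ⟶ sgf)
    {tf : ta ⟶ tb} {tg : tb ⟶ tc} {tgf : ta ⟶ tc} (ct : tf ≫ tg ⟶ tgf)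
    {Xa : ra ⟶ sa} {Xb : rb ⟶ sb} {Xc : rc ⟶ sc}
    {Ya : sa ⟶ ta} {Yb : sb ⟶ tb} {Yc : sc ⟶ tc}
    (xf : rf ≫ Xb ⟶ Xa ≫ sf) (xg : rg ≫ Xc ⟶ Xb ≫ sg) (xgf : rgf ≫ Xc ⟶ Xa ≫ sgf)
    (yf : sf ≫ Yb ⟶ Ya ≫ tf) (yg : sg ≫ Yc ⟶ Yb ≫ tg) (ygf : sgf ≫ Yc ⟶ Ya ≫ tgf)
    (hx : cr ▷ Xc ≫ xgf = (α_ _ _ _).hom ≫ rf ◁ xg ≫ (α_ _ _ _).inv ≫ xf ▷ sg ≫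
      (α_ _ _ _).hom ≫ Xa ◁ cs)
    (hy : cs ▷ Yc ≫ ygf = (α_ _ _ _).hom ≫ sf ◁ yg ≫ (α_ _ _ _).inv ≫ yf ▷ tg ≫
      (α_ _ _ _).hom ≫ Ya ◁ ct) :
    cr ▷ (Xc ≫ Yc) ≫ ((α_ _ _ _).inv ≫ xgf ▷ Yc ≫ (α_ _ _ _).hom ≫ Xa ◁ ygf ≫
        (α_ _ _ _).inv) =
      (α_ _ _ _).hom ≫ rf ◁ ((α_ _ _ _).inv ≫ xg ▷ Yc ≫ (α_ _ _ _).hom ≫ Xb ◁ yg ≫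
        (α_ _ _ _).inv) ≫ (α_ _ _ _).inv ≫ ((α_ _ _ _).inv ≫ xf ▷ Yb ≫ (α_ _ _ _).hom ≫
        Xa ◁ yf ≫ (α_ _ _ _).inv) ▷ tg ≫ (α_ _ _ _).hom ≫ (Xa ≫ Ya) ◁ ct := by
  calc
    _ = 𝟙 _ ⊗≫ (cr ▷ Xc ≫ xgf) ▷ Yc ⊗≫ Xa ◁ ygf ⊗≫ 𝟙 _ := by bicategory
    _ = 𝟙 _ ⊗≫ rf ◁ xg ▷ Yc ⊗≫ xf ▷ sg ▷ Yc ⊗≫ Xa ◁ (cs ▷ Yc ≫ ygf) ⊗≫ 𝟙 _ := by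
      rw [hx]; bicategory
    _ = 𝟙 _ ⊗≫ rf ◁ xg ▷ Yc ⊗≫ (xf ▷ (sg ≫ Yc) ≫ (Xa ≫ sf) ◁ yg) ⊗≫ Xa ◁ yf ▷ tg ⊗≫
        Xa ◁ Ya ◁ ct ⊗≫ 𝟙 _ := by
      rw [hy]; bicategory
    _ = _ := by
      rw [← whisker_exchange]; bicategory

theorem bicat_vcomp_unit {ra sa ta : B} {rf : ra ⟶ ra} (ir : 𝟙 ra ⟶ rf) {sf : sa ⟶ sa}
    (is : 𝟙 sa ⟶ sf) {tf : ta ⟶ ta} (it : 𝟙 ta ⟶ tf) {Xa : ra ⟶ sa} {Ya : sa ⟶ ta}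
    (xf : rf ≫ Xa ⟶ Xa ≫ sf) (yf : sf ≫ Ya ⟶ Ya ≫ tf)
    (hx : (ρ_ Xa).hom ≫ (λ_ Xa).inv ≫ ir ▷ Xa ≫ xf = Xa ◁ is)
    (hy : (ρ_ Ya).hom ≫ (λ_ Ya).inv ≫ is ▷ Ya ≫ yf = Ya ◁ it) :
    (ρ_ (Xa ≫ Ya)).hom ≫ (λ_ (Xa ≫ Ya)).inv ≫ ir ▷ (Xa ≫ Ya) ≫
      ((α_ _ _ _).inv ≫ xf ▷ Ya ≫ (α_ _ _ _).hom ≫ Xa ◁ yf ≫ (α_ _ _ _).inv) =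
    (Xa ≫ Ya) ◁ it := by
  calc
    _ = 𝟙 _ ⊗≫ ((ρ_ Xa).hom ≫ (λ_ Xa).inv ≫ ir ▷ Xa ≫ xf) ▷ Ya ⊗≫ Xa ◁ yf ⊗≫ 𝟙 _ := by
      bicategory
    _ = 𝟙 _ ⊗≫ Xa ◁ ((ρ_ Ya).hom ≫ (λ_ Ya).inv ≫ is ▷ Ya ≫ yf) ⊗≫ 𝟙 _ := by
      rw [hx]; bicategory
    _ = _ := by
      rw [hy]; bicategory

/-- Post-composition of an oplax transformation with a lax functor, compatibility with
composition. -/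
theorem bicat_id_comp {ra rb rc : B} {rf : ra ⟶ rb} {rg : rb ⟶ rc} {rgf : ra ⟶ rc}
    (cr : rf ≫ rg ⟶ rgf) :
    cr ▷ 𝟙 rc ≫ (ρ_ rgf).hom ≫ (λ_ rgf).inv =
      (α_ _ _ _).hom ≫ rf ◁ ((ρ_ rg).hom ≫ (λ_ rg).inv) ≫ (α_ _ _ _).inv ≫
        ((ρ_ rf).hom ≫ (λ_ rf).inv) ▷ rg ≫ (α_ _ _ _).hom ≫ 𝟙 ra ◁ cr := by
  bicategory

theorem bicat_id_unit {ra : B} {rf : ra ⟶ ra} (ir : 𝟙 ra ⟶ rf) :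
    (ρ_ (𝟙 ra)).hom ≫ (λ_ (𝟙 ra)).inv ≫ ir ▷ 𝟙 ra ≫ (ρ_ rf).hom ≫ (λ_ rf).inv =
      𝟙 ra ◁ ir := by
  bicategory

theorem bicat_assoc_mod {ra rb sa sb ta tb ua ub : B} {rf : ra ⟶ rb} {sf : sa ⟶ sb}
    {tf : ta ⟶ tb} {uf : ua ⟶ ub} {Xa : ra ⟶ sa} {Xb : rb ⟶ sb} {Ya : sa ⟶ ta} {Yb : sb ⟶ tb}
    {Za : ta ⟶ ua} {Zb : tb ⟶ ub}
    (xf : rf ≫ Xb ⟶ Xa ≫ sf) (yf : sf ≫ Yb ⟶ Ya ≫ tf) (zf : tf ≫ Zb ⟶ Za ≫ uf) :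
    ((α_ _ _ _).inv ≫ xf ▷ (Yb ≫ Zb) ≫ (α_ _ _ _).hom ≫
      Xa ◁ ((α_ _ _ _).inv ≫ yf ▷ Zb ≫ (α_ _ _ _).hom ≫ Ya ◁ zf ≫ (α_ _ _ _).inv) ≫
        (α_ _ _ _).inv) ≫ (α_ Xa Ya Za).inv ▷ uf =
    rf ◁ (α_ Xb Yb Zb).inv ≫ ((α_ _ _ _).inv ≫ ((α_ _ _ _).inv ≫ xf ▷ Yb ≫ (α_ _ _ _).hom ≫
      Xa ◁ yf ≫ (α_ _ _ _).inv) ▷ Zb ≫ (α_ _ _ _).hom ≫ (Xa ≫ Ya) ◁ zf ≫ (α_ _ _ _).inv) := by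
  bicategory

theorem bicat_lunit_mod {ra rb sa sb : B} {rf : ra ⟶ rb} {sf : sa ⟶ sb} {Xa : ra ⟶ sa}
    {Xb : rb ⟶ sb} (xf : rf ≫ Xb ⟶ Xa ≫ sf) :
    ((α_ _ _ _).inv ≫ ((ρ_ rf).hom ≫ (λ_ rf).inv) ▷ Xb ≫ (α_ _ _ _).hom ≫ 𝟙 ra ◁ xf ≫
      (α_ _ _ _).inv) ≫ (λ_ Xa).hom ▷ sf = rf ◁ (λ_ Xb).hom ≫ xf := by
  bicategory

theorem bicat_runit_mod {ra rb sa sb : B} {rf : ra ⟶ rb} {sf : sa ⟶ sb} {Xa : ra ⟶ sa}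
    {Xb : rb ⟶ sb} (xf : rf ≫ Xb ⟶ Xa ≫ sf) :
    ((α_ _ _ _).inv ≫ xf ▷ 𝟙 sb ≫ (α_ _ _ _).hom ≫ Xa ◁ ((ρ_ sf).hom ≫ (λ_ sf).inv) ≫
      (α_ _ _ _).inv) ≫ (ρ_ Xa).hom ▷ sf = rf ◁ (ρ_ Xb).hom ≫ xf := by
  bicategory

end BicategoryLemmas

/-- A 2-natural transformation between 2-superfunctors `R S : 𝔄 → 𝔅`: 1-morphisms
`X a : R a → S a` and even supernatural transformations `x : X (R -) ⇒ (S -) X`, compatible with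
horizontal composition and with units. -/
structure TwoNatTrans {k : Type t} [CommRing k] {𝔄 : TwoSupercategory.{t, u₁, v₁, w₁} k}
    {𝔅 : TwoSupercategory.{t, u₂, v₂, w₂} k} (R S : TwoSuperfunctor 𝔄 𝔅) where
  X : ∀ a, 𝔅.Hom (R.obj a) (S.obj a)
  x : ∀ {a b} (F : 𝔄.Hom a b), 𝔅.comp (X b) (R.map₁ F) ⟶ 𝔅.comp (S.map₁ F) (X a)
  x_mem : ∀ {a b} (F : 𝔄.Hom a b), HasParity k 0 (x F)
  x_naturality : ∀ {a b} {F G : 𝔄.Hom a b} (f : F ⟶ G),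
    𝔅.hcomp (𝟙 (X b)) (R.map₂ f) ≫ x G = x F ≫ 𝔅.hcomp (S.map₂ f) (𝟙 (X a))
  x_comp : ∀ {a b d} (G : 𝔄.Hom b d) (F : 𝔄.Hom a b),
    𝔅.hcomp (𝟙 (X d)) (R.c G F).hom ≫ x (𝔄.comp G F) =
      (𝔅.assoc (X d) (R.map₁ G) (R.map₁ F)).inv ≫ 𝔅.hcomp (x G) (𝟙 (R.map₁ F)) ≫
        (𝔅.assoc (S.map₁ G) (X b) (R.map₁ F)).hom ≫ 𝔅.hcomp (𝟙 (S.map₁ G)) (x F) ≫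
        (𝔅.assoc (S.map₁ G) (S.map₁ F) (X a)).inv ≫ 𝔅.hcomp (S.c G F).hom (𝟙 (X a))
  x_unit : ∀ a, (𝔅.lunit (X a)).hom ≫ (𝔅.runit (X a)).inv ≫
      𝔅.hcomp (𝟙 (X a)) (R.i a).hom ≫ x (𝔄.one a) = 𝔅.hcomp (S.i a).hom (𝟙 (X a))

namespace TwoNatTrans

variable {k : Type t} [CommRing k] {𝔄 : TwoSupercategory.{t, u₁, v₁, w₁} k}
  {𝔅 : TwoSupercategory.{t, u₂, v₂, w₂} k} {ℭ : TwoSupercategory.{t, u₃, v₃, w₃} k}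
  {R S T : TwoSuperfunctor 𝔄 𝔅}

/-- A 2-natural transformation is strong if all its 2-morphism components are isomorphisms. -/
def IsStrong (X : TwoNatTrans R S) : Prop := ∀ {a b} (F : 𝔄.Hom a b), IsIso (X.x F)

open TwoSupercategory

/-- Auxiliary: a 1-morphism as a 1-morphism of the bicategory of even 2-morphisms. -/
abbrev ev₁ {a b : 𝔅.Obj} (F : 𝔅.Hom a b) : (⟨a⟩ : Ev 𝔅) ⟶ ⟨b⟩ := (⟨F⟩ : EvHom 𝔅 ⟨a⟩ ⟨b⟩)

/-- Auxiliary: an even 2-morphism in the bicategory of even 2-morphisms. -/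
abbrev ev₂ {a b : 𝔅.Obj} {F G : 𝔅.Hom a b} (x : F ⟶ G) (hx : HasParity k 0 x) :
    ev₁ F ⟶ ev₁ G := ⟨x, hx⟩

/-- The identity 2-natural transformation. -/
def id (R : TwoSuperfunctor 𝔄 𝔅) : TwoNatTrans R R where
  X a := 𝔅.one (R.obj a)
  x F := (𝔅.lunit (R.map₁ F)).hom ≫ (𝔅.runit (R.map₁ F)).inv
  x_mem F := (𝔅.lunit_mem _).comp_even (HasParity.inv _ (𝔅.runit_mem _))
  x_naturality f := by
    rw [reassoc_of% 𝔅.lunit_naturality, Category.assoc, Iso.cancel_iso_hom_left,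
      Iso.eq_inv_comp, ← Category.assoc, Iso.comp_inv_eq]
    exact (𝔅.runit_naturality _).symm
  x_comp G F := congrArg Subtype.val (bicat_id_comp (B := Ev 𝔅) (rf := ev₁ (R.map₁ F))
    (rg := ev₁ (R.map₁ G)) (ev₂ (R.c G F).hom (R.c_mem G F)))
  x_unit a := congrArg Subtype.val (bicat_id_unit (B := Ev 𝔅)
    (rf := ev₁ (R.map₁ (𝔄.one a))) (ev₂ (R.i a).hom (R.i_mem a)))

/-- The vertical composite `Y ∘ X` of 2-natural transformations. -/
def comp (Y : TwoNatTrans S T) (X : TwoNatTrans R S) : TwoNatTrans R T where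
  X a := 𝔅.comp (Y.X a) (X.X a)
  x {a b} F := (𝔅.assoc (Y.X b) (X.X b) (R.map₁ F)).hom ≫ 𝔅.hcomp (𝟙 (Y.X b)) (X.x F) ≫
    (𝔅.assoc (Y.X b) (S.map₁ F) (X.X a)).inv ≫ 𝔅.hcomp (Y.x F) (𝟙 (X.X a)) ≫
    (𝔅.assoc (T.map₁ F) (Y.X a) (X.X a)).hom
  x_mem F := (𝔅.assoc_mem _ _ _).comp_even ((hcomp_mem_even (HasParity.id _) (X.x_mem F)).comp_even
    ((HasParity.inv _ (𝔅.assoc_mem _ _ _)).comp_even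
      ((hcomp_mem_even (Y.x_mem F) (HasParity.id _)).comp_even (𝔅.assoc_mem _ _ _))))
  x_naturality {a b F G} f := by
    have h1 := 𝔅.assoc_naturality (𝟙 (Y.X b)) (𝟙 (X.X b)) (R.map₂ f)
    have h2 := congrArg (𝔅.hcomp (𝟙 (Y.X b))) (X.x_naturality f)
    have h3 := assoc_inv_naturality (𝟙 (Y.X b)) (S.map₂ f) (𝟙 (X.X a))
    have h4 := congrArg (fun z => 𝔅.hcomp z (𝟙 (X.X a))) (Y.x_naturality f)
    have h5 := 𝔅.assoc_naturality (T.map₂ f) (𝟙 (Y.X a)) (𝟙 (X.X a))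
    simp only [whiskerL_comp, whiskerR_comp] at h2 h4
    rw [𝔅.hcomp_id] at h1 h5
    simp only [Category.assoc]
    rw [reassoc_of% h1, reassoc_of% h2, reassoc_of% h3, reassoc_of% h4, h5]
  x_comp {a b d} G F := congrArg Subtype.val (bicat_vcomp_comp (B := Ev 𝔅)
    (rf := ev₁ (R.map₁ F)) (rg := ev₁ (R.map₁ G)) (ev₂ (R.c G F).hom (R.c_mem G F))
    (sf := ev₁ (S.map₁ F)) (sg := ev₁ (S.map₁ G)) (ev₂ (S.c G F).hom (S.c_mem G F))
    (tf := ev₁ (T.map₁ F)) (tg := ev₁ (T.map₁ G)) (ev₂ (T.c G F).hom (T.c_mem G F))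
    (Xa := ev₁ (X.X a)) (Xb := ev₁ (X.X b)) (Xc := ev₁ (X.X d))
    (Ya := ev₁ (Y.X a)) (Yb := ev₁ (Y.X b)) (Yc := ev₁ (Y.X d))
    (ev₂ (X.x F) (X.x_mem F)) (ev₂ (X.x G) (X.x_mem G)) (ev₂ (X.x _) (X.x_mem _))
    (ev₂ (Y.x F) (Y.x_mem F)) (ev₂ (Y.x G) (Y.x_mem G)) (ev₂ (Y.x _) (Y.x_mem _))
    (Subtype.ext (X.x_comp G F)) (Subtype.ext (Y.x_comp G F)))
  x_unit a := congrArg Subtype.val (bicat_vcomp_unit (B := Ev 𝔅)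
    (rf := ev₁ (R.map₁ (𝔄.one a))) (ev₂ (R.i a).hom (R.i_mem a))
    (sf := ev₁ (S.map₁ (𝔄.one a))) (ev₂ (S.i a).hom (S.i_mem a))
    (tf := ev₁ (T.map₁ (𝔄.one a))) (ev₂ (T.i a).hom (T.i_mem a))
    (Xa := ev₁ (X.X a)) (Ya := ev₁ (Y.X a))
    (ev₂ (X.x _) (X.x_mem _)) (ev₂ (Y.x _) (Y.x_mem _))
    (Subtype.ext (X.x_unit a)) (Subtype.ext (Y.x_unit a)))

/-- The composite `X P` of a 2-natural transformation `X : R ⇒ S` with a 2-superfunctor `P`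
applied first. -/
def precomp {R S : TwoSuperfunctor 𝔅 ℭ} (X : TwoNatTrans R S) (P : TwoSuperfunctor 𝔄 𝔅) :
    TwoNatTrans (R.comp P) (S.comp P) where
  X a := X.X (P.obj a)
  x F := X.x (P.map₁ F)
  x_mem F := X.x_mem _
  x_naturality f := X.x_naturality _
  x_comp {a b d} G F := by
    change ℭ.hcomp (𝟙 (X.X (P.obj d))) ((R.c (P.map₁ G) (P.map₁ F)).hom ≫ R.map₂ (P.c G F).hom) ≫
      X.x (P.map₁ (𝔄.comp G F)) = (ℭ.assoc _ _ _).inv ≫ ℭ.hcomp (X.x (P.map₁ G)) (𝟙 _) ≫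
      (ℭ.assoc _ _ _).hom ≫ ℭ.hcomp (𝟙 _) (X.x (P.map₁ F)) ≫ (ℭ.assoc _ _ _).inv ≫
      ℭ.hcomp ((S.c (P.map₁ G) (P.map₁ F)).hom ≫ S.map₂ (P.c G F).hom) (𝟙 (X.X (P.obj a)))
    rw [whiskerL_comp, whiskerR_comp, Category.assoc, X.x_naturality, reassoc_of% X.x_comp]
  x_unit a := by
    change (ℭ.lunit (X.X (P.obj a))).hom ≫ (ℭ.runit (X.X (P.obj a))).inv ≫
      ℭ.hcomp (𝟙 (X.X (P.obj a))) ((R.i (P.obj a)).hom ≫ R.map₂ (P.i a).hom) ≫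
      X.x (P.map₁ (𝔄.one a)) =
      ℭ.hcomp ((S.i (P.obj a)).hom ≫ S.map₂ (P.i a).hom) (𝟙 (X.X (P.obj a)))
    rw [whiskerL_comp, whiskerR_comp, Category.assoc, X.x_naturality, reassoc_of% X.x_unit]

/-- The composite `Q X` of a 2-natural transformation `X : R ⇒ S` with a 2-superfunctor `Q`
applied last. -/
def postcomp (Q : TwoSuperfunctor 𝔅 ℭ) (X : TwoNatTrans R S) :
    TwoNatTrans (Q.comp R) (Q.comp S) where
  X a := Q.map₁ (X.X a)
  x {a b} F := (Q.c (X.X b) (R.map₁ F)).hom ≫ Q.map₂ (X.x F) ≫ (Q.c (S.map₁ F) (X.X a)).inv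
  x_mem F := (Q.c_mem _ _).comp_even ((Q.map₂_mem (X.x_mem F)).comp_even
    (HasParity.inv _ (Q.c_mem _ _)))
  x_naturality {a b F G} f := by
    have h1 := Q.c_naturality (𝟙 (X.X b)) (R.map₂ f)
    have h2 := Q.c_naturality (S.map₂ f) (𝟙 (X.X a))
    rw [Q.map₂_id] at h1 h2
    change ℭ.hcomp (𝟙 (Q.map₁ (X.X b))) (Q.map₂ (R.map₂ f)) ≫ (Q.c (X.X b) (R.map₁ G)).hom ≫
        Q.map₂ (X.x G) ≫ (Q.c (S.map₁ G) (X.X a)).inv =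
      ((Q.c (X.X b) (R.map₁ F)).hom ≫ Q.map₂ (X.x F) ≫ (Q.c (S.map₁ F) (X.X a)).inv) ≫
        ℭ.hcomp (Q.map₂ (S.map₂ f)) (𝟙 (Q.map₁ (X.X a)))
    have h3 := congrArg Q.map₂ (X.x_naturality f)
    simp only [Q.map₂_comp] at h3
    rw [reassoc_of% h1, reassoc_of% h3, Category.assoc, Category.assoc]
    congr 2
    rw [Iso.eq_inv_comp, ← reassoc_of% h2, Iso.hom_inv_id, Category.comp_id]
  x_comp {a b d} G F := by
    change ℭ.hcomp (𝟙 (Q.map₁ (X.X d))) ((Q.c (R.map₁ G) (R.map₁ F)).hom ≫ Q.map₂ (R.c G F).hom) ≫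
        (Q.c (X.X d) (R.map₁ (𝔄.comp G F))).hom ≫ Q.map₂ (X.x (𝔄.comp G F)) ≫
          (Q.c (S.map₁ (𝔄.comp G F)) (X.X a)).inv =
      (ℭ.assoc _ _ _).inv ≫ ℭ.hcomp ((Q.c (X.X d) (R.map₁ G)).hom ≫ Q.map₂ (X.x G) ≫
          (Q.c (S.map₁ G) (X.X b)).inv) (𝟙 (Q.map₁ (R.map₁ F))) ≫
        (ℭ.assoc _ _ _).hom ≫ ℭ.hcomp (𝟙 (Q.map₁ (S.map₁ G))) ((Q.c (X.X b) (R.map₁ F)).hom ≫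
          Q.map₂ (X.x F) ≫ (Q.c (S.map₁ F) (X.X a)).inv) ≫
        (ℭ.assoc _ _ _).inv ≫ ℭ.hcomp ((Q.c (S.map₁ G) (S.map₁ F)).hom ≫ Q.map₂ (S.c G F).hom)
          (𝟙 (Q.map₁ (X.X a)))
    rw [← cancel_mono (Q.c (S.map₁ (𝔄.comp G F)) (X.X a)).hom]
    simp only [whiskerL_comp, whiskerR_comp, Category.assoc, Iso.inv_hom_id, Category.comp_id]
    have n1 := Q.c_naturality (𝟙 (X.X d)) (R.c G F).hom
    have n2 := Q.c_naturality (S.c G F).hom (𝟙 (X.X a))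
    have n3 := Q.c_naturality (X.x G) (𝟙 (R.map₁ F))
    have n4 := Q.c_naturality (𝟙 (S.map₁ G)) (X.x F)
    rw [Q.map₂_id] at n1 n2 n3 n4
    have k1 := Q.assoc_inv_c (X.X d) (R.map₁ G) (R.map₁ F)
    have k2 := Q.assoc_inv_c (S.map₁ G) (S.map₁ F) (X.X a)
    have k3 := Q.assoc (S.map₁ G) (X.X b) (R.map₁ F)
    have h3 := congrArg Q.map₂ (X.x_comp G F)
    simp only [Q.map₂_comp] at h3
    have e1 : ℭ.hcomp (𝟙 (Q.map₁ (S.map₁ G))) (Q.c (S.map₁ F) (X.X a)).inv ≫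
        (ℭ.assoc (Q.map₁ (S.map₁ G)) (Q.map₁ (S.map₁ F)) (Q.map₁ (X.X a))).inv ≫
        ℭ.hcomp (Q.c (S.map₁ G) (S.map₁ F)).hom (𝟙 (Q.map₁ (X.X a))) ≫
        (Q.c (𝔅.comp (S.map₁ G) (S.map₁ F)) (X.X a)).hom =
        (Q.c (S.map₁ G) (𝔅.comp (S.map₁ F) (X.X a))).hom ≫ Q.map₂ (𝔅.assoc _ _ _).inv := by
      rw [k2, ← Category.assoc, ← whiskerL_comp, Iso.inv_hom_id, ℭ.hcomp_id, Category.id_comp]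
    have e2 : ℭ.hcomp (Q.c (S.map₁ G) (X.X b)).inv (𝟙 (Q.map₁ (R.map₁ F))) ≫
        (ℭ.assoc (Q.map₁ (S.map₁ G)) (Q.map₁ (X.X b)) (Q.map₁ (R.map₁ F))).hom ≫
        ℭ.hcomp (𝟙 (Q.map₁ (S.map₁ G))) (Q.c (X.X b) (R.map₁ F)).hom ≫
        (Q.c (S.map₁ G) (𝔅.comp (X.X b) (R.map₁ F))).hom =
        (Q.c (𝔅.comp (S.map₁ G) (X.X b)) (R.map₁ F)).hom ≫ Q.map₂ (𝔅.assoc _ _ _).hom := by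
      rw [← k3, ← Category.assoc, ← whiskerR_comp, Iso.inv_hom_id, ℭ.hcomp_id, Category.id_comp]
    rw [reassoc_of% n1, h3, n2, reassoc_of% e1, reassoc_of% n4, reassoc_of% e2,
      reassoc_of% n3, reassoc_of% k1]
  x_unit a := by
    change (ℭ.lunit (Q.map₁ (X.X a))).hom ≫ (ℭ.runit (Q.map₁ (X.X a))).inv ≫
        ℭ.hcomp (𝟙 (Q.map₁ (X.X a))) ((Q.i (R.obj a)).hom ≫ Q.map₂ (R.i a).hom) ≫
        (Q.c (X.X a) (R.map₁ (𝔄.one a))).hom ≫ Q.map₂ (X.x (𝔄.one a)) ≫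
          (Q.c (S.map₁ (𝔄.one a)) (X.X a)).inv =
      ℭ.hcomp ((Q.i (S.obj a)).hom ≫ Q.map₂ (S.i a).hom) (𝟙 (Q.map₁ (X.X a)))
    have h1 := Q.c_naturality (𝟙 (X.X a)) (R.i a).hom
    have h2 := Q.c_naturality (S.i a).hom (𝟙 (X.X a))
    rw [Q.map₂_id] at h1 h2
    have h3 := congrArg Q.map₂ (X.x_unit a)
    simp only [Q.map₂_comp] at h3
    have h4 : (ℭ.runit (Q.map₁ (X.X a))).inv ≫ ℭ.hcomp (𝟙 _) (Q.i (R.obj a)).hom ≫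
        (Q.c (X.X a) (𝔅.one (R.obj a))).hom = Q.map₂ (𝔅.runit (X.X a)).inv := by
      rw [Iso.inv_comp_eq, ← Q.runit, Category.assoc, Category.assoc, ← Q.map₂_comp,
        Iso.hom_inv_id, Q.map₂_id, Category.comp_id]
    rw [whiskerL_comp, whiskerR_comp, Category.assoc, reassoc_of% h1, reassoc_of% h4]
    rw [← cancel_mono (Q.c (S.map₁ (𝔄.one a)) (X.X a)).hom]
    simp only [Category.assoc, Iso.inv_hom_id, Category.comp_id]
    rw [h2, ← Q.lunit, Category.assoc, Category.assoc, h3]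

end TwoNatTrans

section Modifications

variable {k : Type t} [CommRing k] {𝔄 : TwoSupercategory.{t, u₁, v₁, w₁} k}
  {𝔅 : TwoSupercategory.{t, u₂, v₂, w₂} k} {R S T U : TwoSuperfunctor 𝔄 𝔅}

open TwoSupercategory

/-- The `k`-module of supermodifications `X ⇛ Y` : families of 2-morphisms `α a : X a ⟶ Y a`
(not necessarily homogeneous) that are compatible with `x` and `y`. -/
def superModification (X Y : TwoNatTrans R S) : Submodule k (∀ a, X.X a ⟶ Y.X a) where
  carrier := {α | ∀ {a b} (F : 𝔄.Hom a b),
    X.x F ≫ 𝔅.hcomp (𝟙 (S.map₁ F)) (α a) = 𝔅.hcomp (α b) (𝟙 (R.map₁ F)) ≫ Y.x F}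
  add_mem' {α β} hα hβ a b F := by
    simp only [Pi.add_apply, map_add, LinearMap.add_apply, Preadditive.comp_add,
      Preadditive.add_comp, hα F, hβ F]
  zero_mem' := by simp
  smul_mem' r α hα a b F := by
    simp only [Pi.smul_apply, map_smul, LinearMap.smul_apply, Linear.comp_smul,
      Linear.smul_comp, hα F]

/-- The supercategory of 2-natural transformations `R ⇒ S` and supermodifications. -/
instance TwoNatTrans.category : Category (TwoNatTrans R S) where
  Hom X Y := superModification X Y
  id X := ⟨fun a => 𝟙 (X.X a), fun F => by simp [𝔅.hcomp_id]⟩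
  comp {X Y Z} α β := ⟨fun a => α.1 a ≫ β.1 a, fun {a b} F => by
    rw [whiskerL_comp, whiskerR_comp, Category.assoc, ← β.2 F, reassoc_of% α.2 F]⟩
  id_comp α := Subtype.ext (funext fun a => Category.id_comp _)
  comp_id α := Subtype.ext (funext fun a => Category.comp_id _)
  assoc α β γ := Subtype.ext (funext fun a => Category.assoc _ _ _)

/-- The component of a supermodification. -/
def TwoNatTrans.app {X Y : TwoNatTrans R S} (α : X ⟶ Y) (a : 𝔄.Obj) : X.X a ⟶ Y.X a := α.1 a

theorem TwoNatTrans.app_nat {X Y : TwoNatTrans R S} (α : X ⟶ Y) {a b : 𝔄.Obj} (F : 𝔄.Hom a b) :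
    X.x F ≫ 𝔅.hcomp (𝟙 (S.map₁ F)) (app α a) = 𝔅.hcomp (app α b) (𝟙 (R.map₁ F)) ≫ Y.x F :=
  α.2 F

theorem TwoNatTrans.hom_ext {X Y : TwoNatTrans R S} {α β : X ⟶ Y}
    (h : ∀ a, app α a = app β a) : α = β := Subtype.ext (funext h)

instance TwoNatTrans.preadditive : Preadditive (TwoNatTrans R S) where
  homGroup X Y := inferInstanceAs (AddCommGroup (superModification X Y))
  add_comp X Y Z α β γ := Subtype.ext (funext fun a => Preadditive.add_comp _ _ _ _ _ _)
  comp_add X Y Z α β γ := Subtype.ext (funext fun a => Preadditive.comp_add _ _ _ _ _ _)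

instance TwoNatTrans.linear : Linear k (TwoNatTrans R S) where
  homModule X Y := inferInstanceAs (Module k (superModification X Y))
  smul_comp X Y Z r α β := Subtype.ext (funext fun a => Linear.smul_comp _ _ _ _ _ _)
  comp_smul X Y Z α r β := Subtype.ext (funext fun a => Linear.comp_smul _ _ _ _ _ _)

/-- A supermodification is homogeneous of parity `p` if all its components are. -/
instance TwoNatTrans.supercategory : Supercategory k (TwoNatTrans R S) where
  par X Y p :=
    { carrier := {α | ∀ a, HasParity k p (app α a)}
      add_mem' := fun {α β} hα hβ a => add_mem (hα a) (hβ a)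
      zero_mem' := fun a => zero_mem (Supercategory.par (X.X a) (Y.X a) p)
      smul_mem' := fun r α hα a => Submodule.smul_mem _ r (hα a) }
  isCompl X Y := by
    refine IsCompl.of_le ?_ ?_
    · rintro α ⟨h0, h1⟩
      refine (Submodule.mem_bot k).2 (hom_ext fun a => ?_)
      exact Submodule.disjoint_def.1 (Supercategory.isCompl (k := k) (X.X a) (Y.X a)).disjoint _
        (h0 a) (h1 a)
    · rintro α -
      choose f g hf hg hfg using fun a => exists_decomp (k := k) (app α a)
      have key : ∀ {a b : 𝔄.Obj} (F : 𝔄.Hom a b), _ := fun {a b} F =>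
        decomp_unique (k := k)
          (a := X.x F ≫ 𝔅.hcomp (𝟙 (S.map₁ F)) (f a)) (b := X.x F ≫ 𝔅.hcomp (𝟙 (S.map₁ F)) (g a))
          (a' := 𝔅.hcomp (f b) (𝟙 (R.map₁ F)) ≫ Y.x F)
          (b' := 𝔅.hcomp (g b) (𝟙 (R.map₁ F)) ≫ Y.x F)
          (by simpa using (X.x_mem F).comp (𝔅.hcomp_mem (HasParity.id _) (hf a)))
          (by simpa using (X.x_mem F).comp (𝔅.hcomp_mem (HasParity.id _) (hg a)))
          (by simpa using (𝔅.hcomp_mem (hf b) (HasParity.id _)).comp (Y.x_mem F))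
          (by simpa using (𝔅.hcomp_mem (hg b) (HasParity.id _)).comp (Y.x_mem F))
          (by
            rw [← Preadditive.comp_add, ← Preadditive.add_comp, ← map_add, ← LinearMap.add_apply,
              ← map_add, ← hfg, ← hfg]
            exact app_nat α F)
      refine Submodule.mem_sup.2 ⟨⟨f, fun F => (key F).1⟩, hf, ⟨g, fun F => (key F).2⟩, hg, ?_⟩
      exact hom_ext fun a => (hfg a).symm
  id_mem X a := HasParity.id _
  comp_mem hf hg a := (hf a).comp (hg a)

theorem TwoNatTrans.app_mem {X Y : TwoNatTrans R S} {α : X ⟶ Y} {p : ZMod 2}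
    (h : HasParity k p α) (a : 𝔄.Obj) : HasParity k p (app α a) := h a

/-- An isomorphism of 2-natural transformations from its components. -/
def TwoNatTrans.mkIso {X Y : TwoNatTrans R S} (e : ∀ a, X.X a ≅ Y.X a)
    (he : (fun a => (e a).hom) ∈ superModification X Y) : X ≅ Y where
  hom := ⟨fun a => (e a).hom, he⟩
  inv := ⟨fun a => (e a).inv, fun {a b} F => by
    have h : X.x F ≫ 𝔅.hcomp (𝟙 (S.map₁ F)) (e a).hom =
      𝔅.hcomp (e b).hom (𝟙 (R.map₁ F)) ≫ Y.x F := he F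
    have h1 : 𝔅.hcomp (e b).inv (𝟙 (R.map₁ F)) ≫ 𝔅.hcomp (e b).hom (𝟙 (R.map₁ F)) = 𝟙 _ := by
      rw [← whiskerR_comp, Iso.inv_hom_id, 𝔅.hcomp_id]
    have h2 : 𝔅.hcomp (𝟙 (S.map₁ F)) (e a).hom ≫ 𝔅.hcomp (𝟙 (S.map₁ F)) (e a).inv = 𝟙 _ := by
      rw [← whiskerL_comp, Iso.hom_inv_id, 𝔅.hcomp_id]
    calc Y.x F ≫ 𝔅.hcomp (𝟙 (S.map₁ F)) (e a).inv
        = (𝔅.hcomp (e b).inv (𝟙 (R.map₁ F)) ≫ 𝔅.hcomp (e b).hom (𝟙 (R.map₁ F)) ≫ Y.x F) ≫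
          𝔅.hcomp (𝟙 (S.map₁ F)) (e a).inv := by rw [reassoc_of% h1]
      _ = _ := by rw [← h, Category.assoc, Category.assoc, h2, Category.comp_id]⟩
  hom_inv_id := hom_ext fun a => (e a).hom_inv_id
  inv_hom_id := hom_ext fun a => (e a).inv_hom_id

/-- Horizontal composition of supermodifications. -/
def TwoNatTrans.hcompMod {Y Y' : TwoNatTrans S T} {X X' : TwoNatTrans R S} (β : Y ⟶ Y')
    (α : X ⟶ X') : Y.comp X ⟶ Y'.comp X' :=
  ⟨fun a => 𝔅.hcomp (app β a) (app α a), fun {a b} F => by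
    have hα := congrArg (𝔅.hcomp (𝟙 (Y.X b))) (app_nat α F)
    have hβ := congrArg (fun z => 𝔅.hcomp z (𝟙 (X'.X a))) (app_nat β F)
    simp only [whiskerL_comp, whiskerR_comp] at hα hβ
    have n1 := 𝔅.assoc_naturality (𝟙 (T.map₁ F)) (app β a) (app α a)
    have n2 := whisker_exchange_even (Y.x F) (app α a) (Y.x_mem F)
    have n3 := assoc_inv_naturality (𝟙 (Y.X b)) (𝟙 (S.map₁ F)) (app α a)
    rw [𝔅.hcomp_id] at n3
    have n4 := assoc_inv_naturality (app β b) (𝟙 (S.map₁ F)) (𝟙 (X'.X a))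
    rw [𝔅.hcomp_id] at n4
    have n5 := 𝔅.assoc_naturality (app β b) (app α b) (𝟙 (R.map₁ F))
    have e1 : 𝔅.hcomp (𝔅.hcomp (𝟙 (T.map₁ F)) (app β a)) (app α a) =
        𝔅.hcomp (𝟙 (𝔅.comp (T.map₁ F) (Y.X a))) (app α a) ≫
          𝔅.hcomp (𝔅.hcomp (𝟙 (T.map₁ F)) (app β a)) (𝟙 (X'.X a)) := hcomp_eq _ _
    have e2 : 𝔅.hcomp (app β b) (𝔅.hcomp (app α b) (𝟙 (R.map₁ F))) ≫
        𝔅.hcomp (𝟙 (Y'.X b)) (X'.x F) =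
        𝔅.hcomp (𝟙 (Y.X b)) (𝔅.hcomp (app α b) (𝟙 (R.map₁ F)) ≫ X'.x F) ≫
          𝔅.hcomp (app β b) (𝟙 _) := by
      rw [hcomp_comp_even_right _ _ _ _ (X'.x_mem F), ← hcomp_eq, Category.comp_id]
    change ((𝔅.assoc (Y.X b) (X.X b) (R.map₁ F)).hom ≫ 𝔅.hcomp (𝟙 (Y.X b)) (X.x F) ≫
        (𝔅.assoc (Y.X b) (S.map₁ F) (X.X a)).inv ≫ 𝔅.hcomp (Y.x F) (𝟙 (X.X a)) ≫
        (𝔅.assoc (T.map₁ F) (Y.X a) (X.X a)).hom) ≫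
        𝔅.hcomp (𝟙 (T.map₁ F)) (𝔅.hcomp (app β a) (app α a)) =
      𝔅.hcomp (𝔅.hcomp (app β b) (app α b)) (𝟙 (R.map₁ F)) ≫
        (𝔅.assoc (Y'.X b) (X'.X b) (R.map₁ F)).hom ≫ 𝔅.hcomp (𝟙 (Y'.X b)) (X'.x F) ≫
        (𝔅.assoc (Y'.X b) (S.map₁ F) (X'.X a)).inv ≫ 𝔅.hcomp (Y'.x F) (𝟙 (X'.X a)) ≫
        (𝔅.assoc (T.map₁ F) (Y'.X a) (X'.X a)).hom
    simp only [Category.assoc]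
    rw [← n1, e1, Category.assoc, ← reassoc_of% n2, reassoc_of% n5, reassoc_of% e2, whiskerL_comp,
      Category.assoc, reassoc_of% n4, ← reassoc_of% hβ, ← reassoc_of% n3, ← reassoc_of% hα]⟩

open TwoNatTrans

/-- The 2-supercategory `𝔥𝔬𝔪(𝔄, 𝔅)` of 2-superfunctors, 2-natural transformations and
supermodifications. -/
def HomTwo (𝔄 : TwoSupercategory.{t, u₁, v₁, w₁} k) (𝔅 : TwoSupercategory.{t, u₂, v₂, w₂} k) :
    TwoSupercategory k where
  Obj := TwoSuperfunctor 𝔄 𝔅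
  Hom R S := TwoNatTrans R S
  one R := TwoNatTrans.id R
  comp Y X := Y.comp X
  hcomp {R S T Y Y' X X'} := LinearMap.mk₂ k (fun β α => hcompMod β α)
    (fun β β' α => hom_ext fun a => LinearMap.map_add₂ 𝔅.hcomp (app β a) (app β' a) (app α a))
    (fun r β α => hom_ext fun a => LinearMap.map_smul₂ 𝔅.hcomp r (app β a) (app α a))
    (fun β α α' => hom_ext fun a => map_add (𝔅.hcomp (app β a)) (app α a) (app α' a))
    (fun r β α => hom_ext fun a => map_smul (𝔅.hcomp (app β a)) r (app α a))
  hcomp_mem hβ hα a := 𝔅.hcomp_mem (app_mem hβ a) (app_mem hα a)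
  hcomp_id Y X := hom_ext fun a => 𝔅.hcomp_id _ _
  interchange β β' α α' hα' hβ := hom_ext fun a => 𝔅.interchange _ _ _ _ (app_mem hα' a) (app_mem hβ a)
  assoc Z Y X := mkIso (fun a => 𝔅.assoc _ _ _) fun {a b} F =>
    congrArg Subtype.val (bicat_assoc_mod (B := Ev 𝔅)
      (Xa := ev₁ (X.X a)) (Xb := ev₁ (X.X b)) (Ya := ev₁ (Y.X a)) (Yb := ev₁ (Y.X b))
      (Za := ev₁ (Z.X a)) (Zb := ev₁ (Z.X b))
      (ev₂ (X.x F) (X.x_mem F)) (ev₂ (Y.x F) (Y.x_mem F)) (ev₂ (Z.x F) (Z.x_mem F)))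
  assoc_mem Z Y X a := 𝔅.assoc_mem _ _ _
  assoc_naturality γ β α := hom_ext fun a => 𝔅.assoc_naturality _ _ _
  lunit X := mkIso (fun a => 𝔅.lunit _) fun {a b} F =>
    congrArg Subtype.val (bicat_runit_mod (B := Ev 𝔅) (Xa := ev₁ (X.X a)) (Xb := ev₁ (X.X b))
      (ev₂ (X.x F) (X.x_mem F)))
  lunit_mem X a := 𝔅.lunit_mem _
  lunit_naturality α := hom_ext fun a => 𝔅.lunit_naturality _
  runit X := mkIso (fun a => 𝔅.runit _) fun {a b} F =>
    congrArg Subtype.val (bicat_lunit_mod (B := Ev 𝔅) (Xa := ev₁ (X.X a)) (Xb := ev₁ (X.X b))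
      (ev₂ (X.x F) (X.x_mem F)))
  runit_mem X a := 𝔅.runit_mem _
  runit_naturality α := hom_ext fun a => 𝔅.runit_naturality _
  pentagon W Z Y X := hom_ext fun a => 𝔅.pentagon _ _ _ _
  triangle Y X := hom_ext fun a => 𝔅.triangle _ _

end Modifications

section Envelope

/-- An object `Π^a λ` of the `Π`-envelope of a supercategory: `deg` is `a` and `base` is `λ`. -/
structure Env (C : Type u) where
  deg : ZMod 2
  base : C

variable {k : Type t} [CommRing k] {C : Type u} [Category.{v} C] [Preadditive C] [Linear k C]
  [Supercategory k C]

/-- The morphisms `Π^a λ ⟶ Π^b μ` are the morphisms `λ ⟶ μ`. -/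
instance Env.category : Category (Env C) where
  Hom X Y := X.base ⟶ Y.base
  id X := 𝟙 X.base
  comp f g := CategoryStruct.comp (obj := C) f g
  id_comp f := Category.id_comp (obj := C) f
  comp_id f := Category.comp_id (obj := C) f
  assoc f g h := Category.assoc (obj := C) f g h

/-- `Env.mor a b f` is the morphism `f_a^b : Π^a λ ⟶ Π^b μ` that comes from `f : λ ⟶ μ`. -/
def Env.mor (a b : ZMod 2) {X Y : C} (f : X ⟶ Y) : (⟨a, X⟩ : Env C) ⟶ ⟨b, Y⟩ := f

/-- The morphism of the supercategory underlying a morphism of its `Π`-envelope. -/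
def Env.un {X Y : Env C} (f : X ⟶ Y) : X.base ⟶ Y.base := f

instance Env.preadditive : Preadditive (Env C) where
  homGroup X Y := inferInstanceAs (AddCommGroup (X.base ⟶ Y.base))
  add_comp X Y Z f g h := Preadditive.add_comp (C := C) _ _ _ f g h
  comp_add X Y Z f g h := Preadditive.comp_add (C := C) _ _ _ f g h

instance Env.linear : Linear k (Env C) where
  homModule X Y := inferInstanceAs (Module k (X.base ⟶ Y.base))
  smul_comp X Y Z r f g := Linear.smul_comp (C := C) _ _ _ r f g
  comp_smul X Y Z f r g := Linear.comp_smul (C := C) _ _ _ f r g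

/-- The parity of `f_a^b` is `|f| + a + b`. -/
instance Env.supercategory : Supercategory k (Env C) where
  par X Y p := Supercategory.par (k := k) X.base Y.base (p + X.deg + Y.deg)
  isCompl X Y := by
    have h : ∀ a b : ZMod 2, ((0 + a + b = 0) ∧ (1 + a + b = 1)) ∨
      ((0 + a + b = 1) ∧ (1 + a + b = 0)) := by decide
    rcases h X.deg Y.deg with ⟨h0, h1⟩ | ⟨h0, h1⟩ <;> rw [h0, h1]
    · exact Supercategory.isCompl X.base Y.base
    · exact (Supercategory.isCompl X.base Y.base).symm
  id_mem X := by
    have h : ∀ a : ZMod 2, 0 + a + a = 0 := by decide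
    rw [h]; exact Supercategory.id_mem X.base
  comp_mem {X Y Z p q f g} hf hg := by
    have h : ∀ p q a b c : ZMod 2, p + a + b + (q + b + c) = p + q + a + c := by decide
    rw [← h p q X.deg Y.deg Z.deg]
    exact Supercategory.comp_mem (C := C) hf hg

theorem Env.hasParity_iff {X Y : Env C} (f : X ⟶ Y) (p : ZMod 2) :
    HasParity k p f ↔ HasParity k (p + X.deg + Y.deg) (Env.un f) := Iff.rfl

/-- An isomorphism in the envelope from an isomorphism of the underlying objects. -/
def Env.mkIso {X Y : Env C} (e : X.base ≅ Y.base) : X ≅ Y where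
  hom := e.hom
  inv := e.inv
  hom_inv_id := e.hom_inv_id
  inv_hom_id := e.inv_hom_id

theorem Env.mkIso_mem {X Y : Env C} (e : X.base ≅ Y.base) (he : HasParity k 0 e.hom)
    (h : X.deg = Y.deg) : HasParity k 0 (Env.mkIso e).hom := by
  rw [Env.hasParity_iff, h]
  have h2 : ∀ d : ZMod 2, 0 = 0 + d + d := by decide
  exact HasParity.congr he (h2 _)

variable (k) in
/-- The linear map `f ↦ (-1)^{p|f|} f`. -/
noncomputable def twist (p : ZMod 2) (X Y : C) : (X ⟶ Y) →ₗ[k] (X ⟶ Y) :=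
  Submodule.projection _ _ (Supercategory.isCompl (k := k) X Y) +
    sgn p • Submodule.projection _ _ (Supercategory.isCompl (k := k) X Y).symm

theorem twist_apply {p q : ZMod 2} {X Y : C} {f : X ⟶ Y} (hf : HasParity k q f) :
    twist k p X Y f = sgn (p * q) • f := by
  have key : ∀ q : ZMod 2, q = 0 ∨ q = 1 := by decide
  rcases key q with rfl | rfl
  · simp [twist, Submodule.projection_apply_of_mem_left _ hf,
      (Submodule.projection_apply_eq_zero_iff _).2 hf]
  · simp [twist, Submodule.projection_apply_of_mem_left _ hf,
      (Submodule.projection_apply_eq_zero_iff _).2 hf]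

end Envelope

namespace TwoSupercategory

variable {k : Type t} [CommRing k] (𝔄 : TwoSupercategory.{t, u, v, w} k)

/-- Horizontal composition in the `Π`-envelope of a 2-supercategory: on homogeneous 2-morphisms,
`y_b^d x_a^c = (-1)^{b|x| + |y|c + bc + ab} (yx)_{a+b}^{c+d}`. -/
noncomputable def envHcomp {a b c : 𝔄.Obj} (G K : Env (𝔄.Hom b c)) (F H : Env (𝔄.Hom a b)) :
    (G ⟶ K) →ₗ[k] (F ⟶ H) →ₗ[k] ((⟨F.deg + G.deg, 𝔄.comp G.base F.base⟩ : Env (𝔄.Hom a c)) ⟶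
      ⟨H.deg + K.deg, 𝔄.comp K.base H.base⟩) :=
  sgn (G.deg * H.deg + F.deg * G.deg) •
    (𝔄.hcomp (G := G.base) (K := K.base) (F := F.base) (H := H.base)).compl₁₂
      (twist k H.deg G.base K.base) (twist k G.deg F.base H.base)

variable {𝔄}

theorem envHcomp_apply {a b c : 𝔄.Obj} {G K : Env (𝔄.Hom b c)} {F H : Env (𝔄.Hom a b)}
    {p q : ZMod 2} {y : G ⟶ K} {x : F ⟶ H} (hy : HasParity k q (Env.un y))
    (hx : HasParity k p (Env.un x)) :
    Env.un (𝔄.envHcomp G K F H y x) =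
      sgn (G.deg * p + q * H.deg + G.deg * H.deg + F.deg * G.deg) •
        𝔄.hcomp (Env.un y) (Env.un x) := by
  change sgn _ • 𝔄.hcomp (twist k H.deg _ _ (Env.un y)) (twist k G.deg _ _ (Env.un x)) = _
  rw [twist_apply hy, twist_apply hx]
  simp only [map_zsmul, LinearMap.smul_apply, smul_smul, ← sgn_add]
  congr 2; ring

theorem envHcomp_mor {a b c : 𝔄.Obj} {G K : 𝔄.Hom b c} {F H : 𝔄.Hom a b} {p q g h m n : ZMod 2}
    {y : G ⟶ K} {x : F ⟶ H} (hy : HasParity k q y) (hx : HasParity k p x) :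
    𝔄.envHcomp ⟨g, G⟩ ⟨h, K⟩ ⟨m, F⟩ ⟨n, H⟩ (Env.mor g h y) (Env.mor m n x) =
      sgn (g * p + q * n + g * n + m * g) • Env.mor (m + g) (n + h) (𝔄.hcomp y x) :=
  envHcomp_apply (G := ⟨g, G⟩) (K := ⟨h, K⟩) (F := ⟨m, F⟩) (H := ⟨n, H⟩) hy hx

theorem envHcomp_even_left {a b c : 𝔄.Obj} {G K : Env (𝔄.Hom b c)} {F H : Env (𝔄.Hom a b)}
    {y : G ⟶ K} (x : F ⟶ H) (hy : HasParity k 0 (Env.un y)) (hG : G.deg = 0) :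
    Env.un (𝔄.envHcomp G K F H y x) = 𝔄.hcomp (Env.un y) (Env.un x) := by
  refine hom_induction k (P := fun x : F.base ⟶ H.base =>
    Env.un (𝔄.envHcomp G K F H y x) = 𝔄.hcomp (Env.un y) x) x ?_ ?_
  · intro p g hg
    refine (envHcomp_apply (y := y) (x := (g : F ⟶ H)) hy hg).trans ?_
    simp only [hG, zero_mul, mul_zero, add_zero, sgn_zero, one_smul]
    rfl
  · intro f g hf hg
    refine (congrArg Env.un (map_add (𝔄.envHcomp G K F H y) f g)).trans ?_
    refine Eq.trans ?_ (map_add (𝔄.hcomp (Env.un y)) f g).symm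
    exact congrArg₂ (· + ·) hf hg

theorem envHcomp_even_right {a b c : 𝔄.Obj} {G K : Env (𝔄.Hom b c)} {F H : Env (𝔄.Hom a b)}
    (y : G ⟶ K) {x : F ⟶ H} (hx : HasParity k 0 (Env.un x)) (hFH : F.deg = H.deg)
    (hF : F.deg = 0) :
    Env.un (𝔄.envHcomp G K F H y x) = 𝔄.hcomp (Env.un y) (Env.un x) := by
  refine hom_induction k (P := fun y : G.base ⟶ K.base =>
    Env.un (𝔄.envHcomp G K F H y x) = 𝔄.hcomp y (Env.un x)) y ?_ ?_
  · intro p g hg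
    refine (envHcomp_apply (y := (g : G ⟶ K)) (x := x) hg hx).trans ?_
    rw [hF] at hFH
    simp only [hF, ← hFH, zero_mul, mul_zero, add_zero, sgn_zero, one_smul]
    rfl
  · intro f g hf hg
    refine (congrArg Env.un (LinearMap.map_add₂ (𝔄.envHcomp G K F H) f g x)).trans ?_
    refine Eq.trans ?_ (LinearMap.map_add₂ 𝔄.hcomp f g (Env.un x)).symm
    exact congrArg₂ (· + ·) hf hg

theorem envHcomp_even {a b c : 𝔄.Obj} {G K : Env (𝔄.Hom b c)} {F H : Env (𝔄.Hom a b)}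
    {y : G ⟶ K} {x : F ⟶ H} (hy : HasParity k 0 (Env.un y)) (hx : HasParity k 0 (Env.un x))
    (hFH : F.deg = H.deg) :
    Env.un (𝔄.envHcomp G K F H y x) = 𝔄.hcomp (Env.un y) (Env.un x) := by
  rw [envHcomp_apply hy hx, hFH]
  have h : ∀ g n : ZMod 2, sgn (g * 0 + 0 * n + g * n + n * g) = 1 := by decide
  rw [h, one_smul]

variable (k) in
theorem Env.hom_ind {C : Type u} [Category.{v} C] [Preadditive C] [Linear k C]
    [Supercategory k C] {X Y : Env C} {P : (X ⟶ Y) → Prop} (f : X ⟶ Y)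
    (h : ∀ (p : ZMod 2) (g : X ⟶ Y), HasParity k p (Env.un g) → P g)
    (hadd : ∀ a b, P a → P b → P (a + b)) : P f :=
  hom_induction k (X := X.base) (Y := Y.base) (P := P) f h hadd

theorem env_interchange {a b c : 𝔄.Obj} {G K N : Env (𝔄.Hom b c)} {F H M : Env (𝔄.Hom a b)}
    {p q : ZMod 2} (y : G ⟶ K) (v : K ⟶ N) (x : F ⟶ H) (u : H ⟶ M) (hu : HasParity k p u)
    (hy : HasParity k q y) :
    𝔄.envHcomp G K F H y x ≫ 𝔄.envHcomp K N H M v u =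
      sgn (p * q) • 𝔄.envHcomp G N F M (y ≫ v) (x ≫ u) := by
  refine Env.hom_ind k (P := fun x => 𝔄.envHcomp G K F H y x ≫ 𝔄.envHcomp K N H M v u =
      sgn (p * q) • 𝔄.envHcomp G N F M (y ≫ v) (x ≫ u)) x ?_ ?_
  · intro r x hx
    refine Env.hom_ind k (P := fun v => 𝔄.envHcomp G K F H y x ≫ 𝔄.envHcomp K N H M v u =
      sgn (p * q) • 𝔄.envHcomp G N F M (y ≫ v) (x ≫ u)) v ?_ ?_
    · intro s v hv
      have hyv : HasParity k _ (Env.un (y ≫ v)) := HasParity.comp (C := 𝔄.Hom b c) hy hv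
      have hxu : HasParity k _ (Env.un (x ≫ u)) := HasParity.comp (C := 𝔄.Hom a b) hx hu
      change Env.un (𝔄.envHcomp G K F H y x) ≫ Env.un (𝔄.envHcomp K N H M v u) =
        sgn (p * q) • Env.un (𝔄.envHcomp G N F M (y ≫ v) (x ≫ u))
      rw [envHcomp_apply hy hx, envHcomp_apply hv hu, envHcomp_apply hyv hxu]
      rw [Preadditive.zsmul_comp, Preadditive.comp_zsmul,
        𝔄.interchange _ _ _ _ ((Env.hasParity_iff u p).1 hu) ((Env.hasParity_iff y q).1 hy)]
      simp only [smul_smul, ← sgn_add]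
      refine congrArg₂ (· • ·) (congrArg sgn ?_) rfl
      generalize F.deg = f, G.deg = g, K.deg = k, H.deg = h, N.deg = n, M.deg = m
      have h2 : (2 : ZMod 2) = 0 := rfl
      linear_combination (q * h + g * h + 2 * k * h + k * p + k * m - g * m) * h2
    · intro f g hf hg
      simp only [map_add, LinearMap.add_apply, Preadditive.comp_add, smul_add, hf, hg]
  · intro f g hf hg
    simp only [map_add, Preadditive.add_comp, smul_add, hf, hg]

theorem env_assoc_naturality {a b c d : 𝔄.Obj} {H H' : Env (𝔄.Hom c d)} {G G' : Env (𝔄.Hom b c)}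
    {F F' : Env (𝔄.Hom a b)} (z : H ⟶ H') (y : G ⟶ G') (x : F ⟶ F') :
    Env.un (𝔄.envHcomp ⟨G.deg + H.deg, 𝔄.comp H.base G.base⟩
      ⟨G'.deg + H'.deg, 𝔄.comp H'.base G'.base⟩ F F' (𝔄.envHcomp H H' G G' z y) x) ≫
        (𝔄.assoc H'.base G'.base F'.base).hom =
      (𝔄.assoc H.base G.base F.base).hom ≫
        Env.un (𝔄.envHcomp H H' ⟨F.deg + G.deg, 𝔄.comp G.base F.base⟩
          ⟨F'.deg + G'.deg, 𝔄.comp G'.base F'.base⟩ z (𝔄.envHcomp G G' F F' y x)) := by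
  refine Env.hom_ind k (P := fun z => Env.un (𝔄.envHcomp ⟨G.deg + H.deg, 𝔄.comp H.base G.base⟩
      ⟨G'.deg + H'.deg, 𝔄.comp H'.base G'.base⟩ F F' (𝔄.envHcomp H H' G G' z y) x) ≫
        (𝔄.assoc H'.base G'.base F'.base).hom =
      (𝔄.assoc H.base G.base F.base).hom ≫
        Env.un (𝔄.envHcomp H H' ⟨F.deg + G.deg, 𝔄.comp G.base F.base⟩
          ⟨F'.deg + G'.deg, 𝔄.comp G'.base F'.base⟩ z (𝔄.envHcomp G G' F F' y x))) z ?_ ?_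
  · intro p z hz
    refine Env.hom_ind k (P := fun y => Env.un (𝔄.envHcomp ⟨G.deg + H.deg, 𝔄.comp H.base G.base⟩
      ⟨G'.deg + H'.deg, 𝔄.comp H'.base G'.base⟩ F F' (𝔄.envHcomp H H' G G' z y) x) ≫
        (𝔄.assoc H'.base G'.base F'.base).hom =
      (𝔄.assoc H.base G.base F.base).hom ≫
        Env.un (𝔄.envHcomp H H' ⟨F.deg + G.deg, 𝔄.comp G.base F.base⟩
          ⟨F'.deg + G'.deg, 𝔄.comp G'.base F'.base⟩ z (𝔄.envHcomp G G' F F' y x))) y ?_ ?_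
    · intro q y hy
      refine Env.hom_ind k (P := fun x => Env.un (𝔄.envHcomp ⟨G.deg + H.deg, 𝔄.comp H.base G.base⟩
        ⟨G'.deg + H'.deg, 𝔄.comp H'.base G'.base⟩ F F' (𝔄.envHcomp H H' G G' z y) x) ≫
          (𝔄.assoc H'.base G'.base F'.base).hom =
        (𝔄.assoc H.base G.base F.base).hom ≫
          Env.un (𝔄.envHcomp H H' ⟨F.deg + G.deg, 𝔄.comp G.base F.base⟩
            ⟨F'.deg + G'.deg, 𝔄.comp G'.base F'.base⟩ z (𝔄.envHcomp G G' F F' y x))) x ?_ ?_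
      · intro r x hx
        have h1 : Env.un (𝔄.envHcomp H H' G G' z y) = _ := envHcomp_apply hz hy
        have h2 : Env.un (𝔄.envHcomp G G' F F' y x) = _ := envHcomp_apply hy hx
        have h3 : HasParity k (p + q) (Env.un (𝔄.envHcomp H H' G G' z y)) := by
          rw [h1]; exact (𝔄.hcomp_mem hz hy).zsmul _
        have h4 : HasParity k (q + r) (Env.un (𝔄.envHcomp G G' F F' y x)) := by
          rw [h2]; exact (𝔄.hcomp_mem hy hx).zsmul _
        refine (congrArg (· ≫ (𝔄.assoc H'.base G'.base F'.base).hom)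
          (envHcomp_apply h3 hx)).trans (Eq.trans ?_ (congrArg
            ((𝔄.assoc H.base G.base F.base).hom ≫ ·) (envHcomp_apply hz h4)).symm)
        rw [h1, h2]
        simp only [map_zsmul, LinearMap.smul_apply, smul_smul, ← sgn_add,
          Preadditive.zsmul_comp, Preadditive.comp_zsmul]
        refine congrArg₂ (· • ·) (congrArg sgn ?_) (𝔄.assoc_naturality _ _ _)
        ring
      · intro f g hf hg
        have e1 : Env.un (𝔄.envHcomp ⟨G.deg + H.deg, 𝔄.comp H.base G.base⟩
          ⟨G'.deg + H'.deg, 𝔄.comp H'.base G'.base⟩ F F' (𝔄.envHcomp H H' G G' z y) (f + g)) = _ + _ :=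
          map_add _ _ _
        have e2 : Env.un (𝔄.envHcomp H H' ⟨F.deg + G.deg, 𝔄.comp G.base F.base⟩
          ⟨F'.deg + G'.deg, 𝔄.comp G'.base F'.base⟩ z (𝔄.envHcomp G G' F F' y (f + g))) = _ + _ :=
          (congrArg (𝔄.envHcomp H H' _ _ z) (map_add _ _ _)).trans (map_add _ _ _)
        rw [e1, e2, Preadditive.add_comp, Preadditive.comp_add]
        exact congrArg₂ (· + ·) hf hg
    · intro f g hf hg
      have e1 : Env.un (𝔄.envHcomp ⟨G.deg + H.deg, 𝔄.comp H.base G.base⟩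
        ⟨G'.deg + H'.deg, 𝔄.comp H'.base G'.base⟩ F F' (𝔄.envHcomp H H' G G' z (f + g)) x) = _ + _ :=
        (congrArg (fun w => 𝔄.envHcomp _ _ F F' w x) (map_add _ _ _)).trans
          (LinearMap.map_add₂ _ _ _ _)
      have e2 : Env.un (𝔄.envHcomp H H' ⟨F.deg + G.deg, 𝔄.comp G.base F.base⟩
        ⟨F'.deg + G'.deg, 𝔄.comp G'.base F'.base⟩ z (𝔄.envHcomp G G' F F' (f + g) x)) = _ + _ :=
        (congrArg (𝔄.envHcomp H H' _ _ z) (LinearMap.map_add₂ _ _ _ _)).trans (map_add _ _ _)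
      rw [e1, e2, Preadditive.add_comp, Preadditive.comp_add]
      exact congrArg₂ (· + ·) hf hg
  · intro f g hf hg
    have e1 : Env.un (𝔄.envHcomp ⟨G.deg + H.deg, 𝔄.comp H.base G.base⟩
      ⟨G'.deg + H'.deg, 𝔄.comp H'.base G'.base⟩ F F' (𝔄.envHcomp H H' G G' (f + g) y) x) = _ + _ :=
      (congrArg (fun w => 𝔄.envHcomp _ _ F F' w x) (LinearMap.map_add₂ _ _ _ _)).trans
        (LinearMap.map_add₂ _ _ _ _)
    have e2 : Env.un (𝔄.envHcomp H H' ⟨F.deg + G.deg, 𝔄.comp G.base F.base⟩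
      ⟨F'.deg + G'.deg, 𝔄.comp G'.base F'.base⟩ (f + g) (𝔄.envHcomp G G' F F' y x)) = _ + _ :=
      LinearMap.map_add₂ _ _ _ _
    rw [e1, e2, Preadditive.add_comp, Preadditive.comp_add]
    exact congrArg₂ (· + ·) hf hg

/-- The `Π`-envelope of a 2-supercategory, as a 2-supercategory. -/
noncomputable def env (𝔄 : TwoSupercategory.{t, u, v, w} k) : TwoSupercategory.{t, u, v, w} k where
  Obj := 𝔄.Obj
  Hom a b := Env (𝔄.Hom a b)
  one a := ⟨0, 𝔄.one a⟩
  comp G F := ⟨F.deg + G.deg, 𝔄.comp G.base F.base⟩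
  hcomp := 𝔄.envHcomp _ _ _ _
  hcomp_mem {a b c G K F H p q y x} hy hx := by
    rw [Env.hasParity_iff] at *
    rw [envHcomp_apply hy hx]
    refine HasParity.congr ((𝔄.hcomp_mem hy hx).zsmul _) ?_
    dsimp only
    ring
  hcomp_id G F := envHcomp_even (HasParity.id _) (HasParity.id _) rfl |>.trans (𝔄.hcomp_id _ _)
  interchange y v x u hu hy := env_interchange y v x u hu hy
  assoc H G F := Env.mkIso (𝔄.assoc H.base G.base F.base)
  assoc_mem H G F := Env.mkIso_mem _ (𝔄.assoc_mem _ _ _) (add_assoc _ _ _).symm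
  assoc_naturality z y x := env_assoc_naturality z y x
  lunit F := Env.mkIso (𝔄.lunit F.base)
  lunit_mem F := Env.mkIso_mem _ (𝔄.lunit_mem _) (add_zero _)
  lunit_naturality {a b F G} x := by
    have h := envHcomp_even_left (G := (⟨0, 𝔄.one b⟩ : Env (𝔄.Hom b b))) (K := ⟨0, 𝔄.one b⟩)
      (y := 𝟙 _) x (HasParity.id _) rfl
    exact (congrArg (fun z => z ≫ (𝔄.lunit G.base).hom) h).trans (𝔄.lunit_naturality (Env.un x))
  runit F := Env.mkIso (𝔄.runit F.base)
  runit_mem F := Env.mkIso_mem _ (𝔄.runit_mem _) (zero_add _)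
  runit_naturality {a b F G} x := by
    have h := envHcomp_even_right (F := (⟨0, 𝔄.one a⟩ : Env (𝔄.Hom a a))) (H := ⟨0, 𝔄.one a⟩)
      x (x := 𝟙 _) (HasParity.id _) rfl rfl
    exact (congrArg (fun z => z ≫ (𝔄.runit G.base).hom) h).trans (𝔄.runit_naturality (Env.un x))
  pentagon K H G F := by
    refine Eq.trans ?_ (𝔄.pentagon K.base H.base G.base F.base)
    refine congrArg₂ (fun p q => p ≫ (𝔄.assoc _ _ _).hom ≫ q)
      (envHcomp_even (𝔄.assoc_mem _ _ _) (HasParity.id _) rfl)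
      (envHcomp_even (HasParity.id _) (𝔄.assoc_mem _ _ _) (add_assoc _ _ _).symm)
  triangle G F := by
    refine Eq.trans ?_ ((𝔄.triangle G.base F.base).trans ?_)
    · exact congrArg (fun p => (𝔄.assoc _ _ _).hom ≫ p)
        (envHcomp_even (HasParity.id _) (𝔄.lunit_mem _) (add_zero _))
    · exact (envHcomp_even (G := ⟨0 + G.deg, 𝔄.comp G.base (𝔄.one _)⟩) (K := G) (F := F) (H := F)
        (y := (Env.mkIso (X := ⟨0 + G.deg, 𝔄.comp G.base (𝔄.one _)⟩) (Y := G) (𝔄.runit G.base)).hom)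
        (𝔄.runit_mem G.base) (HasParity.id _) rfl).symm

end TwoSupercategory

/-- A `Π`-2-supercategory: a 2-supercategory with 1-morphisms `pi a : a → a` and odd
2-isomorphisms `zeta a : pi a ≅ one a` for all objects `a`. -/
structure PiTwoSupercategory (k : Type t) [CommRing k] extends TwoSupercategory.{t, u, v, w} k where
  pi : ∀ a, Hom a a
  zeta : ∀ a, @Iso (Hom a a) (cat a a) (pi a) (one a)
  zeta_mem : ∀ a, HasParity k (C := Hom a a) 1 (zeta a).hom

/-- The `Π`-envelope of a 2-supercategory: `π_a = Π^1 1_a` and `ζ_a = (1_{1_a})_1^0`. -/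
noncomputable def PiEnvelope {k : Type t} [CommRing k] (𝔄 : TwoSupercategory.{t, u, v, w} k) :
    PiTwoSupercategory.{t, u, v, w} k where
  toTwoSupercategory := 𝔄.env
  pi := fun a : 𝔄.Obj => (⟨1, 𝔄.one a⟩ : Env (𝔄.Hom a a))
  zeta := fun a : 𝔄.Obj =>
    Env.mkIso (X := ⟨1, 𝔄.one a⟩) (Y := ⟨0, 𝔄.one a⟩) (Iso.refl (𝔄.one a))
  zeta_mem := fun a : 𝔄.Obj => (Env.hasParity_iff _ _).2
    (HasParity.congr (HasParity.id (𝔄.one a)) (by change (0 : ZMod 2) = 1 + 1 + 0; decide))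

section EnvelopeFunctoriality

variable {k : Type t} [CommRing k] {𝔄 : TwoSupercategory.{t, u₁, v₁, w₁} k}
  {𝔅 : TwoSupercategory.{t, u₂, v₂, w₂} k}

open TwoSupercategory

variable (k) in
theorem twist_zero {C : Type u} [Category.{v} C] [Preadditive C] [Linear k C]
    [Supercategory k C] {X Y : C} (f : X ⟶ Y) : twist k 0 X Y f = f := by
  refine hom_induction k (P := fun f => twist k 0 X Y f = f) f ?_ ?_
  · intro p g hg
    rw [twist_apply hg]; simp
  · intro a b ha hb
    rw [map_add, ha, hb]

theorem TwoSuperfunctor.map₂_twist (R : TwoSuperfunctor 𝔄 𝔅) (p : ZMod 2) {a b : 𝔄.Obj}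
    {F G : 𝔄.Hom a b} (x : F ⟶ G) :
    R.map₂ (twist k p F G x) = twist k p (R.map₁ F) (R.map₁ G) (R.map₂ x) := by
  refine hom_induction k (P := fun x => R.map₂ (twist k p F G x) =
    twist k p (R.map₁ F) (R.map₁ G) (R.map₂ x)) x ?_ ?_
  · intro p g hg
    rw [twist_apply hg, twist_apply (R.map₂_mem hg), R.map₂_zsmul]
  · intro a b ha hb
    rw [map_add, R.map₂_add, R.map₂_add, map_add, ha, hb]

theorem envHcomp_zero {a b c : 𝔄.Obj} {G K : Env (𝔄.Hom b c)} {F H : Env (𝔄.Hom a b)}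
    (y : G ⟶ K) (x : F ⟶ H) (hG : G.deg = 0) (hH : H.deg = 0) :
    Env.un (𝔄.envHcomp G K F H y x) = 𝔄.hcomp (Env.un y) (Env.un x) := by
  change sgn _ • 𝔄.hcomp (twist k H.deg _ _ (Env.un y)) (twist k G.deg _ _ (Env.un x)) = _
  rw [hG, hH, twist_zero, twist_zero]
  simp

theorem envHcomp_ev {a b c : 𝔄.Obj} {G K : 𝔄.Hom b c} {F H : 𝔄.Hom a b} (g h m n : ZMod 2)
    (y : G ⟶ K) (x : F ⟶ H) (hy : HasParity k 0 y) (hx : HasParity k 0 x) (hmn : m = n) :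
    Env.un (𝔄.envHcomp ⟨g, G⟩ ⟨h, K⟩ ⟨m, F⟩ ⟨n, H⟩ (Env.mor g h y) (Env.mor m n x)) =
      𝔄.hcomp y x :=
  envHcomp_even (G := ⟨g, G⟩) (K := ⟨h, K⟩) (F := ⟨m, F⟩) (H := ⟨n, H⟩) (y := Env.mor g h y)
    (x := Env.mor m n x) hy hx hmn

/-- The canonical 2-superfunctor `𝕁 : 𝔄 → 𝔄_π`, `F ↦ Π^0 F`, `x ↦ x_0^0`. -/
noncomputable def inclusion (𝔄 : TwoSupercategory.{t, u₁, v₁, w₁} k) :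
    TwoSuperfunctor 𝔄 𝔄.env where
  obj a := a
  map₁ {a b} F := (⟨0, F⟩ : Env (𝔄.Hom a b))
  map₂ x := Env.mor 0 0 x
  map₂_id _ := rfl
  map₂_comp _ _ := rfl
  map₂_add _ _ := rfl
  map₂_smul _ _ := rfl
  map₂_mem {a b F G p x} h := (Env.hasParity_iff (Env.mor 0 0 x) p).2
    (HasParity.congr h (by simp))
  c {a b d} G F := Env.mkIso (X := ⟨0 + 0, 𝔄.comp G F⟩) (Y := ⟨0, 𝔄.comp G F⟩) (Iso.refl _)
  c_mem G F := Env.mkIso_mem (X := ⟨0 + 0, 𝔄.comp G F⟩) (Y := ⟨0, 𝔄.comp G F⟩) (Iso.refl _)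
    (HasParity.id _) (zero_add _)
  c_naturality {a b d G K F H} y x := by
    refine Eq.trans (Category.comp_id (obj := 𝔄.Hom a d) _) (Eq.trans ?_
      (Category.id_comp (obj := 𝔄.Hom a d) (𝔄.hcomp y x)).symm)
    exact envHcomp_zero (Env.mor 0 0 y) (Env.mor 0 0 x) rfl rfl
  i := fun a : 𝔄.Obj => Env.mkIso (X := ⟨0, 𝔄.one a⟩) (Y := ⟨0, 𝔄.one a⟩) (Iso.refl (𝔄.one a))
  i_mem := fun a : 𝔄.Obj => Env.mkIso_mem (X := ⟨0, 𝔄.one a⟩) (Y := ⟨0, 𝔄.one a⟩) (Iso.refl _)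
    (HasParity.id _) rfl
  assoc {a b d e} H G F := by
    have e1 := envHcomp_zero (Env.mor 0 0 (𝟙 (𝔄.comp H G))) (Env.mor 0 0 (𝟙 F)) rfl rfl
    have e2 := envHcomp_zero (Env.mor 0 0 (𝟙 H)) (Env.mor 0 0 (𝟙 (𝔄.comp G F))) rfl rfl
    refine (congrArg (fun z => z ≫ 𝟙 (𝔄.comp (𝔄.comp H G) F) ≫ (𝔄.assoc H G F).hom) e1).trans
      (Eq.trans ?_ (congrArg (fun z => (𝔄.assoc H G F).hom ≫ z ≫ 𝟙 (𝔄.comp H (𝔄.comp G F))) e2).symm)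
    change 𝔄.hcomp (𝟙 _) (𝟙 _) ≫ _ = _ ≫ 𝔄.hcomp (𝟙 _) (𝟙 _) ≫ _
    simp [𝔄.hcomp_id]
  runit {a b} F := by
    have e1 := envHcomp_zero (Env.mor 0 0 (𝟙 F)) (Env.mor 0 0 (𝟙 (𝔄.one a))) rfl rfl
    refine (congrArg (fun z => z ≫ 𝟙 (𝔄.comp F (𝔄.one a)) ≫ (𝔄.runit F).hom) e1).trans ?_
    change 𝔄.hcomp (𝟙 _) (𝟙 _) ≫ _ = (𝔄.runit F).hom
    simp [𝔄.hcomp_id]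
  lunit {a b} F := by
    have e1 := envHcomp_zero (Env.mor 0 0 (𝟙 (𝔄.one b))) (Env.mor 0 0 (𝟙 F)) rfl rfl
    refine (congrArg (fun z => z ≫ 𝟙 (𝔄.comp (𝔄.one b) F) ≫ (𝔄.lunit F).hom) e1).trans ?_
    change 𝔄.hcomp (𝟙 _) (𝟙 _) ≫ _ = (𝔄.lunit F).hom
    simp [𝔄.hcomp_id]

/-- The 2-superfunctor `R_π : 𝔄_π → 𝔅_π` induced by `R : 𝔄 → 𝔅`. -/
noncomputable def TwoSuperfunctor.env (R : TwoSuperfunctor 𝔄 𝔅) :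
    TwoSuperfunctor 𝔄.env 𝔅.env where
  obj a := R.obj a
  map₁ {a b : 𝔄.Obj} (F : Env (𝔄.Hom a b)) :=
    (⟨F.deg, R.map₁ F.base⟩ : Env (𝔅.Hom (R.obj a) (R.obj b)))
  map₂ {a b : 𝔄.Obj} {F G : Env (𝔄.Hom a b)} x := Env.mor F.deg G.deg (R.map₂ (Env.un x))
  map₂_id F := R.map₂_id _
  map₂_comp x y := R.map₂_comp _ _
  map₂_add x y := R.map₂_add _ _
  map₂_smul r x := R.map₂_smul _ _
  map₂_mem h := R.map₂_mem h
  c {a b d : 𝔄.Obj} (G : Env (𝔄.Hom b d)) (F : Env (𝔄.Hom a b)) :=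
    Env.mkIso (X := ⟨F.deg + G.deg, 𝔅.comp (R.map₁ G.base) (R.map₁ F.base)⟩)
      (Y := ⟨F.deg + G.deg, R.map₁ (𝔄.comp G.base F.base)⟩) (R.c G.base F.base)
  c_mem G F := Env.mkIso_mem _ (R.c_mem _ _) rfl
  c_naturality {a b d : 𝔄.Obj} {G K : Env (𝔄.Hom b d)} {F H : Env (𝔄.Hom a b)} y x := by
    change (sgn (G.deg * H.deg + F.deg * G.deg) •
        𝔅.hcomp (twist k H.deg _ _ (R.map₂ (Env.un y))) (twist k G.deg _ _ (R.map₂ (Env.un x)))) ≫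
        (R.c K.base H.base).hom = (R.c G.base F.base).hom ≫
      R.map₂ (sgn (G.deg * H.deg + F.deg * G.deg) •
        𝔄.hcomp (twist k H.deg _ _ (Env.un y)) (twist k G.deg _ _ (Env.un x)))
    rw [← R.map₂_twist, ← R.map₂_twist, R.map₂_zsmul, Preadditive.zsmul_comp,
      Preadditive.comp_zsmul, R.c_naturality]
  i a := Env.mkIso (X := ⟨0, 𝔅.one (R.obj a)⟩) (Y := ⟨0, R.map₁ (𝔄.one a)⟩) (R.i a)
  i_mem a := Env.mkIso_mem _ (R.i_mem a) rfl
  assoc {a b d e : 𝔄.Obj} (H : Env (𝔄.Hom d e)) (G : Env (𝔄.Hom b d)) (F : Env (𝔄.Hom a b)) := by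
    refine Eq.trans ?_ ((R.assoc H.base G.base F.base).trans ?_)
    · exact congrArg (fun z => z ≫ (R.c _ _).hom ≫ R.map₂ (𝔄.assoc _ _ _).hom)
        (envHcomp_ev (G.deg + H.deg) (G.deg + H.deg) F.deg F.deg (R.c H.base G.base).hom
          (𝟙 (R.map₁ F.base)) (R.c_mem _ _) (HasParity.id _) rfl)
    · exact congrArg (fun z => (𝔅.assoc _ _ _).hom ≫ z ≫ (R.c _ _).hom)
        (envHcomp_ev H.deg H.deg (F.deg + G.deg) (F.deg + G.deg) (𝟙 (R.map₁ H.base))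
          (R.c G.base F.base).hom (HasParity.id _) (R.c_mem _ _) rfl).symm
  runit {a b : 𝔄.Obj} (F : Env (𝔄.Hom a b)) := by
    refine Eq.trans ?_ (R.runit F.base)
    exact congrArg (fun z => z ≫ (R.c _ _).hom ≫ R.map₂ (𝔄.runit _).hom)
      (envHcomp_ev F.deg F.deg 0 0 (𝟙 (R.map₁ F.base)) (R.i a).hom (HasParity.id _) (R.i_mem _) rfl)
  lunit {a b : 𝔄.Obj} (F : Env (𝔄.Hom a b)) := by
    refine Eq.trans ?_ (R.lunit F.base)
    exact congrArg (fun z => z ≫ (R.c _ _).hom ≫ R.map₂ (𝔄.lunit _).hom)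
      (envHcomp_ev 0 0 F.deg F.deg (R.i b).hom (𝟙 (R.map₁ F.base)) (R.i_mem _) (HasParity.id _) rfl)

/-- The 2-natural transformation `X_π : R_π ⇒ S_π` induced by `X : R ⇒ S`. -/
noncomputable def TwoNatTrans.env {R S : TwoSuperfunctor 𝔄 𝔅} (X : TwoNatTrans R S) :
    TwoNatTrans R.env S.env where
  X := fun a : 𝔄.Obj => (⟨0, X.X a⟩ : Env (𝔅.Hom (R.obj a) (S.obj a)))
  x {a b : 𝔄.Obj} (F : Env (𝔄.Hom a b)) :=
    Env.mor (C := 𝔅.Hom (R.obj a) (S.obj b)) (F.deg + 0) (0 + F.deg) (X.x F.base)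
  x_mem {a b : 𝔄.Obj} (F : Env (𝔄.Hom a b)) := 
    show HasParity k (0 + (F.deg + 0) + (0 + F.deg)) (X.x F.base) from
      (X.x_mem F.base).congr (by generalize F.deg = f; revert f; decide)
  x_naturality {a b : 𝔄.Obj} {F G : Env (𝔄.Hom a b)} f := by
    refine Eq.trans ?_ ((X.x_naturality (Env.un f)).trans ?_)
    · exact congrArg (fun z => z ≫ X.x G.base)
        (envHcomp_even_left (G := ⟨0, X.X b⟩) (K := ⟨0, X.X b⟩) (F := ⟨F.deg, R.map₁ F.base⟩)
          (H := ⟨G.deg, R.map₁ G.base⟩) (y := Env.mor 0 0 (𝟙 (X.X b)))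
          (Env.mor F.deg G.deg (R.map₂ (Env.un f))) (HasParity.id _) rfl)
    · exact congrArg (fun z => X.x F.base ≫ z)
        (envHcomp_even_right (F := ⟨0, X.X a⟩) (H := ⟨0, X.X a⟩) (G := ⟨F.deg, S.map₁ F.base⟩)
          (K := ⟨G.deg, S.map₁ G.base⟩) (Env.mor F.deg G.deg (S.map₂ (Env.un f)))
          (x := Env.mor 0 0 (𝟙 (X.X a))) (HasParity.id _) rfl rfl).symm
  x_comp {a b d : 𝔄.Obj} (G : Env (𝔄.Hom b d)) (F : Env (𝔄.Hom a b)) := by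
    refine Eq.trans ?_ ((X.x_comp G.base F.base).trans ?_)
    · exact congrArg (fun z => z ≫ X.x _)
        (envHcomp_ev 0 0 (F.deg + G.deg) (F.deg + G.deg) (𝟙 (X.X d)) (R.c G.base F.base).hom
          (HasParity.id _) (R.c_mem _ _) rfl)
    · have e1 := envHcomp_ev (G.deg + 0) (0 + G.deg) F.deg F.deg (X.x G.base)
        (𝟙 (R.map₁ F.base)) (X.x_mem _) (HasParity.id _) rfl
      have e2 := envHcomp_ev G.deg G.deg (F.deg + 0) (0 + F.deg) (𝟙 (S.map₁ G.base))
        (X.x F.base) (HasParity.id _) (X.x_mem _) (by simp)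
      have e3 := envHcomp_ev (F.deg + G.deg) (F.deg + G.deg) 0 0 (S.c G.base F.base).hom
        (𝟙 (X.X a)) (S.c_mem _ _) (HasParity.id _) rfl
      rw [← e1, ← e2, ← e3]
      rfl
  x_unit a := by
    refine Eq.trans ?_ ((X.x_unit a).trans ?_)
    · exact congrArg (fun z => (𝔅.lunit _).hom ≫ (𝔅.runit _).inv ≫ z ≫ X.x _)
        (envHcomp_ev 0 0 0 0 (𝟙 (X.X a)) (R.i a).hom (HasParity.id _) (R.i_mem _) rfl)
    · exact (envHcomp_ev 0 0 0 0 (S.i a).hom (𝟙 (X.X a)) (S.i_mem _) (HasParity.id _) rfl).symm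

end EnvelopeFunctoriality

namespace TwoSupercategory

/-- The 2-isomorphism `y F : G F ≅ K F` for a 2-isomorphism `y : G ≅ K`. -/
def whiskerRIso {k : Type t} [CommRing k] {𝔄 : TwoSupercategory.{t, u, v, w} k}
    {a b c : 𝔄.Obj} {G K : 𝔄.Hom b c} (y : G ≅ K) (F : 𝔄.Hom a b) :
    𝔄.comp G F ≅ 𝔄.comp K F where
  hom := 𝔄.hcomp y.hom (𝟙 F)
  inv := 𝔄.hcomp y.inv (𝟙 F)
  hom_inv_id := by rw [← whiskerR_comp, y.hom_inv_id, 𝔄.hcomp_id]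
  inv_hom_id := by rw [← whiskerR_comp, y.inv_hom_id, 𝔄.hcomp_id]

end TwoSupercategory

section Tilde

open TwoSupercategory

variable {k : Type t} [CommRing k]

namespace PiTwoSupercategory

variable (𝔅 : PiTwoSupercategory.{t, u₂, v₂, w₂} k) {a b c : 𝔅.Obj}

/-- The 1-morphism `π^p F`: this is `F` if `p = 0` and `π_b F` if `p = 1`. -/
def pw (p : ZMod 2) (F : 𝔅.Hom a b) : 𝔅.Hom a b :=
  match (p : Fin 2) with
  | 0 => F
  | 1 => 𝔅.comp (𝔅.pi b) F

/-- The 2-isomorphism `ζ^p F : π^p F ≅ F`, of parity `p`: this is the identity if `p = 0` and the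
composite of `ζ_b F : π_b F ≅ 1_b F` with the unit isomorphism if `p = 1`. -/
def zpow (p : ZMod 2) (F : 𝔅.toTwoSupercategory.Hom a b) : 𝔅.pw p F ≅ F :=
  match (p : Fin 2) with
  | 0 => Iso.refl F
  | 1 => whiskerRIso (𝔄 := 𝔅.toTwoSupercategory) (𝔅.zeta b) F ≪≫
      𝔅.toTwoSupercategory.lunit F

theorem zpow_mem (p : ZMod 2) (F : 𝔅.toTwoSupercategory.Hom a b) :
    HasParity k p (𝔅.zpow p F).hom := by
  match (p : Fin 2) with
  | 0 => exact HasParity.id F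
  | 1 => 
    exact ((𝔅.hcomp_mem (𝔅.zeta_mem b) (HasParity.id F)).comp (𝔅.lunit_mem F)).congr (by decide)

theorem zpow_zero (F : 𝔅.toTwoSupercategory.Hom a b) : 𝔅.zpow 0 F = Iso.refl F := rfl

end PiTwoSupercategory

/-- The horizontal composite of two homogeneous 2-isomorphisms. -/
def TwoSupercategory.hcompIso' {𝔄 : TwoSupercategory.{t, u, v, w} k} {a b c : 𝔄.Obj}
    {G K : 𝔄.Hom b c} {F H : 𝔄.Hom a b} {p q : ZMod 2} (y : G ≅ K) (x : F ≅ H)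
    (hy : HasParity k p y.hom) (hx : HasParity k q x.hom) : 𝔄.comp G F ≅ 𝔄.comp K H where
  hom := 𝔄.hcomp y.hom x.hom
  inv := sgn (p * q) • 𝔄.hcomp y.inv x.inv
  hom_inv_id := by
    rw [Preadditive.comp_zsmul, 𝔄.interchange _ _ _ _ (HasParity.inv x hx) hy, smul_smul,
      mul_comm q p, sgn_mul_self, one_smul, y.hom_inv_id, x.hom_inv_id, 𝔄.hcomp_id]
  inv_hom_id := by
    rw [Preadditive.zsmul_comp, 𝔄.interchange _ _ _ _ hx (HasParity.inv y hy), smul_smul,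
      mul_comm q p, sgn_mul_self, one_smul, y.inv_hom_id, x.inv_hom_id, 𝔄.hcomp_id]

/-- The 2-isomorphism `(-1)^p x`. -/
def sgnIso {C : Type u} [Category.{v} C] [Preadditive C] (p : ZMod 2) {X Y : C} (x : X ≅ Y) :
    X ≅ Y where
  hom := sgn p • x.hom
  inv := sgn p • x.inv
  hom_inv_id := by
    rw [Preadditive.zsmul_comp, Preadditive.comp_zsmul, smul_smul, sgn_mul_self, one_smul,
      x.hom_inv_id]
  inv_hom_id := by
    rw [Preadditive.zsmul_comp, Preadditive.comp_zsmul, smul_smul, sgn_mul_self, one_smul,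
      x.inv_hom_id]

theorem TwoSupercategory.hcomp_conj {𝔄 : TwoSupercategory.{t, u, v, w} k} {a b c : 𝔄.Obj}
    {G G' K K' : 𝔄.Hom b c} {F F' H H' : 𝔄.Hom a b} {g q n m p h : ZMod 2} {zG : G' ⟶ G}
    {y : G ⟶ K} {zK : K' ≅ K} {zF : F' ⟶ F} {x : F ⟶ H} {zH : H' ≅ H}
    (hzG : HasParity k g zG) (hy : HasParity k q y) (hzK : HasParity k n zK.hom)
    (hzF : HasParity k m zF) (hx : HasParity k p x) (hzH : HasParity k h zH.hom) :
    𝔄.hcomp (zG ≫ y ≫ zK.inv) (zF ≫ x ≫ zH.inv) ≫ 𝔄.hcomp zK.hom zH.hom =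
      sgn (h * (g + q + n) + p * g) • 𝔄.hcomp zG zF ≫ 𝔄.hcomp y x := by
  rw [𝔄.interchange _ _ _ _ hzH (hzG.comp (hy.comp (HasParity.inv _ hzK))),
    Category.assoc, Category.assoc, Category.assoc, Category.assoc, Iso.inv_hom_id,
    Iso.inv_hom_id, Category.comp_id, Category.comp_id, 𝔄.interchange _ _ _ _ hx hzG, smul_smul,
    ← sgn_add]
  refine congrArg₂ (· • ·) (congrArg sgn ?_) rfl
  have h2 : (2 : ZMod 2) = 0 := rfl
  linear_combination -(p * g) * h2

theorem TwoSupercategory.hcomp_conj_twist {𝔄 : TwoSupercategory.{t, u, v, w} k} {a b c : 𝔄.Obj}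
    {G G' K K' : 𝔄.Hom b c} {F F' H H' : 𝔄.Hom a b} {g n m h : ZMod 2} {zG : G' ⟶ G}
    (y : G ⟶ K) {zK : K' ≅ K} {zF : F' ⟶ F} (x : F ⟶ H) {zH : H' ≅ H}
    (hzG : HasParity k g zG) (hzK : HasParity k n zK.hom)
    (hzF : HasParity k m zF) (hzH : HasParity k h zH.hom) :
    𝔄.hcomp (zG ≫ y ≫ zK.inv) (zF ≫ x ≫ zH.inv) ≫ 𝔄.hcomp zK.hom zH.hom =
      sgn (h * (g + n)) • 𝔄.hcomp zG zF ≫ 𝔄.hcomp (twist k h G K y) (twist k g F H x) := by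
  refine hom_induction k (P := fun y =>
    𝔄.hcomp (zG ≫ y ≫ zK.inv) (zF ≫ x ≫ zH.inv) ≫ 𝔄.hcomp zK.hom zH.hom =
      sgn (h * (g + n)) • 𝔄.hcomp zG zF ≫ 𝔄.hcomp (twist k h G K y) (twist k g F H x)) y ?_ ?_
  · intro q y hy
    refine hom_induction k (P := fun x =>
      𝔄.hcomp (zG ≫ y ≫ zK.inv) (zF ≫ x ≫ zH.inv) ≫ 𝔄.hcomp zK.hom zH.hom =
        sgn (h * (g + n)) • 𝔄.hcomp zG zF ≫ 𝔄.hcomp (twist k h G K y) (twist k g F H x)) x ?_ ?_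
    · intro p x hx
      rw [hcomp_conj hzG hy hzK hzF hx hzH, twist_apply hy, twist_apply hx]
      simp only [map_zsmul, LinearMap.smul_apply, Preadditive.comp_zsmul, smul_smul, ← sgn_add]
      refine congrArg₂ (· • ·) (congrArg sgn ?_) rfl
      ring
    · intro f g hf hg
      simp only [map_add, Preadditive.comp_add, Preadditive.add_comp, smul_add, hf, hg]
  · intro f g hf hg
    simp only [map_add, LinearMap.add_apply, Preadditive.comp_add, Preadditive.add_comp, smul_add,
      hf, hg]

theorem TwoSupercategory.hcomp_cancel_left {𝔄 : TwoSupercategory.{t, u, v, w} k} {a b c : 𝔄.Obj}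
    {L M N W : 𝔄.Hom b c} {F' F : 𝔄.Hom a b} (s : ZMod 2) (z : L ⟶ M) (y : M ⟶ N) (e : W ≅ N)
    (zF : F' ⟶ F) (hy : HasParity k 0 y) (h : HasParity k 0 (sgn s • (z ≫ y ≫ e.inv))) :
    𝔄.hcomp (sgn s • (z ≫ y ≫ e.inv)) (𝟙 F') ≫ 𝔄.hcomp e.hom zF =
      sgn s • 𝔄.hcomp z zF ≫ 𝔄.hcomp y (𝟙 F) := by
  rw [hcomp_comp_even_left _ _ _ _ h, hcomp_comp_even_right _ _ _ _ (HasParity.id F)]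
  simp only [Preadditive.zsmul_comp, Category.assoc, Iso.inv_hom_id, Category.comp_id,
    Category.id_comp, map_zsmul, LinearMap.smul_apply]

theorem TwoSupercategory.hcomp_cancel_right {𝔄 : TwoSupercategory.{t, u, v, w} k} {a b c : 𝔄.Obj}
    {G' G : 𝔄.Hom b c} {L M N W : 𝔄.Hom a b} (s : ZMod 2) (z : L ⟶ M) (y : M ⟶ N) (e : W ≅ N)
    (zG : G' ⟶ G) (hy : HasParity k 0 y) (h : HasParity k 0 (sgn s • (z ≫ y ≫ e.inv))) :
    𝔄.hcomp (𝟙 G') (sgn s • (z ≫ y ≫ e.inv)) ≫ 𝔄.hcomp zG e.hom =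
      sgn s • 𝔄.hcomp zG z ≫ 𝔄.hcomp (𝟙 G) y := by
  rw [hcomp_comp_even_left _ _ _ _ (HasParity.id G'), hcomp_comp_even_right _ _ _ _ hy]
  simp only [Preadditive.zsmul_comp, Category.assoc, Iso.inv_hom_id, Category.comp_id,
    Category.id_comp, map_zsmul]


variable {𝔄 : TwoSupercategory.{t, u₁, v₁, w₁} k} {𝔅 : PiTwoSupercategory.{t, u₂, v₂, w₂} k}

/-- The coherence map `c̃` of `R̃` at `Π^q G`, `Π^p F`. -/
noncomputable def TwoSuperfunctor.tildeC (R : TwoSuperfunctor 𝔄 𝔅.toTwoSupercategory)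
    {a b d : 𝔄.Obj} (q p : ZMod 2) (G : 𝔄.Hom b d) (F : 𝔄.Hom a b) :
    𝔅.toTwoSupercategory.comp (𝔅.pw q (R.map₁ G)) (𝔅.pw p (R.map₁ F)) ≅
      𝔅.pw (p + q) (R.map₁ (𝔄.comp G F)) :=
  sgnIso (p * q) (hcompIso' (𝔅.zpow q (R.map₁ G)) (𝔅.zpow p (R.map₁ F))
    (𝔅.zpow_mem _ _) (𝔅.zpow_mem _ _) ≪≫ R.c G F ≪≫
      (𝔅.zpow (p + q) (R.map₁ (𝔄.comp G F))).symm)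

theorem TwoSuperfunctor.tildeC_hom (R : TwoSuperfunctor 𝔄 𝔅.toTwoSupercategory)
    {a b d : 𝔄.Obj} (q p : ZMod 2) (G : 𝔄.Hom b d) (F : 𝔄.Hom a b) :
    (R.tildeC q p G F).hom = sgn (p * q) • (𝔅.toTwoSupercategory.hcomp
      (𝔅.zpow q (R.map₁ G)).hom (𝔅.zpow p (R.map₁ F)).hom ≫ (R.c G F).hom ≫
        (𝔅.zpow (p + q) (R.map₁ (𝔄.comp G F))).inv) := rfl

theorem TwoSuperfunctor.tildeC_mem (R : TwoSuperfunctor 𝔄 𝔅.toTwoSupercategory)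
    {a b d : 𝔄.Obj} (q p : ZMod 2) (G : 𝔄.Hom b d) (F : 𝔄.Hom a b) :
    HasParity k 0 (R.tildeC q p G F).hom :=
  (((𝔅.hcomp_mem (𝔅.zpow_mem q (R.map₁ G)) (𝔅.zpow_mem p (R.map₁ F))).comp
    ((R.c_mem G F).comp (HasParity.inv _ (𝔅.zpow_mem (p + q)
      (R.map₁ (𝔄.comp G F)))))).zsmul _).congr (by revert p q; decide)

/-- The 2-superfunctor `R̃ : 𝔄_π → 𝔅` induced by `R : 𝔄 → 𝔅`. It sends `Π^p F` to `π^p (R F)` and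
`x_p^q : Π^p F ⟶ Π^q G` to `(ζ^q (R G))⁻¹ ∘ R x ∘ ζ^p (R F)`. Its coherence maps are
`(-1)^{pq} (ζ^{p+q} R(GF))⁻¹ ∘ c_{G,F} ∘ (ζ^q (R G)) (ζ^p (R F))` at `Π^q G`, `Π^p F`. -/
noncomputable def TwoSuperfunctor.tilde (R : TwoSuperfunctor 𝔄 𝔅.toTwoSupercategory) :
    TwoSuperfunctor 𝔄.env 𝔅.toTwoSupercategory where
  obj a := R.obj a
  map₁ {a b : 𝔄.Obj} (F : Env (𝔄.Hom a b)) := 𝔅.pw F.deg (R.map₁ F.base)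
  map₂ {a b : 𝔄.Obj} {F G : Env (𝔄.Hom a b)} x := (𝔅.zpow F.deg (R.map₁ F.base)).hom ≫
    R.map₂ (Env.un x) ≫ (𝔅.zpow G.deg (R.map₁ G.base)).inv
  map₂_id {a b : 𝔄.Obj} (F : Env (𝔄.Hom a b)) := by
    change _ ≫ R.map₂ (𝟙 F.base) ≫ _ = _
    rw [R.map₂_id, Category.id_comp, Iso.hom_inv_id]
  map₂_comp {a b : 𝔄.Obj} {F G H : Env (𝔄.Hom a b)} x y := by
    change _ ≫ R.map₂ (Env.un x ≫ Env.un y) ≫ _ = _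
    simp [R.map₂_comp]
  map₂_add {a b : 𝔄.Obj} {F G : Env (𝔄.Hom a b)} x y := by
    change _ ≫ R.map₂ (Env.un x + Env.un y) ≫ _ = _
    rw [R.map₂_add, Preadditive.add_comp, Preadditive.comp_add]
  map₂_smul {a b : 𝔄.Obj} {F G : Env (𝔄.Hom a b)} r x := by
    change _ ≫ R.map₂ (r • Env.un x) ≫ _ = _
    rw [R.map₂_smul, Linear.smul_comp, Linear.comp_smul]
  map₂_mem {a b : 𝔄.Obj} {F G : Env (𝔄.Hom a b)} {p x} h :=
    ((𝔅.zpow_mem F.deg (R.map₁ F.base)).comp ((R.map₂_mem ((Env.hasParity_iff _ _).1 h)).comp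
      (HasParity.inv _ (𝔅.zpow_mem G.deg (R.map₁ G.base))))).congr (by
        generalize F.deg = f, G.deg = g; clear h; revert p f g; decide)
  c {a b d : 𝔄.Obj} (G : Env (𝔄.Hom b d)) (F : Env (𝔄.Hom a b)) :=
    R.tildeC G.deg F.deg G.base F.base
  c_mem {a b d : 𝔄.Obj} (G : Env (𝔄.Hom b d)) (F : Env (𝔄.Hom a b)) := R.tildeC_mem _ _ _ _
  c_naturality {a b d : 𝔄.Obj} {G K : Env (𝔄.Hom b d)} {F H : Env (𝔄.Hom a b)} y x := by
    have h1 := hcomp_conj_twist (R.map₂ (Env.un y)) (R.map₂ (Env.un x))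
      (𝔅.zpow_mem G.deg (R.map₁ G.base)) (𝔅.zpow_mem K.deg (R.map₁ K.base))
      (𝔅.zpow_mem F.deg (R.map₁ F.base)) (𝔅.zpow_mem H.deg (R.map₁ H.base))
    change 𝔅.hcomp _ _ ≫ (sgn _ • (𝔅.hcomp _ _ ≫ (R.c _ _).hom ≫ (𝔅.zpow _ _).inv)) =
      (sgn _ • (𝔅.hcomp _ _ ≫ (R.c _ _).hom ≫ (𝔅.zpow _ _).inv)) ≫ (𝔅.zpow _ _).hom ≫
        R.map₂ (sgn (G.deg * H.deg + F.deg * G.deg) •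
          𝔄.hcomp (twist k H.deg _ _ (Env.un y)) (twist k G.deg _ _ (Env.un x))) ≫
        (𝔅.zpow _ _).inv
    rw [R.map₂_zsmul]
    simp only [Preadditive.zsmul_comp, Preadditive.comp_zsmul, Category.assoc,
      Iso.inv_hom_id_assoc, smul_smul, ← sgn_add]
    rw [reassoc_of% h1, ← R.map₂_twist, ← R.map₂_twist]
    simp only [Preadditive.zsmul_comp, smul_smul, ← sgn_add, Category.assoc]
    rw [reassoc_of% R.c_naturality]
    refine congrArg₂ (· • ·) (congrArg sgn ?_) rfl
    have h2 : (2 : ZMod 2) = 0 := rfl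
    linear_combination (H.deg * K.deg - F.deg * G.deg) * h2
  i a := R.i a
  i_mem a := R.i_mem a
  assoc {a b d e : 𝔄.Obj} (H : Env (𝔄.Hom d e)) (G : Env (𝔄.Hom b d)) (F : Env (𝔄.Hom a b)) := by
    have h1 := R.tildeC_mem H.deg G.deg H.base G.base
    have h2 := R.tildeC_mem G.deg F.deg G.base F.base
    change 𝔅.hcomp (R.tildeC H.deg G.deg H.base G.base).hom (𝟙 (𝔅.pw F.deg (R.map₁ F.base))) ≫
        (R.tildeC (G.deg + H.deg) F.deg (𝔄.comp H.base G.base) F.base).hom ≫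
        (𝔅.zpow (F.deg + (G.deg + H.deg)) _).hom ≫ R.map₂ (𝔄.assoc H.base G.base F.base).hom ≫
        (𝔅.zpow (F.deg + G.deg + H.deg) _).inv =
      (𝔅.assoc _ _ _).hom ≫ 𝔅.hcomp (𝟙 (𝔅.pw H.deg (R.map₁ H.base)))
        (R.tildeC G.deg F.deg G.base F.base).hom ≫
        (R.tildeC H.deg (F.deg + G.deg) H.base (𝔄.comp G.base F.base)).hom
    rw [R.tildeC_hom] at h1 h2
    have e1 := hcomp_cancel_left _ _ _ _ (𝔅.zpow F.deg (R.map₁ F.base)).hom (R.c_mem _ _) h1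
    have e2 := hcomp_cancel_right _ _ _ _ (𝔅.zpow H.deg (R.map₁ H.base)).hom (R.c_mem _ _) h2
    simp only [R.tildeC_hom]
    rw [Preadditive.zsmul_comp, Preadditive.comp_zsmul]
    rw [Preadditive.comp_zsmul, Preadditive.comp_zsmul]
    simp only [Category.assoc, Iso.inv_hom_id_assoc]
    rw [reassoc_of% e1, reassoc_of% e2]
    simp only [Preadditive.zsmul_comp, Preadditive.comp_zsmul, smul_smul, ← sgn_add, Category.assoc]
    have e3 := R.assoc H.base G.base F.base
    have e4 := 𝔅.assoc_naturality (𝔅.zpow H.deg (R.map₁ H.base)).hom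
      (𝔅.zpow G.deg (R.map₁ G.base)).hom (𝔅.zpow F.deg (R.map₁ F.base)).hom
    rw [reassoc_of% e3, reassoc_of% e4]
    refine congrArg₂ (· • ·) (congrArg sgn ?_) rfl
    ring
  runit {a b : 𝔄.Obj} (F : Env (𝔄.Hom a b)) := by
    change 𝔅.hcomp (𝟙 (𝔅.pw F.deg (R.map₁ F.base))) (R.i a).hom ≫
      (R.tildeC F.deg 0 F.base (𝔄.one a)).hom ≫ (𝔅.zpow (0 + F.deg) _).hom ≫
        R.map₂ (𝔄.runit F.base).hom ≫ (𝔅.zpow F.deg _).inv = (𝔅.runit _).hom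
    have h1 := hcomp_comp_even_left (𝟙 (𝔅.pw F.deg (R.map₁ F.base)))
      (𝔅.zpow F.deg (R.map₁ F.base)).hom (R.i a).hom (𝟙 _) (HasParity.id _)
    have h2 := hcomp_comp_even_right (𝔅.zpow F.deg (R.map₁ F.base)).hom
      (𝟙 _) (𝟙 _) (R.i a).hom (R.i_mem a)
    simp only [Category.id_comp, Category.comp_id] at h1 h2
    have e : (R.tildeC F.deg 0 F.base (𝔄.one a)).hom =
        𝔅.hcomp (𝔅.zpow F.deg (R.map₁ F.base)).hom (𝟙 (R.map₁ (𝔄.one a))) ≫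
          (R.c F.base (𝔄.one a)).hom ≫ (𝔅.zpow (0 + F.deg) _).inv := by
      rw [R.tildeC_hom, zero_mul, sgn_zero, one_smul]; rfl
    refine (congrArg (fun z => 𝔅.hcomp (𝟙 (𝔅.pw F.deg (R.map₁ F.base))) (R.i a).hom ≫ z ≫
      (𝔅.zpow (0 + F.deg) _).hom ≫ R.map₂ (𝔄.runit F.base).hom ≫ (𝔅.zpow F.deg _).inv) e).trans ?_
    simp only [Category.assoc, Iso.inv_hom_id_assoc]
    rw [reassoc_of% h1, ← h2, Category.assoc, reassoc_of% R.runit, reassoc_of% 𝔅.runit_naturality,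
      Iso.hom_inv_id, Category.comp_id]
  lunit {a b : 𝔄.Obj} (F : Env (𝔄.Hom a b)) := by
    change 𝔅.hcomp (R.i b).hom (𝟙 (𝔅.pw F.deg (R.map₁ F.base))) ≫
      (R.tildeC 0 F.deg (𝔄.one b) F.base).hom ≫ (𝔅.zpow (F.deg + 0) _).hom ≫
        R.map₂ (𝔄.lunit F.base).hom ≫ (𝔅.zpow F.deg _).inv = (𝔅.lunit _).hom
    have h1 := hcomp_comp_even_left (R.i b).hom (𝟙 _) (𝟙 (𝔅.pw F.deg (R.map₁ F.base)))
      (𝔅.zpow F.deg (R.map₁ F.base)).hom (R.i_mem b)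
    have h2 := hcomp_comp_even_right (𝟙 _) (R.i b).hom
      (𝔅.zpow F.deg (R.map₁ F.base)).hom (𝟙 _) (HasParity.id _)
    simp only [Category.id_comp, Category.comp_id] at h1 h2
    have e : (R.tildeC 0 F.deg (𝔄.one b) F.base).hom =
        𝔅.hcomp (𝟙 (R.map₁ (𝔄.one b))) (𝔅.zpow F.deg (R.map₁ F.base)).hom ≫
          (R.c (𝔄.one b) F.base).hom ≫ (𝔅.zpow (F.deg + 0) _).inv := by
      rw [R.tildeC_hom, mul_zero, sgn_zero, one_smul]; rfl
    refine (congrArg (fun z => 𝔅.hcomp (R.i b).hom (𝟙 (𝔅.pw F.deg (R.map₁ F.base))) ≫ z ≫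
      (𝔅.zpow (F.deg + 0) _).hom ≫ R.map₂ (𝔄.lunit F.base).hom ≫ (𝔅.zpow F.deg _).inv) e).trans ?_
    simp only [Category.assoc, Iso.inv_hom_id_assoc]
    rw [reassoc_of% h1, ← h2, Category.assoc, reassoc_of% R.lunit, reassoc_of% 𝔅.lunit_naturality,
      Iso.hom_inv_id, Category.comp_id]

end Tilde

section Extension

open TwoSupercategory

variable {k : Type t} [CommRing k]

theorem TwoSupercategory.whisker_exchange_even_right {𝔄 : TwoSupercategory.{t, u, v, w} k}
    {a b c : 𝔄.Obj} {G K : 𝔄.Hom b c} {F H : 𝔄.Hom a b} (y : G ⟶ K) (x : F ⟶ H)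
    (hx : HasParity k 0 x) :
    𝔄.hcomp (𝟙 G) x ≫ 𝔄.hcomp y (𝟙 H) = 𝔄.hcomp y (𝟙 F) ≫ 𝔄.hcomp (𝟙 K) x := by
  rw [← hcomp_eq, hcomp_comp_even_right _ _ _ _ hx, Category.id_comp, Category.comp_id]

/-- The 2-isomorphism `G x : G F ≅ G H` for a 2-isomorphism `x : F ≅ H`. -/
def TwoSupercategory.whiskerLIso {𝔄 : TwoSupercategory.{t, u, v, w} k}
    {a b c : 𝔄.Obj} (G : 𝔄.Hom b c) {F H : 𝔄.Hom a b} (x : F ≅ H) :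
    𝔄.comp G F ≅ 𝔄.comp G H where
  hom := 𝔄.hcomp (𝟙 G) x.hom
  inv := 𝔄.hcomp (𝟙 G) x.inv
  hom_inv_id := by rw [← whiskerL_comp, x.hom_inv_id, 𝔄.hcomp_id]
  inv_hom_id := by rw [← whiskerL_comp, x.inv_hom_id, 𝔄.hcomp_id]

variable {𝔄 : TwoSupercategory.{t, u₁, v₁, w₁} k} {𝔅 : TwoSupercategory.{t, u₂, v₂, w₂} k}

/-- The compatibility of a natural family with horizontal composition can be transported along
2-isomorphisms. -/
theorem TwoNatTrans.x_comp_of_iso {R S : TwoSuperfunctor 𝔄 𝔅}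
    (X : ∀ a, 𝔅.Hom (R.obj a) (S.obj a))
    (x : ∀ {a b} (F : 𝔄.Hom a b), 𝔅.comp (X b) (R.map₁ F) ⟶ 𝔅.comp (S.map₁ F) (X a))
    (x_mem : ∀ {a b} (F : 𝔄.Hom a b), HasParity k 0 (x F))
    (x_naturality : ∀ {a b} {F G : 𝔄.Hom a b} (f : F ⟶ G),
      𝔅.hcomp (𝟙 (X b)) (R.map₂ f) ≫ x G = x F ≫ 𝔅.hcomp (S.map₂ f) (𝟙 (X a)))
    {a b d : 𝔄.Obj} {G G' : 𝔄.Hom b d} {F F' : 𝔄.Hom a b} (u : G ≅ G') (v : F ≅ F')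
    (h : 𝔅.hcomp (𝟙 (X d)) (R.c G' F').hom ≫ x (𝔄.comp G' F') =
      (𝔅.assoc (X d) (R.map₁ G') (R.map₁ F')).inv ≫ 𝔅.hcomp (x G') (𝟙 (R.map₁ F')) ≫
        (𝔅.assoc (S.map₁ G') (X b) (R.map₁ F')).hom ≫ 𝔅.hcomp (𝟙 (S.map₁ G')) (x F') ≫
        (𝔅.assoc (S.map₁ G') (S.map₁ F') (X a)).inv ≫ 𝔅.hcomp (S.c G' F').hom (𝟙 (X a))) :
    𝔅.hcomp (𝟙 (X d)) (R.c G F).hom ≫ x (𝔄.comp G F) =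
      (𝔅.assoc (X d) (R.map₁ G) (R.map₁ F)).inv ≫ 𝔅.hcomp (x G) (𝟙 (R.map₁ F)) ≫
        (𝔅.assoc (S.map₁ G) (X b) (R.map₁ F)).hom ≫ 𝔅.hcomp (𝟙 (S.map₁ G)) (x F) ≫
        (𝔅.assoc (S.map₁ G) (S.map₁ F) (X a)).inv ≫ 𝔅.hcomp (S.c G F).hom (𝟙 (X a)) := by
  have hm : 𝔄.hcomp u.hom v.hom = (whiskerLIso G v ≪≫ whiskerRIso u F').hom := hcomp_eq _ _
  have hi : IsIso (𝔅.hcomp (S.map₂ (𝔄.hcomp u.hom v.hom)) (𝟙 (X a))) := by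
    rw [hm]
    exact (whiskerRIso (S.mapIso (whiskerLIso G v ≪≫ whiskerRIso u F')) (X a)).isIso_hom
  rw [← cancel_mono (𝔅.hcomp (S.map₂ (𝔄.hcomp u.hom v.hom)) (𝟙 (X a)))]
  simp only [Category.assoc]
  rw [← x_naturality, ← whiskerR_comp, ← S.c_naturality, whiskerR_comp, ← Category.assoc,
    ← whiskerL_comp, ← R.c_naturality, whiskerL_comp, Category.assoc, h]
  simp only [← Category.assoc]
  congr 1
  simp only [Category.assoc]
  have a1 := assoc_inv_naturality (𝟙 (X d)) (R.map₂ u.hom) (R.map₂ v.hom)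
  have a2 := 𝔅.assoc_naturality (S.map₂ u.hom) (𝟙 (X b)) (R.map₂ v.hom)
  have a3 := assoc_inv_naturality (S.map₂ u.hom) (S.map₂ v.hom) (𝟙 (X a))
  have n1 : 𝔅.hcomp (𝔅.hcomp (𝟙 (X d)) (R.map₂ u.hom)) (R.map₂ v.hom) ≫
      𝔅.hcomp (x G') (𝟙 (R.map₁ F')) = 𝔅.hcomp (x G) (𝟙 (R.map₁ F)) ≫
      𝔅.hcomp (𝔅.hcomp (S.map₂ u.hom) (𝟙 (X b))) (R.map₂ v.hom) := by
    rw [hcomp_comp_even_right _ _ _ _ (HasParity.id _), x_naturality,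
      hcomp_comp_even_left _ _ _ _ (x_mem _), Category.comp_id, Category.id_comp]
  have n2 : 𝔅.hcomp (S.map₂ u.hom) (𝔅.hcomp (𝟙 (X b)) (R.map₂ v.hom)) ≫
      𝔅.hcomp (𝟙 (S.map₁ G')) (x F') = 𝔅.hcomp (𝟙 (S.map₁ G)) (x F) ≫
      𝔅.hcomp (S.map₂ u.hom) (𝔅.hcomp (S.map₂ v.hom) (𝟙 (X a))) := by
    rw [hcomp_comp_even_right _ _ _ _ (x_mem _), x_naturality,
      hcomp_comp_even_left _ _ _ _ (HasParity.id _), Category.comp_id, Category.id_comp]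
  rw [reassoc_of% a1, reassoc_of% n1, reassoc_of% a2, reassoc_of% n2, a3]

end Extension
section TildeTransformation

open TwoSupercategory

variable {k : Type t} [CommRing k] {𝔄 : TwoSupercategory.{t, u₁, v₁, w₁} k}
  {𝔅 : PiTwoSupercategory.{t, u₂, v₂, w₂} k}

/-- The isomorphism `(1_F)_p^0 : Π^p F ≅ Π^0 F`. -/
def Env.toZero {C : Type u} [Category.{v} C] (F : Env C) : F ≅ (⟨0, F.base⟩ : Env C) :=
  Env.mkIso (Iso.refl F.base)

theorem TwoSuperfunctor.tildeC_zero (R : TwoSuperfunctor 𝔄 𝔅.toTwoSupercategory)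
    {a b d : 𝔄.Obj} (G : 𝔄.Hom b d) (F : 𝔄.Hom a b) :
    (R.tildeC 0 0 G F).hom = (R.c G F).hom := by
  rw [R.tildeC_hom, mul_zero, sgn_zero, one_smul]
  change 𝔅.hcomp (𝟙 (R.map₁ G)) (𝟙 (R.map₁ F)) ≫ (R.c G F).hom ≫ 𝟙 (R.map₁ (𝔄.comp G F)) = _
  rw [𝔅.hcomp_id, Category.id_comp, Category.comp_id]

/-- The component `x̃` of `X̃` at `Π^p F`: it is `(ζ^p (S F) X)⁻¹ ∘ x_F ∘ (X ζ^p (R F))`. -/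
def TwoNatTrans.tildeX {R S : TwoSuperfunctor 𝔄 𝔅.toTwoSupercategory} (X : TwoNatTrans R S)
    (p : ZMod 2) {a b : 𝔄.Obj} (F : 𝔄.Hom a b) :
    𝔅.toTwoSupercategory.comp (X.X b) (𝔅.pw p (R.map₁ F)) ⟶
      𝔅.toTwoSupercategory.comp (𝔅.pw p (S.map₁ F)) (X.X a) :=
  𝔅.hcomp (𝟙 (X.X b)) (𝔅.zpow p (R.map₁ F)).hom ≫ X.x F ≫
    𝔅.hcomp (𝔅.zpow p (S.map₁ F)).inv (𝟙 (X.X a))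

theorem TwoNatTrans.tildeX_mem {R S : TwoSuperfunctor 𝔄 𝔅.toTwoSupercategory}
    (X : TwoNatTrans R S) (p : ZMod 2) {a b : 𝔄.Obj} (F : 𝔄.Hom a b) :
    HasParity k 0 (X.tildeX p F) :=
  ((𝔅.hcomp_mem (HasParity.id (X.X b)) (𝔅.zpow_mem p (R.map₁ F))).comp
    ((X.x_mem F).comp (𝔅.hcomp_mem (HasParity.inv _ (𝔅.zpow_mem p (S.map₁ F)))
      (HasParity.id (X.X a))))).congr (by revert p; decide)

theorem TwoNatTrans.tildeX_zero {R S : TwoSuperfunctor 𝔄 𝔅.toTwoSupercategory}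
    (X : TwoNatTrans R S) {a b : 𝔄.Obj} (F : 𝔄.Hom a b) : X.tildeX 0 F = X.x F := by
  change 𝔅.hcomp (𝟙 (X.X b)) (𝟙 (R.map₁ F)) ≫ X.x F ≫ 𝔅.hcomp (𝟙 (S.map₁ F)) (𝟙 (X.X a)) = _
  rw [𝔅.hcomp_id, 𝔅.hcomp_id, Category.id_comp, Category.comp_id]

theorem TwoNatTrans.tildeX_naturality {R S : TwoSuperfunctor 𝔄 𝔅.toTwoSupercategory}
    (X : TwoNatTrans R S) (p q : ZMod 2) {a b : 𝔄.Obj} {F G : 𝔄.Hom a b} (f : F ⟶ G) :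
    𝔅.hcomp (𝟙 (X.X b)) ((𝔅.zpow p (R.map₁ F)).hom ≫ R.map₂ f ≫ (𝔅.zpow q (R.map₁ G)).inv) ≫
      X.tildeX q G = X.tildeX p F ≫
        𝔅.hcomp ((𝔅.zpow p (S.map₁ F)).hom ≫ S.map₂ f ≫ (𝔅.zpow q (S.map₁ G)).inv)
          (𝟙 (X.X a)) := by
  have h1 : 𝔅.hcomp (𝟙 (X.X b)) (𝔅.zpow q (R.map₁ G)).inv ≫
      𝔅.hcomp (𝟙 (X.X b)) (𝔅.zpow q (R.map₁ G)).hom = 𝟙 _ := by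
    rw [← whiskerL_comp, Iso.inv_hom_id, 𝔅.hcomp_id]
  have h2 : 𝔅.hcomp (𝔅.zpow p (S.map₁ F)).inv (𝟙 (X.X a)) ≫
      𝔅.hcomp (𝔅.zpow p (S.map₁ F)).hom (𝟙 (X.X a)) = 𝟙 _ := by
    rw [← whiskerR_comp, Iso.inv_hom_id, 𝔅.hcomp_id]
  simp only [tildeX, whiskerL_comp, whiskerR_comp, Category.assoc]
  rw [reassoc_of% h1, reassoc_of% h2, reassoc_of% X.x_naturality]

/-- The 2-natural transformation `X̃ : R̃ ⇒ S̃` induced by `X : R ⇒ S`: the 1-morphisms are those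
of `X`, and `x̃` at `Π^p F` is `(ζ^p (S F) X)⁻¹ ∘ x_F ∘ (X ζ^p (R F))`. -/
noncomputable def TwoNatTrans.tilde {R S : TwoSuperfunctor 𝔄 𝔅.toTwoSupercategory}
    (X : TwoNatTrans R S) : TwoNatTrans R.tilde S.tilde where
  X := fun a : 𝔄.Obj => X.X a
  x {a b : 𝔄.Obj} (F : Env (𝔄.Hom a b)) := X.tildeX F.deg F.base
  x_mem {a b : 𝔄.Obj} (F : Env (𝔄.Hom a b)) := X.tildeX_mem _ _
  x_naturality {a b : 𝔄.Obj} {F G : Env (𝔄.Hom a b)} f := X.tildeX_naturality _ _ (Env.un f)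
  x_comp {a b d : 𝔄.Obj} (G : Env (𝔄.Hom b d)) (F : Env (𝔄.Hom a b)) := by
    refine TwoNatTrans.x_comp_of_iso (R := R.tilde) (S := S.tilde) (fun a : 𝔄.Obj => X.X a)
      (fun {a b : 𝔄.Obj} (F : Env (𝔄.Hom a b)) => X.tildeX F.deg F.base)
      (fun {a b : 𝔄.Obj} (F : Env (𝔄.Hom a b)) => X.tildeX_mem _ _)
      (fun {a b : 𝔄.Obj} {F G : Env (𝔄.Hom a b)} f => X.tildeX_naturality _ _ (Env.un f))
      (Env.toZero G) (Env.toZero F) ?_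
    have h := X.x_comp G.base F.base
    rw [← R.tildeC_zero, ← S.tildeC_zero, ← X.tildeX_zero, ← X.tildeX_zero, ← X.tildeX_zero] at h
    exact h
  x_unit := fun a : 𝔄.Obj => by
    have h := X.x_unit a
    rw [← X.tildeX_zero] at h
    exact h

end TildeTransformation

section TildeTwo

open TwoSupercategory

theorem TwoSupercategory.comp_hcomp_id {k : Type t} [CommRing k]
    {𝔅 : TwoSupercategory.{t, u, v, w} k} {a b c d : 𝔅.Obj} {F : 𝔅.Hom a b} {G : 𝔅.Hom b d}
    {H : 𝔅.Hom a c} {K : 𝔅.Hom c d} {f g : 𝔅.comp G F ⟶ 𝔅.comp K H} (h : f = g) :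
    f ≫ 𝔅.hcomp (𝟙 K) (𝟙 H) = 𝔅.hcomp (𝟙 G) (𝟙 F) ≫ g := by
  rw [h, 𝔅.hcomp_id, 𝔅.hcomp_id, Category.comp_id, Category.id_comp]

variable {k : Type t} [CommRing k] {𝔄 : TwoSupercategory.{t, u₁, v₁, w₁} k}
  {𝔅 : PiTwoSupercategory.{t, u₂, v₂, w₂} k}

/-- A supermodification `X ⇛ Y` is also a supermodification `X̃ ⇛ Ỹ`. -/
theorem TwoNatTrans.tilde_mod {R S : TwoSuperfunctor 𝔄 𝔅.toTwoSupercategory}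
    {X Y : TwoNatTrans R S} (α : X ⟶ Y) (p : ZMod 2) {a b : 𝔄.Obj} (F : 𝔄.Hom a b) :
    X.tildeX p F ≫ 𝔅.hcomp (𝟙 (𝔅.pw p (S.map₁ F))) (app α a) =
      𝔅.hcomp (app α b) (𝟙 (𝔅.pw p (R.map₁ F))) ≫ Y.tildeX p F := by
  refine hom_induction k (P := fun α : X ⟶ Y =>
    X.tildeX p F ≫ 𝔅.hcomp (𝟙 (𝔅.pw p (S.map₁ F))) (app α a) =
      𝔅.hcomp (app α b) (𝟙 (𝔅.pw p (R.map₁ F))) ≫ Y.tildeX p F) α ?_ ?_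
  · intro q α hα
    have h1 : 𝔅.hcomp (𝔅.zpow p (S.map₁ F)).inv (𝟙 (X.X a)) ≫
        𝔅.hcomp (𝟙 (𝔅.pw p (S.map₁ F))) (app α a) = sgn (q * p) •
        𝔅.hcomp (𝟙 (S.map₁ F)) (app α a) ≫ 𝔅.hcomp (𝔅.zpow p (S.map₁ F)).inv (𝟙 (Y.X a)) := by
      rw [𝔅.interchange _ _ _ _ (app_mem hα a) (HasParity.inv _ (𝔅.zpow_mem p (S.map₁ F))),
        ← hcomp_eq, Category.comp_id, Category.id_comp]
    have h2 : 𝔅.hcomp (app α b) (𝟙 (𝔅.pw p (R.map₁ F))) ≫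
        𝔅.hcomp (𝟙 (Y.X b)) (𝔅.zpow p (R.map₁ F)).hom = sgn (q * p) •
        𝔅.hcomp (𝟙 (X.X b)) (𝔅.zpow p (R.map₁ F)).hom ≫ 𝔅.hcomp (app α b) (𝟙 (R.map₁ F)) := by
      rw [𝔅.interchange _ _ _ _ (𝔅.zpow_mem p (R.map₁ F)) (app_mem hα b),
        ← hcomp_eq, Category.comp_id, Category.id_comp, mul_comm]
    simp only [tildeX, Category.assoc]
    rw [h1, reassoc_of% h2]
    simp only [Preadditive.comp_zsmul, Preadditive.zsmul_comp, Category.assoc]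
    rw [reassoc_of% app_nat α F]
  · intro α β hα hβ
    have e : ∀ a, app (α + β) a = app α a + app β a := fun _ => rfl
    rw [e, e, map_add, map_add, LinearMap.add_apply, Preadditive.comp_add, Preadditive.add_comp,
      hα, hβ]

theorem TwoNatTrans.tildeX_comp {R S T : TwoSuperfunctor 𝔄 𝔅.toTwoSupercategory}
    (Y : TwoNatTrans S T) (X : TwoNatTrans R S) (p : ZMod 2) {a b : 𝔄.Obj} (F : 𝔄.Hom a b) :
    (Y.tilde.comp X.tilde).x (show 𝔄.env.Hom a b from ⟨p, F⟩) = (Y.comp X).tildeX p F := by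
  change (𝔅.assoc (Y.X b) (X.X b) (𝔅.pw p (R.map₁ F))).hom ≫
      𝔅.hcomp (𝟙 (Y.X b)) (X.tildeX p F) ≫
      (𝔅.assoc (Y.X b) (𝔅.pw p (S.map₁ F)) (X.X a)).inv ≫ 𝔅.hcomp (Y.tildeX p F) (𝟙 (X.X a)) ≫
      (𝔅.assoc (𝔅.pw p (T.map₁ F)) (Y.X a) (X.X a)).hom =
    𝔅.hcomp (𝟙 (𝔅.comp (Y.X b) (X.X b))) (𝔅.zpow p (R.map₁ F)).hom ≫
      ((𝔅.assoc (Y.X b) (X.X b) (R.map₁ F)).hom ≫ 𝔅.hcomp (𝟙 (Y.X b)) (X.x F) ≫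
      (𝔅.assoc (Y.X b) (S.map₁ F) (X.X a)).inv ≫ 𝔅.hcomp (Y.x F) (𝟙 (X.X a)) ≫
      (𝔅.assoc (T.map₁ F) (Y.X a) (X.X a)).hom) ≫
      𝔅.hcomp (𝔅.zpow p (T.map₁ F)).inv (𝟙 (𝔅.comp (Y.X a) (X.X a)))
  have h1 := 𝔅.assoc_naturality (𝟙 (Y.X b)) (𝟙 (X.X b)) (𝔅.zpow p (R.map₁ F)).hom
  have h2 := 𝔅.assoc_naturality (𝔅.zpow p (T.map₁ F)).inv (𝟙 (Y.X a)) (𝟙 (X.X a))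
  have h3 := assoc_inv_naturality (𝟙 (Y.X b)) (𝔅.zpow p (S.map₁ F)).inv (𝟙 (X.X a))
  have h4 : 𝔅.hcomp (𝔅.hcomp (𝟙 (Y.X b)) (𝔅.zpow p (S.map₁ F)).inv) (𝟙 (X.X a)) ≫
      𝔅.hcomp (𝔅.hcomp (𝟙 (Y.X b)) (𝔅.zpow p (S.map₁ F)).hom) (𝟙 (X.X a)) = 𝟙 _ := by
    rw [← whiskerR_comp, ← whiskerL_comp, Iso.inv_hom_id, 𝔅.hcomp_id, 𝔅.hcomp_id]
  rw [𝔅.hcomp_id] at h1 h2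
  simp only [tildeX, whiskerL_comp, whiskerR_comp, Category.assoc]
  rw [← h2, reassoc_of% h1, reassoc_of% h3, reassoc_of% h4]

theorem TwoNatTrans.tildeX_id (R : TwoSuperfunctor 𝔄 𝔅.toTwoSupercategory)
    (p : ZMod 2) {a b : 𝔄.Obj} (F : 𝔄.Hom a b) :
    (TwoNatTrans.id R.tilde).x (show 𝔄.env.Hom a b from ⟨p, F⟩) =
      (TwoNatTrans.id R).tildeX p F := by
  change (𝔅.lunit (𝔅.pw p (R.map₁ F))).hom ≫ (𝔅.runit (𝔅.pw p (R.map₁ F))).inv =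
    𝔅.hcomp (𝟙 (𝔅.one (R.obj b))) (𝔅.zpow p (R.map₁ F)).hom ≫
      ((𝔅.lunit (R.map₁ F)).hom ≫ (𝔅.runit (R.map₁ F)).inv) ≫
      𝔅.hcomp (𝔅.zpow p (R.map₁ F)).inv (𝟙 (𝔅.one (R.obj a)))
  rw [Category.assoc, reassoc_of% 𝔅.lunit_naturality, ← cancel_mono (𝔅.runit _).hom]
  simp only [Category.assoc, 𝔅.runit_naturality]
  simp

/-- The 2-superfunctor `𝔥𝔬𝔪(𝔄, 𝔅) → 𝔥𝔬𝔪(𝔄_π, 𝔅)`, `R ↦ R̃`, `X ↦ X̃`. A supermodification is sent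
to the supermodification with the same components, and the coherence maps are identities. -/
noncomputable def tildeTwo (𝔄 : TwoSupercategory.{t, u₁, v₁, w₁} k)
    (𝔅 : PiTwoSupercategory.{t, u₂, v₂, w₂} k) :
    TwoSuperfunctor (HomTwo 𝔄 𝔅.toTwoSupercategory) (HomTwo 𝔄.env 𝔅.toTwoSupercategory) where
  obj R := TwoSuperfunctor.tilde R
  map₁ X := TwoNatTrans.tilde X
  map₂ α := ⟨fun a => TwoNatTrans.app α a, fun {a b} F => TwoNatTrans.tilde_mod α F.deg F.base⟩
  map₂_id X := rfl
  map₂_comp α β := rfl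
  map₂_add α β := rfl
  map₂_smul r α := rfl
  map₂_mem h := h
  c {R S T} Y X := TwoNatTrans.mkIso (X := Y.tilde.comp X.tilde) (Y := (Y.comp X).tilde)
    (fun a : 𝔄.Obj => Iso.refl (𝔅.comp (Y.X a) (X.X a))) fun {a b : 𝔄.Obj} (F : Env (𝔄.Hom a b)) =>
      comp_hcomp_id (𝔅 := 𝔅.toTwoSupercategory) (Y.tildeX_comp X F.deg F.base)
  c_mem {R S T} Y X := fun a : 𝔄.Obj => by
    have h : HasParity k 0 (𝟙 (𝔅.comp (Y.X a) (X.X a))) :=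
      HasParity.id (C := 𝔅.Hom (TwoSuperfunctor.obj R a) (TwoSuperfunctor.obj T a)) _
    exact h
  c_naturality {R S T Y Y' X X'} β α := TwoNatTrans.hom_ext fun a : 𝔄.Obj =>
    (Category.comp_id (𝔅.hcomp (TwoNatTrans.app β a) (TwoNatTrans.app α a))).trans
      (Category.id_comp _).symm
  i R := TwoNatTrans.mkIso (X := TwoNatTrans.id (TwoSuperfunctor.tilde R))
    (Y := (TwoNatTrans.id R).tilde) (fun a : 𝔄.Obj => Iso.refl (𝔅.one (R.obj a)))
    fun {a b : 𝔄.Obj} (F : Env (𝔄.Hom a b)) =>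
      comp_hcomp_id (𝔅 := 𝔅.toTwoSupercategory) (TwoNatTrans.tildeX_id R F.deg F.base)
  i_mem R := fun a : 𝔄.Obj => by
    have h : HasParity k 0 (𝟙 (𝔅.one (R.obj a))) := HasParity.id _
    exact h
  assoc {R S T U} Z Y X := TwoNatTrans.hom_ext fun a : 𝔄.Obj => by
    change 𝔅.hcomp (𝟙 (𝔅.comp (Z.X a) (Y.X a))) (𝟙 (X.X a)) ≫ 𝟙 (𝔅.comp (𝔅.comp (Z.X a) (Y.X a)) (X.X a)) ≫
        (𝔅.assoc (Z.X a) (Y.X a) (X.X a)).hom = (𝔅.assoc (Z.X a) (Y.X a) (X.X a)).hom ≫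
        𝔅.hcomp (𝟙 (Z.X a)) (𝟙 (𝔅.comp (Y.X a) (X.X a))) ≫ 𝟙 (𝔅.comp (Z.X a) (𝔅.comp (Y.X a) (X.X a)))
    simp [𝔅.hcomp_id]
  runit {R S} X := TwoNatTrans.hom_ext fun a : 𝔄.Obj => by
    change 𝔅.hcomp (𝟙 (X.X a)) (𝟙 (𝔅.one (R.obj a))) ≫ 𝟙 (𝔅.comp (X.X a) (𝔅.one (R.obj a))) ≫
      (𝔅.runit (X.X a)).hom = (𝔅.runit (X.X a)).hom
    simp [𝔅.hcomp_id]
  lunit {R S} X := TwoNatTrans.hom_ext fun a : 𝔄.Obj => by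
    change 𝔅.hcomp (𝟙 (𝔅.one (S.obj a))) (𝟙 (X.X a)) ≫ 𝟙 (𝔅.comp (𝔅.one (S.obj a)) (X.X a)) ≫
      (𝔅.lunit (X.X a)).hom = (𝔅.lunit (X.X a)).hom
    simp [𝔅.hcomp_id]

end TildeTwo

section Equivalence

open TwoSupercategory

variable {k : Type t} [CommRing k]

/-- Two objects of a 2-supercategory are superequivalent if there are 1-morphisms between them, in
both directions, whose two composites are isomorphic to identities via even 2-isomorphisms. -/
def TwoSupercategory.Superequivalent (𝔄 : TwoSupercategory.{t, u, v, w} k) (a b : 𝔄.Obj) : Prop :=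
  ∃ (F : 𝔄.Hom a b) (G : 𝔄.Hom b a),
    (∃ e : 𝔄.comp G F ≅ 𝔄.one a, HasParity k 0 e.hom) ∧
    (∃ e : 𝔄.comp F G ≅ 𝔄.one b, HasParity k 0 e.hom)

/-- A 2-superfunctor is a 2-superequivalence if it induces superequivalences on all morphism
supercategories and every object of the target is superequivalent to one in its image. -/
def TwoSuperfunctor.IsTwoSuperequivalence {𝔄 : TwoSupercategory.{t, u₁, v₁, w₁} k}
    {𝔅 : TwoSupercategory.{t, u₂, v₂, w₂} k} (R : TwoSuperfunctor 𝔄 𝔅) : Prop :=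
  (∀ a b, IsSuperequivalence k (R.homFunctor a b)) ∧ ∀ b, ∃ a, 𝔅.Superequivalent (R.obj a) b

/-- A 2-supercategory is strict if its coherence isomorphisms are identities. -/
structure TwoSupercategory.IsStrict (𝔄 : TwoSupercategory.{t, u, v, w} k) : Prop where
  comp_assoc : ∀ {a b c d} (H : 𝔄.Hom c d) (G : 𝔄.Hom b c) (F : 𝔄.Hom a b),
    𝔄.comp (𝔄.comp H G) F = 𝔄.comp H (𝔄.comp G F)
  one_comp : ∀ {a b} (F : 𝔄.Hom a b), 𝔄.comp (𝔄.one b) F = F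
  comp_one : ∀ {a b} (F : 𝔄.Hom a b), 𝔄.comp F (𝔄.one a) = F
  assoc_eq : ∀ {a b c d} (H : 𝔄.Hom c d) (G : 𝔄.Hom b c) (F : 𝔄.Hom a b),
    (𝔄.assoc H G F).hom = eqToHom (comp_assoc H G F)
  lunit_eq : ∀ {a b} (F : 𝔄.Hom a b), (𝔄.lunit F).hom = eqToHom (one_comp F)
  runit_eq : ∀ {a b} (F : 𝔄.Hom a b), (𝔄.runit F).hom = eqToHom (comp_one F)

theorem TwoNatTrans.eq_of_iso {𝔄 : TwoSupercategory.{t, u₁, v₁, w₁} k}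
    {𝔅 : TwoSupercategory.{t, u₂, v₂, w₂} k} {R S : TwoSuperfunctor 𝔄 𝔅} {X Y : TwoNatTrans R S}
    (α : X ⟶ Y) (h : ∀ a, X.X a = Y.X a) (hα : ∀ a, app α a = eqToHom (h a)) : X = Y := by
  have hx : ∀ {a b : 𝔄.Obj} (F : 𝔄.Hom a b), X.x F ≫ 𝔅.hcomp (𝟙 (S.map₁ F)) (eqToHom (h a)) =
      𝔅.hcomp (eqToHom (h b)) (𝟙 (R.map₁ F)) ≫ Y.x F := by
    intro a b F
    rw [← hα, ← hα]; exact app_nat α F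
  clear hα α
  obtain ⟨X, x, _, _, _, _⟩ := X
  obtain ⟨Y, y, _, _, _, _⟩ := Y
  obtain rfl : X = Y := funext h
  have e : @x = @y := by
    funext a b F
    simpa [𝔅.hcomp_id] using hx F
  subst e
  rfl

/-- The type of 2-superfunctors from `𝔄` to a strict 2-supercategory `𝔅`, as the type of objects of
the category `Hom(𝔄, 𝔅)`. -/
structure StrictHom (𝔄 : TwoSupercategory.{t, u₁, v₁, w₁} k)
    (𝔅 : TwoSupercategory.{t, u₂, v₂, w₂} k) (h : 𝔅.IsStrict) where
  of : TwoSuperfunctor 𝔄 𝔅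

/-- The category `Hom(𝔄, 𝔅)` of 2-superfunctors and 2-natural transformations, for a strict
2-supercategory `𝔅`. -/
instance StrictHom.category (𝔄 : TwoSupercategory.{t, u₁, v₁, w₁} k)
    (𝔅 : TwoSupercategory.{t, u₂, v₂, w₂} k) (h : 𝔅.IsStrict) : Category (StrictHom 𝔄 𝔅 h) where
  Hom R S := TwoNatTrans R.of S.of
  id R := TwoNatTrans.id R.of
  comp X Y := Y.comp X
  id_comp {R S} X := TwoNatTrans.eq_of_iso
    (Iso.hom (C := TwoNatTrans R.of S.of) ((HomTwo 𝔄 𝔅).runit X))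
    (fun a => h.comp_one (X.X a)) (fun a => h.runit_eq (X.X a))
  comp_id {R S} X := TwoNatTrans.eq_of_iso
    (Iso.hom (C := TwoNatTrans R.of S.of) ((HomTwo 𝔄 𝔅).lunit X))
    (fun a => h.one_comp (X.X a)) (fun a => h.lunit_eq (X.X a))
  assoc {R S T U} X Y Z := (TwoNatTrans.eq_of_iso
    (Iso.hom (C := TwoNatTrans R.of U.of) ((HomTwo 𝔄 𝔅).assoc Z Y X))
    (fun a => h.comp_assoc (Z.X a) (Y.X a) (X.X a)) (fun a => h.assoc_eq _ _ _)).symm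

theorem TwoNatTrans.tilde_comp {𝔄 : TwoSupercategory.{t, u₁, v₁, w₁} k}
    {𝔅 : PiTwoSupercategory.{t, u₂, v₂, w₂} k} {R S T : TwoSuperfunctor 𝔄 𝔅.toTwoSupercategory}
    (Y : TwoNatTrans S T) (X : TwoNatTrans R S) : Y.tilde.comp X.tilde = (Y.comp X).tilde :=
  TwoNatTrans.eq_of_iso ((tildeTwo 𝔄 𝔅).c Y X).hom (fun _ => rfl) (fun _ => rfl)

theorem TwoNatTrans.tilde_id {𝔄 : TwoSupercategory.{t, u₁, v₁, w₁} k}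
    {𝔅 : PiTwoSupercategory.{t, u₂, v₂, w₂} k} (R : TwoSuperfunctor 𝔄 𝔅.toTwoSupercategory) :
    TwoNatTrans.id R.tilde = (TwoNatTrans.id R).tilde :=
  TwoNatTrans.eq_of_iso ((tildeTwo 𝔄 𝔅).i R).hom (fun _ => rfl) (fun _ => rfl)

/-- The functor `Hom(𝔄, 𝔅) ⥤ Hom(𝔄_π, 𝔅)`, `R ↦ R̃`, `X ↦ X̃`, for a strict `Π`-2-supercategory
`𝔅`. -/
noncomputable def tildeFunctor (𝔄 : TwoSupercategory.{t, u₁, v₁, w₁} k)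
    (𝔅 : PiTwoSupercategory.{t, u₂, v₂, w₂} k) (h : 𝔅.toTwoSupercategory.IsStrict) :
    StrictHom 𝔄 𝔅.toTwoSupercategory h ⥤ StrictHom 𝔄.env 𝔅.toTwoSupercategory h where
  obj R := ⟨R.of.tilde⟩
  map X := TwoNatTrans.tilde X
  map_id R := (TwoNatTrans.tilde_id R.of).symm
  map_comp X Y := (TwoNatTrans.tilde_comp Y X).symm

end Equivalence
section Comparison

open TwoSupercategory

variable {k : Type t} [CommRing k] {𝔄 : TwoSupercategory.{t, u₁, v₁, w₁} k}
  {𝔅 : PiTwoSupercategory.{t, u₂, v₂, w₂} k} {ℭ : PiTwoSupercategory.{t, u₃, v₃, w₃} k}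

/-- The even 2-isomorphism `Q(ζ^p R F)⁻¹ ∘ ζ^p (Q R F) : π^p (Q R F) ≅ Q (π^p R F)`. -/
def comparisonIso (Q : TwoSuperfunctor 𝔅.toTwoSupercategory ℭ.toTwoSupercategory) (p : ZMod 2)
    {a b : 𝔅.Obj} (F : 𝔅.toTwoSupercategory.Hom a b) : ℭ.pw p (Q.map₁ F) ≅ Q.map₁ (𝔅.pw p F) :=
  ℭ.zpow p (Q.map₁ F) ≪≫ (Q.mapIso (𝔅.zpow p F)).symm

/-- The component at `Π^p F` of the comparison between `(Q R)~` and `Q R̃`. -/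
def comparisonX (Q : TwoSuperfunctor 𝔅.toTwoSupercategory ℭ.toTwoSupercategory) (p : ZMod 2)
    {a b : 𝔅.Obj} (F : 𝔅.toTwoSupercategory.Hom a b) :
    ℭ.toTwoSupercategory.comp (ℭ.one (Q.obj b)) (ℭ.pw p (Q.map₁ F)) ⟶
      ℭ.toTwoSupercategory.comp (Q.map₁ (𝔅.pw p F)) (ℭ.one (Q.obj a)) :=
  (ℭ.lunit (ℭ.pw p (Q.map₁ F))).hom ≫ (comparisonIso Q p F).hom ≫
    (ℭ.runit (Q.map₁ (𝔅.pw p F))).inv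

theorem comparisonX_mem (Q : TwoSuperfunctor 𝔅.toTwoSupercategory ℭ.toTwoSupercategory)
    (p : ZMod 2) {a b : 𝔅.Obj} (F : 𝔅.toTwoSupercategory.Hom a b) :
    HasParity k 0 (comparisonX Q p F) :=
  ((ℭ.lunit_mem (ℭ.pw p (Q.map₁ F))).comp (((ℭ.zpow_mem p (Q.map₁ F)).comp
    (Q.map₂_mem (HasParity.inv _ (𝔅.zpow_mem p F)))).comp
      (HasParity.inv _ (ℭ.runit_mem (Q.map₁ (𝔅.pw p F)))))).congr (by revert p; decide)

theorem comparisonX_naturality (Q : TwoSuperfunctor 𝔅.toTwoSupercategory ℭ.toTwoSupercategory)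
    (p q : ZMod 2) {a b : 𝔅.Obj} {F G : 𝔅.toTwoSupercategory.Hom a b} (f : F ⟶ G) :
    ℭ.hcomp (𝟙 (ℭ.one (Q.obj b)))
        ((ℭ.zpow p (Q.map₁ F)).hom ≫ Q.map₂ f ≫ (ℭ.zpow q (Q.map₁ G)).inv) ≫ comparisonX Q q G =
      comparisonX Q p F ≫ ℭ.hcomp
        (Q.map₂ ((𝔅.zpow p F).hom ≫ f ≫ (𝔅.zpow q G).inv)) (𝟙 (ℭ.one (Q.obj a))) := by
  have h1 : Q.map₂ (𝔅.zpow p F).inv ≫ Q.map₂ (𝔅.zpow p F).hom = 𝟙 _ := by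
    rw [← Q.map₂_comp, Iso.inv_hom_id, Q.map₂_id]
  simp only [comparisonX, comparisonIso]
  rw [reassoc_of% ℭ.lunit_naturality, ← cancel_mono (ℭ.runit _).hom]
  simp only [Category.assoc, ℭ.runit_naturality, Iso.inv_hom_id, Category.comp_id,
    Iso.inv_hom_id_assoc, Iso.trans_hom, Iso.symm_hom, TwoSuperfunctor.mapIso, Q.map₂_comp,
    reassoc_of% h1]

theorem comparisonX_zero (Q : TwoSuperfunctor 𝔅.toTwoSupercategory ℭ.toTwoSupercategory)
    {a b : 𝔅.Obj} (F : 𝔅.toTwoSupercategory.Hom a b) :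
    comparisonX Q 0 F = (ℭ.lunit (Q.map₁ F)).hom ≫ (ℭ.runit (Q.map₁ F)).inv := by
  change (ℭ.lunit (Q.map₁ F)).hom ≫ (𝟙 (Q.map₁ F) ≫ Q.map₂ (𝟙 F)) ≫ (ℭ.runit (Q.map₁ F)).inv = _
  rw [Q.map₂_id, Category.id_comp, Category.id_comp]

/-- The canonical 2-natural isomorphism `(Q R)~ ⇒ Q R̃`. Its 1-morphisms are identities, and its
component at `Π^p F` is, up to unit isomorphisms, `Q(ζ^p (R F))⁻¹ ∘ ζ^p (Q R F)`. -/
noncomputable def comparison (Q : TwoSuperfunctor 𝔅.toTwoSupercategory ℭ.toTwoSupercategory)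
    (R : TwoSuperfunctor 𝔄 𝔅.toTwoSupercategory) :
    TwoNatTrans (TwoSuperfunctor.tilde (Q.comp R)) (Q.comp R.tilde) where
  X := fun a : 𝔄.Obj => ℭ.one (Q.obj (R.obj a))
  x {a b : 𝔄.Obj} (F : Env (𝔄.Hom a b)) := comparisonX Q F.deg (R.map₁ F.base)
  x_mem {a b : 𝔄.Obj} (F : Env (𝔄.Hom a b)) := comparisonX_mem Q _ _
  x_naturality {a b : 𝔄.Obj} {F G : Env (𝔄.Hom a b)} f :=
    comparisonX_naturality Q _ _ (R.map₂ (Env.un f))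
  x_comp {a b d : 𝔄.Obj} (G : Env (𝔄.Hom b d)) (F : Env (𝔄.Hom a b)) := by
    refine TwoNatTrans.x_comp_of_iso (R := TwoSuperfunctor.tilde (Q.comp R)) (S := Q.comp R.tilde)
      (fun a : 𝔄.Obj => ℭ.one (Q.obj (R.obj a)))
      (fun {a b : 𝔄.Obj} (F : Env (𝔄.Hom a b)) => comparisonX Q F.deg (R.map₁ F.base))
      (fun {a b : 𝔄.Obj} (F : Env (𝔄.Hom a b)) => comparisonX_mem Q _ _)
      (fun {a b : 𝔄.Obj} {F G : Env (𝔄.Hom a b)} f =>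
        comparisonX_naturality Q _ _ (R.map₂ (Env.un f)))
      (Env.toZero G) (Env.toZero F) ?_
    have h0 : (TwoSuperfunctor.tildeC (Q.comp R) 0 0 G.base F.base).hom =
        (Q.c (R.map₁ G.base) (R.map₁ F.base)).hom ≫ Q.map₂ (R.c G.base F.base).hom :=
      TwoSuperfunctor.tildeC_zero (Q.comp R) G.base F.base
    have h : ℭ.hcomp (𝟙 (ℭ.one (Q.obj (R.obj d)))) ((Q.c (R.map₁ G.base) (R.map₁ F.base)).hom ≫
          Q.map₂ (R.c G.base F.base).hom) ≫
        (ℭ.lunit (Q.map₁ (R.map₁ (𝔄.comp G.base F.base)))).hom ≫ (ℭ.runit _).inv =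
      (ℭ.assoc _ _ _).inv ≫ ℭ.hcomp ((ℭ.lunit (Q.map₁ (R.map₁ G.base))).hom ≫ (ℭ.runit _).inv)
        (𝟙 (Q.map₁ (R.map₁ F.base))) ≫ (ℭ.assoc _ _ _).hom ≫
        ℭ.hcomp (𝟙 (Q.map₁ (R.map₁ G.base)))
          ((ℭ.lunit (Q.map₁ (R.map₁ F.base))).hom ≫ (ℭ.runit _).inv) ≫
        (ℭ.assoc _ _ _).inv ≫ ℭ.hcomp ((Q.c (R.map₁ G.base) (R.map₁ F.base)).hom ≫
          Q.map₂ (R.c G.base F.base).hom) (𝟙 (ℭ.one (Q.obj (R.obj a)))) :=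
      (TwoNatTrans.id (Q.comp R)).x_comp G.base F.base
    rw [← comparisonX_zero, ← comparisonX_zero, ← comparisonX_zero] at h
    refine Eq.trans ?_ (h.trans ?_)
    · exact congrArg (fun z => ℭ.hcomp (𝟙 (ℭ.one (Q.obj (R.obj d)))) z ≫
        comparisonX Q 0 (R.map₁ (𝔄.comp G.base F.base))) h0
    · rw [← R.tildeC_zero]
      rfl
  x_unit := fun a : 𝔄.Obj => by
    have h : (ℭ.lunit (ℭ.one (Q.obj (R.obj a)))).hom ≫ (ℭ.runit (ℭ.one (Q.obj (R.obj a)))).inv ≫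
        ℭ.hcomp (𝟙 (ℭ.one (Q.obj (R.obj a)))) ((Q.i (R.obj a)).hom ≫ Q.map₂ (R.i a).hom) ≫
        (ℭ.lunit (Q.map₁ (R.map₁ (𝔄.one a)))).hom ≫ (ℭ.runit _).inv =
        ℭ.hcomp ((Q.i (R.obj a)).hom ≫ Q.map₂ (R.i a).hom) (𝟙 (ℭ.one (Q.obj (R.obj a)))) :=
      (TwoNatTrans.id (Q.comp R)).x_unit a
    rw [← comparisonX_zero] at h
    exact h

end Comparison

end TwoSuper

open TwoSuper

/-!
In the `Π`-envelope every 1-morphism `Π^p F` is isomorphic to `Π^0 F = 𝕁 F`, by the 2-isomorphism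
`(1_F)_p^0` of parity `p` (`Env.toZero`). Everything follows from this.

A 2-natural transformation out of `𝔄_π` is natural with respect to `(1_F)_p^0`, hence determined by
its components at the `Π^0 F` (`TwoNatTrans.ext_env`). Since `R̃ 𝕁 = R`, restriction along `𝕁` turns
2-natural transformations `R̃ ⇒ S̃` into 2-natural transformations `R ⇒ S`, and it is inverse to
`X ↦ X̃` (`TwoNatTrans.restrict_tilde`, `TwoNatTrans.tilde_restrict`). Both operations are the
identity on components of supermodifications, so they give a superequivalence on morphism
supercategories.

For a 2-superfunctor `T : 𝔄_π → 𝔅`, the even 2-isomorphisms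
`T((1_F)_0^p) ∘ ζ^p : π^p (T Π^0 F) ≅ T Π^p F` are natural and compatible with the coherence maps,
the sign in those of `(T 𝕁)~` being the sign of the interchange law
(`TwoSuperfunctor.conj_comp`). Up to unit isomorphisms they are the components of a 2-natural
transformation `canonical T : (T 𝕁)~ ⇒ T` whose 1-morphisms are identities, and their inverses are
those of a transformation in the other direction. The two composites differ from identities by unit
isomorphisms only, which are identities if `𝔅` is strict. This is essential surjectivity, both for
2-superequivalence and for equivalence of categories.

The comparison `(Q R)~ ⇒ Q R̃` is `canonical T` for `T = Q R̃` (`comparison_heq`), which makes it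
invertible up to even isomorphism. Its naturality in `R` and `Q` is an instance of a general fact
about transformations whose 1-morphisms are identities (`iconX_mod`). The remaining strict equalities
are checked on components, where in most cases both sides agree by definition.
-/

namespace TwoSuper

open TwoSupercategory

/-! ### Extensionality -/

section Extensionality

variable {k : Type t} [CommRing k] {𝔄 : TwoSupercategory.{t, u₁, v₁, w₁} k}
  {𝔅 : TwoSupercategory.{t, u₂, v₂, w₂} k}

/-- The heterogeneous equalities make this applicable when the objects and 1-morphisms agree only by
unfolding definitions, so that no transport along equalities of types is needed. -/
theorem TwoSuperfunctor.ext_heq {R S : TwoSuperfunctor 𝔄 𝔅} (ho : R.obj = S.obj)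
    (h₁ : HEq (@R.map₁) (@S.map₁)) (h₂ : HEq (@R.map₂) (@S.map₂)) (hc : HEq (@R.c) (@S.c))
    (hi : HEq R.i S.i) : R = S := by
  cases R
  cases S
  dsimp only at ho h₁ h₂ hc hi
  subst ho
  subst h₁
  subst h₂
  subst hc
  subst hi
  rfl

theorem TwoNatTrans.ext_heq {R S R' S' : TwoSuperfunctor 𝔄 𝔅} {X : TwoNatTrans R S}
    {Y : TwoNatTrans R' S'} (hR : R = R') (hS : S = S') (hX : HEq X.X Y.X)
    (hx : HEq (@X.x) (@Y.x)) : HEq X Y := by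
  subst hR
  subst hS
  cases X
  cases Y
  dsimp only at hX hx
  subst hX
  subst hx
  rfl

theorem TwoNatTrans.ext_of_eq {R S : TwoSuperfunctor 𝔄 𝔅} {X Y : TwoNatTrans R S}
    (hX : X.X = Y.X) (hx : HEq (@X.x) (@Y.x)) : X = Y :=
  eq_of_heq (TwoNatTrans.ext_heq rfl rfl (heq_of_eq hX) hx)

/-- By naturality, a component of a 2-natural transformation is determined by the component at any
isomorphic 1-morphism. -/
theorem TwoNatTrans.x_eq_of_iso {R S : TwoSuperfunctor 𝔄 𝔅} (X : TwoNatTrans R S) {a b : 𝔄.Obj}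
    {F G : 𝔄.Hom a b} (e : F ≅ G) :
    X.x F = 𝔅.hcomp (𝟙 (X.X b)) (R.map₂ e.hom) ≫ X.x G ≫
      𝔅.hcomp (S.map₂ e.inv) (𝟙 (X.X a)) := by
  rw [reassoc_of% X.x_naturality, ← whiskerR_comp, ← S.map₂_comp, e.hom_inv_id, S.map₂_id,
    𝔅.hcomp_id, Category.comp_id]

/-- Every `Π^p F` is isomorphic to `Π^0 F`, so 2-natural transformations on a `Π`-envelope are
determined by their components in degree `0`. -/
theorem TwoNatTrans.ext_env {R S : TwoSuperfunctor 𝔄.env 𝔅} {X Y : TwoNatTrans R S}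
    (hX : ∀ a, X.X a = Y.X a) (hx : ∀ {a b : 𝔄.Obj} (F : 𝔄.Hom a b),
      HEq (X.x ((inclusion 𝔄).map₁ F)) (Y.x ((inclusion 𝔄).map₁ F))) : X = Y := by
  have hX' : X.X = Y.X := funext hX
  have hF : ∀ {a b : 𝔄.env.Obj} (F : 𝔄.env.Hom a b), HEq (X.x F) (Y.x F) := by
    intro (a : 𝔄.Obj) (b : 𝔄.Obj) (F : Env (𝔄.Hom a b))
    rw [X.x_eq_of_iso (Env.toZero F), Y.x_eq_of_iso (Env.toZero F)]
    have h := hx F.base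
    change HEq (X.x (⟨0, F.base⟩ : Env (𝔄.Hom a b))) (Y.x (⟨0, F.base⟩ : Env (𝔄.Hom a b))) at h
    -- The types of the two components differ in the 1-morphisms of `X` and `Y`, which can be
    -- identified once the components are variables.
    revert h
    generalize X.x (⟨0, F.base⟩ : Env (𝔄.Hom a b)) = f
    generalize Y.x (⟨0, F.base⟩ : Env (𝔄.Hom a b)) = g
    revert f g
    rw [hX']
    intro f g h
    rw [eq_of_heq h]
  refine TwoNatTrans.ext_of_eq hX' ?_
  refine Function.hfunext rfl fun a a' ha => ?_
  subst ha
  refine Function.hfunext rfl fun b b' hb => ?_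
  subst hb
  refine Function.hfunext rfl fun F F' hF' => ?_
  cases hF'
  exact hF F

end Extensionality

/-! ### Extension and restriction along `𝕁` -/

section Restriction

variable {k : Type t} [CommRing k] {𝔄 : TwoSupercategory.{t, u₁, v₁, w₁} k}
  {𝔅 : PiTwoSupercategory.{t, u₂, v₂, w₂} k}

theorem TwoSuperfunctor.tilde_map₂_inclusion (R : TwoSuperfunctor 𝔄 𝔅.toTwoSupercategory)
    {a b : 𝔄.Obj} {F G : 𝔄.Hom a b} (x : F ⟶ G) :
    (R.tilde.comp (inclusion 𝔄)).map₂ x = R.map₂ x := by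
  change 𝟙 (R.map₁ F) ≫ R.map₂ x ≫ 𝟙 (R.map₁ G) = R.map₂ x
  rw [Category.id_comp, Category.comp_id]

theorem TwoSuperfunctor.tilde_c_inclusion (R : TwoSuperfunctor 𝔄 𝔅.toTwoSupercategory)
    {a b d : 𝔄.Obj} (G : 𝔄.Hom b d) (F : 𝔄.Hom a b) :
    ((R.tilde.comp (inclusion 𝔄)).c G F).hom = (R.c G F).hom := by
  change (R.tildeC 0 0 G F).hom ≫ 𝟙 (R.map₁ (𝔄.comp G F)) ≫ R.map₂ (𝟙 (𝔄.comp G F)) ≫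
    𝟙 (R.map₁ (𝔄.comp G F)) = (R.c G F).hom
  refine (congrArg (· ≫ 𝟙 (R.map₁ (𝔄.comp G F)) ≫ R.map₂ (𝟙 (𝔄.comp G F)) ≫
    𝟙 (R.map₁ (𝔄.comp G F))) (R.tildeC_zero G F)).trans ?_
  simp only [R.map₂_id, Category.comp_id]
  exact Category.comp_id _

theorem TwoSuperfunctor.tilde_i_inclusion (R : TwoSuperfunctor 𝔄 𝔅.toTwoSupercategory)
    (a : 𝔄.Obj) : ((R.tilde.comp (inclusion 𝔄)).i a).hom = (R.i a).hom := by
  change (R.i a).hom ≫ 𝟙 (R.map₁ (𝔄.one a)) ≫ R.map₂ (𝟙 (𝔄.one a)) ≫ 𝟙 (R.map₁ (𝔄.one a)) =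
    (R.i a).hom
  rw [R.map₂_id, Category.id_comp, Category.id_comp, Category.comp_id]

theorem TwoSuperfunctor.tilde_comp_inclusion (R : TwoSuperfunctor 𝔄 𝔅.toTwoSupercategory) :
    R.tilde.comp (inclusion 𝔄) = R := by
  refine TwoSuperfunctor.ext_heq rfl HEq.rfl (heq_of_eq ?_) (heq_of_eq ?_) (heq_of_eq ?_)
  · funext a b F G x
    exact R.tilde_map₂_inclusion x
  · funext a b d G F
    exact Iso.ext (R.tilde_c_inclusion G F)
  · funext a
    exact Iso.ext (R.tilde_i_inclusion a)

/-- The restriction of a 2-natural transformation `R̃ ⇒ S̃` to the 1-morphisms `Π^0 F`, as a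
2-natural transformation `R ⇒ S`. -/
noncomputable def TwoNatTrans.restrict {R S : TwoSuperfunctor 𝔄 𝔅.toTwoSupercategory}
    (Y : TwoNatTrans R.tilde S.tilde) : TwoNatTrans R S where
  X := fun a : 𝔄.Obj => Y.X a
  x {a b} F := (Y.precomp (inclusion 𝔄)).x F
  x_mem F := (Y.precomp (inclusion 𝔄)).x_mem F
  x_naturality {a b F G} f := by
    have h := (Y.precomp (inclusion 𝔄)).x_naturality f
    rw [R.tilde_map₂_inclusion, S.tilde_map₂_inclusion] at h
    exact h
  x_comp G F := by
    have h := (Y.precomp (inclusion 𝔄)).x_comp G F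
    rw [R.tilde_c_inclusion, S.tilde_c_inclusion] at h
    exact h
  x_unit a := by
    have h := (Y.precomp (inclusion 𝔄)).x_unit a
    rw [R.tilde_i_inclusion, S.tilde_i_inclusion] at h
    exact h

theorem TwoNatTrans.restrict_tilde {R S : TwoSuperfunctor 𝔄 𝔅.toTwoSupercategory}
    (X : TwoNatTrans R S) : X.tilde.restrict = X := by
  refine TwoNatTrans.ext_of_eq rfl (heq_of_eq ?_)
  funext a b F
  exact X.tildeX_zero F

theorem TwoNatTrans.tilde_x_inclusion {R S : TwoSuperfunctor 𝔄 𝔅.toTwoSupercategory}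
    (X : TwoNatTrans R S) {a b : 𝔄.Obj} (F : 𝔄.Hom a b) :
    HEq (X.tilde.x ((inclusion 𝔄).map₁ F)) (X.x F) :=
  heq_of_eq (X.tildeX_zero F)

theorem TwoNatTrans.eq_tilde_iff {R S : TwoSuperfunctor 𝔄 𝔅.toTwoSupercategory}
    (X : TwoNatTrans R S) (Y : TwoNatTrans R.tilde S.tilde) : Y = X.tilde ↔
      (∀ a, Y.X a = X.X a) ∧
        ∀ {a b : 𝔄.Obj} (F : 𝔄.Hom a b), HEq (Y.x ((inclusion 𝔄).map₁ F)) (X.x F) := by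
  constructor
  · rintro rfl
    exact ⟨fun a => rfl, fun F => X.tilde_x_inclusion F⟩
  · rintro ⟨hX, hx⟩
    exact TwoNatTrans.ext_env hX fun F => (hx F).trans (X.tilde_x_inclusion F).symm

theorem TwoNatTrans.tilde_restrict {R S : TwoSuperfunctor 𝔄 𝔅.toTwoSupercategory}
    (Y : TwoNatTrans R.tilde S.tilde) : Y.restrict.tilde = Y :=
  ((TwoNatTrans.eq_tilde_iff _ _).2 ⟨fun _ => rfl, fun _ => HEq.rfl⟩).symm

theorem TwoNatTrans.tilde_bijective (R S : TwoSuperfunctor 𝔄 𝔅.toTwoSupercategory) :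
    Function.Bijective (TwoNatTrans.tilde : TwoNatTrans R S → TwoNatTrans R.tilde S.tilde) :=
  ⟨Function.LeftInverse.injective TwoNatTrans.restrict_tilde,
    Function.RightInverse.surjective TwoNatTrans.tilde_restrict⟩

theorem TwoNatTrans.restrict_mod {R S : TwoSuperfunctor 𝔄 𝔅.toTwoSupercategory}
    {X Y : TwoNatTrans R.tilde S.tilde} (α : X ⟶ Y) :
    (fun a : 𝔄.Obj => TwoNatTrans.app α a) ∈ superModification X.restrict Y.restrict :=
  fun {a b} F => TwoNatTrans.app_nat α ((inclusion 𝔄).map₁ F)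

/-- Restriction of 2-natural transformations along `𝕁` as a functor, the identity on components of
supermodifications. -/
noncomputable def restrictFunctor (R S : TwoSuperfunctor 𝔄 𝔅.toTwoSupercategory) :
    TwoNatTrans R.tilde S.tilde ⥤ TwoNatTrans R S where
  obj Y := Y.restrict
  map α := ⟨fun a : 𝔄.Obj => TwoNatTrans.app α a, TwoNatTrans.restrict_mod α⟩
  map_id _ := rfl
  map_comp _ _ := rfl

/-- An equality `X = Y` of 2-natural transformations, as a supermodification. When `X` and `Y` have
definitionally equal 1-morphisms, its components are definitionally identities. -/
theorem TwoNatTrans.id_mem_superModification {𝔅 : TwoSupercategory.{t, u₂, v₂, w₂} k}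
    {R S : TwoSuperfunctor 𝔄 𝔅} {X Y : TwoNatTrans R S} (h : X = Y) :
    (fun a => eqToHom (congrArg (fun Z : TwoNatTrans R S => Z.X a) h)) ∈
      superModification X Y := by
  subst h
  exact (𝟙 X : X ⟶ X).2

/-- The functor `X ↦ X̃`, the identity on components of supermodifications. -/
noncomputable def extendFunctor (R S : TwoSuperfunctor 𝔄 𝔅.toTwoSupercategory) :
    TwoNatTrans R S ⥤ TwoNatTrans R.tilde S.tilde :=
  (tildeTwo 𝔄 𝔅).homFunctor R S

/-- The restriction of `X̃` is `X`, as an even isomorphism of functors with identity components. -/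
noncomputable def extendRestrictIso (R S : TwoSuperfunctor 𝔄 𝔅.toTwoSupercategory) :
    extendFunctor R S ⋙ restrictFunctor R S ≅ 𝟭 (TwoNatTrans R S) :=
  NatIso.ofComponents (fun X => TwoNatTrans.mkIso (X := X.tilde.restrict) (Y := X)
    (fun a => Iso.refl (X.X a)) (TwoNatTrans.id_mem_superModification X.restrict_tilde))
    fun α => TwoNatTrans.hom_ext fun a => (Category.comp_id (TwoNatTrans.app α a)).trans
      (Category.id_comp _).symm

/-- The extension of the restriction of `Y` is `Y`, as an even isomorphism of functors with identity
components. -/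
noncomputable def restrictExtendIso (R S : TwoSuperfunctor 𝔄 𝔅.toTwoSupercategory) :
    restrictFunctor R S ⋙ extendFunctor R S ≅ 𝟭 (TwoNatTrans R.tilde S.tilde) :=
  NatIso.ofComponents (fun X => TwoNatTrans.mkIso (X := X.restrict.tilde) (Y := X)
    (fun a => Iso.refl (X.X a)) (TwoNatTrans.id_mem_superModification X.tilde_restrict))
    fun α => TwoNatTrans.hom_ext fun a => (Category.comp_id (TwoNatTrans.app α a)).trans
      (Category.id_comp _).symm

theorem extendFunctor_isSuperequivalence (R S : TwoSuperfunctor 𝔄 𝔅.toTwoSupercategory) :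
    IsSuperequivalence k (extendFunctor R S) :=
  ⟨⟨fun _ _ => rfl, fun _ _ => rfl, fun h => h⟩, restrictFunctor R S,
    ⟨fun _ _ => rfl, fun _ _ => rfl, fun h => h⟩,
    ⟨extendRestrictIso R S, fun X a => HasParity.id (X.X a)⟩,
    ⟨restrictExtendIso R S, fun X a => HasParity.id (X.X a)⟩⟩

end Restriction

/-! ### Transformations whose 1-morphisms are identities -/

section Icon

open Bicategory

variable {B : Type u} [Bicategory.{w, v} B]

/-- If the 2-morphisms `f` are compatible with composition, then so are, up to unit isomorphisms,
the components of the transformation with identity 1-morphisms that they define. The composition of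
`B` is the reverse of that of a 2-supercategory, so `ρ` and `λ` here are its left and right unit
isomorphisms. -/
theorem bicat_icon_comp {a b c : B} {rf sf : a ⟶ b} {rg sg : b ⟶ c} {rgf sgf : a ⟶ c}
    (cr : rf ≫ rg ⟶ rgf) (cs : sf ≫ sg ⟶ sgf) (f : rf ⟶ sf) (g : rg ⟶ sg) (gf : rgf ⟶ sgf)
    (h : cr ≫ gf = rf ◁ g ≫ f ▷ sg ≫ cs) :
    cr ▷ 𝟙 c ≫ (ρ_ rgf).hom ≫ gf ≫ (λ_ sgf).inv =
      (α_ _ _ _).hom ≫ rf ◁ ((ρ_ rg).hom ≫ g ≫ (λ_ sg).inv) ≫ (α_ _ _ _).inv ≫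
        ((ρ_ rf).hom ≫ f ≫ (λ_ sf).inv) ▷ sg ≫ (α_ _ _ _).hom ≫ 𝟙 a ◁ cs := by
  calc
    _ = 𝟙 _ ⊗≫ (cr ≫ gf) ⊗≫ 𝟙 _ := by bicategory
    _ = _ := by rw [h]; bicategory

theorem bicat_icon_unit {a : B} {rf sf : a ⟶ a} (ir : 𝟙 a ⟶ rf) (is : 𝟙 a ⟶ sf) (f : rf ⟶ sf)
    (h : ir ≫ f = is) :
    (ρ_ (𝟙 a)).hom ≫ (λ_ (𝟙 a)).inv ≫ ir ▷ 𝟙 a ≫ (ρ_ rf).hom ≫ f ≫ (λ_ sf).inv =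
      𝟙 a ◁ is := by
  subst h
  bicategory

theorem bicat_icon_icon {a b : B} {rf sf : a ⟶ b} (f : rf ⟶ sf) (g : sf ⟶ rf)
    (h : f ≫ g = 𝟙 rf) :
    ((α_ _ _ _).inv ≫ ((ρ_ rf).hom ≫ f ≫ (λ_ sf).inv) ▷ 𝟙 b ≫ (α_ _ _ _).hom ≫
        𝟙 a ◁ ((ρ_ sf).hom ≫ g ≫ (λ_ rf).inv) ≫ (α_ _ _ _).inv) ≫ (λ_ (𝟙 a)).hom ▷ rf =
      rf ◁ (λ_ (𝟙 b)).hom ≫ (ρ_ rf).hom ≫ (λ_ rf).inv := by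
  calc
    _ = 𝟙 _ ⊗≫ (f ≫ g) ⊗≫ 𝟙 _ := by bicategory
    _ = _ := by rw [h]; bicategory

/-- The unit isomorphisms form a modification between the two composites of a transformation with
one whose 1-morphisms are identities. -/
theorem bicat_icon_mod {a b a' b' : B} {rf sf : a ⟶ b} {rf' sf' : a' ⟶ b'} {Xa : a ⟶ a'}
    {Xb : b ⟶ b'} (f : rf ⟶ sf) (f' : rf' ⟶ sf') (x : rf ≫ Xb ⟶ Xa ≫ rf')
    (y : sf ≫ Xb ⟶ Xa ≫ sf') (h : f ▷ Xb ≫ y = x ≫ Xa ◁ f') :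
    ((α_ _ _ _).inv ≫ ((ρ_ rf).hom ≫ f ≫ (λ_ sf).inv) ▷ Xb ≫ (α_ _ _ _).hom ≫ 𝟙 a ◁ y ≫
        (α_ _ _ _).inv) ≫ ((λ_ Xa).hom ≫ (ρ_ Xa).inv) ▷ sf' =
      rf ◁ ((λ_ Xb).hom ≫ (ρ_ Xb).inv) ≫ ((α_ _ _ _).inv ≫ x ▷ 𝟙 b' ≫ (α_ _ _ _).hom ≫
        Xa ◁ ((ρ_ rf').hom ≫ f' ≫ (λ_ sf').inv) ≫ (α_ _ _ _).inv) := by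
  calc
    _ = 𝟙 _ ⊗≫ (f ▷ Xb ≫ y) ⊗≫ 𝟙 _ := by bicategory
    _ = _ := by rw [h]; bicategory

end Icon

namespace TwoSupercategory

variable {k : Type t} [CommRing k] {𝔅 : TwoSupercategory.{t, u, v, w} k}

/-- The 2-morphism `1 F ⟶ G 1` that is `f` up to unit isomorphisms: a component of a 2-natural
transformation whose 1-morphisms are identities. -/
def iconX {a b : 𝔅.Obj} {F G : 𝔅.Hom a b} (f : F ⟶ G) :
    𝔅.comp (𝔅.one b) F ⟶ 𝔅.comp G (𝔅.one a) :=
  (𝔅.lunit F).hom ≫ f ≫ (𝔅.runit G).inv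

variable {a b c : 𝔅.Obj}

theorem iconX_mem {F G : 𝔅.Hom a b} {f : F ⟶ G} (hf : HasParity k 0 f) :
    HasParity k 0 (iconX f) :=
  (𝔅.lunit_mem F).comp_even (hf.comp_even (HasParity.inv _ (𝔅.runit_mem G)))

theorem iconX_naturality {F G F' G' : 𝔅.Hom a b} {f : F ⟶ G} {f' : F' ⟶ G'} {r : F ⟶ F'}
    {s : G ⟶ G'} (h : r ≫ f' = f ≫ s) :
    𝔅.hcomp (𝟙 (𝔅.one b)) r ≫ iconX f' = iconX f ≫ 𝔅.hcomp s (𝟙 (𝔅.one a)) := by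
  simp only [iconX]
  rw [reassoc_of% 𝔅.lunit_naturality, ← cancel_mono (𝔅.runit _).hom]
  simp only [Category.assoc, 𝔅.runit_naturality, Iso.inv_hom_id, Category.comp_id,
    Iso.inv_hom_id_assoc, h]

theorem iconX_comp {F F' : 𝔅.Hom a b} {G G' : 𝔅.Hom b c} {H H' : 𝔅.Hom a c}
    {r : 𝔅.comp G F ⟶ H} {s : 𝔅.comp G' F' ⟶ H'} {f : F ⟶ F'} {g : G ⟶ G'} {h : H ⟶ H'}
    (hr : HasParity k 0 r) (hs : HasParity k 0 s) (hf : HasParity k 0 f) (hg : HasParity k 0 g)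
    (hh : HasParity k 0 h) (e : r ≫ h = 𝔅.hcomp g f ≫ s) :
    𝔅.hcomp (𝟙 (𝔅.one c)) r ≫ iconX h = (𝔅.assoc _ _ _).inv ≫ 𝔅.hcomp (iconX g) (𝟙 F) ≫
      (𝔅.assoc _ _ _).hom ≫ 𝔅.hcomp (𝟙 G') (iconX f) ≫ (𝔅.assoc _ _ _).inv ≫
        𝔅.hcomp s (𝟙 (𝔅.one a)) := by
  refine congrArg Subtype.val (bicat_icon_comp (B := Ev 𝔅) (rf := TwoNatTrans.ev₁ F)
    (sf := TwoNatTrans.ev₁ F') (rg := TwoNatTrans.ev₁ G) (sg := TwoNatTrans.ev₁ G')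
    (TwoNatTrans.ev₂ r hr) (TwoNatTrans.ev₂ s hs)
    (TwoNatTrans.ev₂ f hf) (TwoNatTrans.ev₂ g hg) (TwoNatTrans.ev₂ h hh) (Subtype.ext ?_))
  change r ≫ h = 𝔅.hcomp g (𝟙 F) ≫ 𝔅.hcomp (𝟙 G') f ≫ s
  rw [e, hcomp_eq, whisker_exchange_even _ _ hg, Category.assoc]

theorem iconX_unit {F G : 𝔅.Hom a a} {r : 𝔅.one a ⟶ F} {s : 𝔅.one a ⟶ G} {f : F ⟶ G}
    (hr : HasParity k 0 r) (hs : HasParity k 0 s) (hf : HasParity k 0 f) (e : r ≫ f = s) :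
    (𝔅.lunit (𝔅.one a)).hom ≫ (𝔅.runit (𝔅.one a)).inv ≫ 𝔅.hcomp (𝟙 (𝔅.one a)) r ≫ iconX f =
      𝔅.hcomp s (𝟙 (𝔅.one a)) :=
  congrArg Subtype.val (bicat_icon_unit (B := Ev 𝔅) (rf := TwoNatTrans.ev₁ F)
    (sf := TwoNatTrans.ev₁ G) (TwoNatTrans.ev₂ r hr) (TwoNatTrans.ev₂ s hs)
    (TwoNatTrans.ev₂ f hf) (Subtype.ext e))

theorem iconX_iconX {F G : 𝔅.Hom a b} {f : F ⟶ G} {g : G ⟶ F} (hf : HasParity k 0 f)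
    (hg : HasParity k 0 g) (e : f ≫ g = 𝟙 F) :
    ((𝔅.assoc _ _ _).hom ≫ 𝔅.hcomp (𝟙 (𝔅.one b)) (iconX f) ≫ (𝔅.assoc _ _ _).inv ≫
        𝔅.hcomp (iconX g) (𝟙 (𝔅.one a)) ≫ (𝔅.assoc _ _ _).hom) ≫
        𝔅.hcomp (𝟙 F) (𝔅.runit (𝔅.one a)).hom =
      𝔅.hcomp (𝔅.runit (𝔅.one b)).hom (𝟙 F) ≫ (𝔅.lunit F).hom ≫ (𝔅.runit F).inv :=
  congrArg Subtype.val (bicat_icon_icon (B := Ev 𝔅) (rf := TwoNatTrans.ev₁ F)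
    (sf := TwoNatTrans.ev₁ G) (TwoNatTrans.ev₂ f hf) (TwoNatTrans.ev₂ g hg) (Subtype.ext e))

theorem iconX_mod {a' b' : 𝔅.Obj} {F G : 𝔅.Hom a b} {F' G' : 𝔅.Hom a' b'} {Xa : 𝔅.Hom a a'}
    {Xb : 𝔅.Hom b b'} {f : F ⟶ G} {f' : F' ⟶ G'} {x : 𝔅.comp Xb F ⟶ 𝔅.comp F' Xa}
    {y : 𝔅.comp Xb G ⟶ 𝔅.comp G' Xa} (hf : HasParity k 0 f) (hf' : HasParity k 0 f')
    (hx : HasParity k 0 x) (hy : HasParity k 0 y)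
    (e : 𝔅.hcomp (𝟙 Xb) f ≫ y = x ≫ 𝔅.hcomp f' (𝟙 Xa)) :
    ((𝔅.assoc _ _ _).hom ≫ 𝔅.hcomp (𝟙 Xb) (iconX f) ≫ (𝔅.assoc _ _ _).inv ≫
        𝔅.hcomp y (𝟙 (𝔅.one a)) ≫ (𝔅.assoc _ _ _).hom) ≫
        𝔅.hcomp (𝟙 G') ((𝔅.runit Xa).hom ≫ (𝔅.lunit Xa).inv) =
      𝔅.hcomp ((𝔅.runit Xb).hom ≫ (𝔅.lunit Xb).inv) (𝟙 F) ≫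
        (𝔅.assoc _ _ _).hom ≫ 𝔅.hcomp (𝟙 (𝔅.one b')) x ≫ (𝔅.assoc _ _ _).inv ≫
        𝔅.hcomp (iconX f') (𝟙 Xa) ≫ (𝔅.assoc _ _ _).hom :=
  congrArg Subtype.val (bicat_icon_mod (B := Ev 𝔅) (rf := TwoNatTrans.ev₁ F)
    (sf := TwoNatTrans.ev₁ G) (rf' := TwoNatTrans.ev₁ F') (sf' := TwoNatTrans.ev₁ G')
    (Xa := TwoNatTrans.ev₁ Xa) (Xb := TwoNatTrans.ev₁ Xb)
    (TwoNatTrans.ev₂ f hf) (TwoNatTrans.ev₂ f' hf') (TwoNatTrans.ev₂ x hx)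
    (TwoNatTrans.ev₂ y hy) (Subtype.ext e))

end TwoSupercategory

/-! ### Strict functoriality of the envelope -/

section Envelope

variable {k : Type t} [CommRing k] {𝔄 : TwoSupercategory.{t, u₁, v₁, w₁} k}
  {𝔅 : TwoSupercategory.{t, u₂, v₂, w₂} k} {ℭ : TwoSupercategory.{t, u₃, v₃, w₃} k}

theorem TwoSuperfunctor.env_id :
    (TwoSuperfunctor.id 𝔄).env = TwoSuperfunctor.id 𝔄.env :=
  TwoSuperfunctor.ext_heq rfl HEq.rfl HEq.rfl HEq.rfl HEq.rfl

theorem TwoSuperfunctor.env_comp (Q : TwoSuperfunctor 𝔅 ℭ) (P : TwoSuperfunctor 𝔄 𝔅) :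
    (Q.comp P).env = Q.env.comp P.env :=
  TwoSuperfunctor.ext_heq rfl HEq.rfl HEq.rfl HEq.rfl HEq.rfl

theorem TwoNatTrans.env_id (P : TwoSuperfunctor 𝔄 𝔅) :
    (TwoNatTrans.id P).env = TwoNatTrans.id P.env :=
  TwoNatTrans.ext_of_eq rfl HEq.rfl

theorem TwoNatTrans.env_comp {P P' P'' : TwoSuperfunctor 𝔄 𝔅} (Y : TwoNatTrans P' P'')
    (X : TwoNatTrans P P') : (Y.comp X).env = Y.env.comp X.env := by
  refine TwoNatTrans.ext_of_eq rfl (heq_of_eq ?_)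
  funext (a : 𝔄.Obj) (b : 𝔄.Obj) (F : Env (𝔄.Hom a b))
  have e1 := envHcomp_ev (𝔄 := 𝔅) 0 0 (F.deg + 0) (0 + F.deg) (𝟙 (Y.X b)) (X.x F.base)
    (HasParity.id _) (X.x_mem _) (by simp)
  have e2 := envHcomp_ev (𝔄 := 𝔅) (F.deg + 0) (0 + F.deg) 0 0 (Y.x F.base) (𝟙 (X.X a))
    (Y.x_mem _) (HasParity.id _) rfl
  change (𝔅.assoc (Y.X b) (X.X b) (P.map₁ F.base)).hom ≫ 𝔅.hcomp (𝟙 (Y.X b)) (X.x F.base) ≫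
    (𝔅.assoc (Y.X b) (P'.map₁ F.base) (X.X a)).inv ≫ 𝔅.hcomp (Y.x F.base) (𝟙 (X.X a)) ≫
    (𝔅.assoc (P''.map₁ F.base) (Y.X a) (X.X a)).hom = _
  rw [← e1, ← e2]
  rfl

theorem TwoNatTrans.env_postcomp (Q : TwoSuperfunctor 𝔅 ℭ) {P P' : TwoSuperfunctor 𝔄 𝔅}
    (X : TwoNatTrans P P') :
    (TwoNatTrans.postcomp Q X).env = TwoNatTrans.postcomp Q.env X.env :=
  TwoNatTrans.ext_of_eq rfl HEq.rfl

theorem TwoNatTrans.env_precomp {Q Q' : TwoSuperfunctor 𝔅 ℭ} (Y : TwoNatTrans Q Q')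
    (P : TwoSuperfunctor 𝔄 𝔅) : (Y.precomp P).env = Y.env.precomp P.env :=
  TwoNatTrans.ext_of_eq rfl HEq.rfl

end Envelope

/-! ### Naturality in the source -/

section Source

variable {k : Type t} [CommRing k] {𝔄₁ : TwoSupercategory.{t, u₃, v₃, w₃} k}
  {𝔄 : TwoSupercategory.{t, u₁, v₁, w₁} k} {𝔅 : PiTwoSupercategory.{t, u₂, v₂, w₂} k}

theorem TwoSuperfunctor.tilde_comp (R : TwoSuperfunctor 𝔄 𝔅.toTwoSupercategory)
    (P : TwoSuperfunctor 𝔄₁ 𝔄) : TwoSuperfunctor.tilde (R.comp P) = R.tilde.comp P.env := by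
  refine TwoSuperfunctor.ext_heq rfl HEq.rfl HEq.rfl (heq_of_eq ?_) (heq_of_eq ?_)
  · funext (a : 𝔄₁.Obj) (b : 𝔄₁.Obj) (d : 𝔄₁.Obj) (G : Env (𝔄₁.Hom b d)) (F : Env (𝔄₁.Hom a b))
    refine Iso.ext ?_
    change sgn (F.deg * G.deg) • (𝔅.toTwoSupercategory.hcomp
        (𝔅.zpow G.deg (R.map₁ (P.map₁ G.base))).hom (𝔅.zpow F.deg (R.map₁ (P.map₁ F.base))).hom ≫
        ((R.c (P.map₁ G.base) (P.map₁ F.base)).hom ≫ R.map₂ (P.c G.base F.base).hom) ≫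
        (𝔅.zpow (F.deg + G.deg) (R.map₁ (P.map₁ (𝔄₁.comp G.base F.base)))).inv) =
      (sgn (F.deg * G.deg) • (𝔅.toTwoSupercategory.hcomp
        (𝔅.zpow G.deg (R.map₁ (P.map₁ G.base))).hom (𝔅.zpow F.deg (R.map₁ (P.map₁ F.base))).hom ≫
        (R.c (P.map₁ G.base) (P.map₁ F.base)).hom ≫
        (𝔅.zpow (F.deg + G.deg) (R.map₁ (𝔄.comp (P.map₁ G.base) (P.map₁ F.base)))).inv)) ≫
        (𝔅.zpow (F.deg + G.deg) (R.map₁ (𝔄.comp (P.map₁ G.base) (P.map₁ F.base)))).hom ≫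
        R.map₂ (P.c G.base F.base).hom ≫
        (𝔅.zpow (F.deg + G.deg) (R.map₁ (P.map₁ (𝔄₁.comp G.base F.base)))).inv
    simp only [Preadditive.zsmul_comp, Category.assoc, Iso.inv_hom_id_assoc]
  · funext (a : 𝔄₁.Obj)
    refine Iso.ext ?_
    change (R.i (P.obj a)).hom ≫ R.map₂ (P.i a).hom = (R.i (P.obj a)).hom ≫
      𝟙 _ ≫ R.map₂ (P.i a).hom ≫ 𝟙 _
    rw [Category.id_comp, Category.comp_id]

theorem TwoNatTrans.tilde_precomp {R S : TwoSuperfunctor 𝔄 𝔅.toTwoSupercategory}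
    (X : TwoNatTrans R S) (P : TwoSuperfunctor 𝔄₁ 𝔄) :
    HEq (TwoNatTrans.tilde (X.precomp P)) (X.tilde.precomp P.env) :=
  TwoNatTrans.ext_heq (R.tilde_comp P) (S.tilde_comp P) HEq.rfl HEq.rfl

theorem TwoSuperfunctor.tildeC_zero_left (R : TwoSuperfunctor 𝔄 𝔅.toTwoSupercategory)
    {a b d : 𝔄.Obj} (p : ZMod 2) (G : 𝔄.Hom b d) (F : 𝔄.Hom a b) :
    (R.tildeC 0 p G F).hom = 𝔅.hcomp (𝟙 (R.map₁ G)) (𝔅.zpow p (R.map₁ F)).hom ≫ (R.c G F).hom ≫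
      (𝔅.zpow (p + 0) (R.map₁ (𝔄.comp G F))).inv := by
  rw [R.tildeC_hom, mul_zero, sgn_zero, one_smul]
  rfl

theorem TwoSuperfunctor.tildeC_zero_right_inv (R : TwoSuperfunctor 𝔄 𝔅.toTwoSupercategory)
    {a b d : 𝔄.Obj} (q : ZMod 2) (G : 𝔄.Hom b d) (F : 𝔄.Hom a b) :
    (R.tildeC q 0 G F).inv = (𝔅.zpow (0 + q) (R.map₁ (𝔄.comp G F))).hom ≫ (R.c G F).inv ≫
      𝔅.hcomp (𝔅.zpow q (R.map₁ G)).inv (𝟙 (R.map₁ F)) := by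
  have h : (R.tildeC q 0 G F).inv = sgn (0 * q) • ((((𝔅.zpow (0 + q) (R.map₁ (𝔄.comp G F))).hom ≫
      (R.c G F).inv) ≫ (sgn (q * 0) • 𝔅.hcomp (𝔅.zpow q (R.map₁ G)).inv (𝟙 (R.map₁ F))))) := rfl
  rw [h, zero_mul, mul_zero, sgn_zero, one_smul, one_smul, Category.assoc]

theorem TwoNatTrans.tilde_postcomp (R : TwoSuperfunctor 𝔄 𝔅.toTwoSupercategory)
    {P P' : TwoSuperfunctor 𝔄₁ 𝔄} (Z : TwoNatTrans P P') :
    HEq (TwoNatTrans.tilde (TwoNatTrans.postcomp R Z))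
      (TwoNatTrans.postcomp R.tilde Z.env) := by
  refine TwoNatTrans.ext_heq (R.tilde_comp P) (R.tilde_comp P') HEq.rfl (heq_of_eq ?_)
  funext (a : 𝔄₁.Obj) (b : 𝔄₁.Obj) (F : Env (𝔄₁.Hom a b))
  change 𝔅.hcomp (𝟙 (R.map₁ (Z.X b))) (𝔅.zpow F.deg (R.map₁ (P.map₁ F.base))).hom ≫
      ((R.c (Z.X b) (P.map₁ F.base)).hom ≫ R.map₂ (Z.x F.base) ≫
        (R.c (P'.map₁ F.base) (Z.X a)).inv) ≫
      𝔅.hcomp (𝔅.zpow F.deg (R.map₁ (P'.map₁ F.base))).inv (𝟙 (R.map₁ (Z.X a))) =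
    (R.tildeC 0 F.deg (Z.X b) (P.map₁ F.base)).hom ≫ ((𝔅.zpow (F.deg + 0) _).hom ≫
      R.map₂ (Z.x F.base) ≫ (𝔅.zpow (0 + F.deg) _).inv) ≫
      (R.tildeC F.deg 0 (P'.map₁ F.base) (Z.X a)).inv
  rw [R.tildeC_zero_right_inv]
  refine Eq.trans ?_ (congrArg (· ≫ ((𝔅.zpow (F.deg + 0) _).hom ≫
      R.map₂ (Z.x F.base) ≫ (𝔅.zpow (0 + F.deg) _).inv) ≫
      (𝔅.zpow (0 + F.deg) _).hom ≫ (R.c _ _).inv ≫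
      𝔅.hcomp (𝔅.zpow F.deg _).inv (𝟙 (R.map₁ (Z.X a))))
    (R.tildeC_zero_left F.deg (Z.X b) (P.map₁ F.base)).symm)
  simp only [Category.assoc, Iso.inv_hom_id_assoc]

end Source

/-! ### Conjugation by homogeneous isomorphisms -/

section Conjugation

variable {k : Type t} [CommRing k] {𝔄 : TwoSupercategory.{t, u₁, v₁, w₁} k}
  {𝔅 : TwoSupercategory.{t, u₂, v₂, w₂} k}

theorem TwoSuperfunctor.comp_map₂_comp_map₂ (T : TwoSuperfunctor 𝔄 𝔅) {a b : 𝔄.Obj}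
    {F G H : 𝔄.Hom a b} {M : 𝔅.Hom (T.obj a) (T.obj b)} (x : M ⟶ T.map₁ F) (y : F ⟶ G)
    (z : G ⟶ H) : (x ≫ T.map₂ y) ≫ T.map₂ z = x ≫ T.map₂ (y ≫ z) := by
  rw [T.map₂_comp, Category.assoc]

theorem TwoSuperfunctor.comp_map₂_id_comp_id (T : TwoSuperfunctor 𝔄 𝔅) {a b : 𝔄.Obj}
    {F : 𝔄.Hom a b} {M : 𝔅.Hom (T.obj a) (T.obj b)} (x : M ⟶ T.map₁ F) :
    (x ≫ T.map₂ (𝟙 F)) ≫ 𝟙 (T.map₁ F) ≫ T.map₂ (𝟙 F) = x := by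
  rw [T.map₂_id, Category.comp_id, Category.comp_id, Category.comp_id]

theorem TwoSuperfunctor.conj_naturality (T : TwoSuperfunctor 𝔄 𝔅) {a b : 𝔄.Obj}
    {F₀ F G₀ G : 𝔄.Hom a b} {M N : 𝔅.Hom (T.obj a) (T.obj b)} (zF : M ≅ T.map₁ F₀)
    (zG : N ≅ T.map₁ G₀) (tF : F₀ ⟶ F) (tG : G₀ ⟶ G) (f₀ : F₀ ⟶ G₀) (f : F ⟶ G)
    (h : f₀ ≫ tG = tF ≫ f) :
    (zF.hom ≫ T.map₂ f₀ ≫ zG.inv) ≫ zG.hom ≫ T.map₂ tG = (zF.hom ≫ T.map₂ tF) ≫ T.map₂ f := by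
  simp only [Category.assoc, Iso.inv_hom_id_assoc]
  rw [← T.map₂_comp, ← T.map₂_comp, h]

/-- The sign in the coherence maps of `R̃` is the one that arises when the parts `ζ` and `T t` of
the two factors are interchanged. -/
theorem TwoSuperfunctor.conj_comp (T : TwoSuperfunctor 𝔄 𝔅) {a b d : 𝔄.Obj}
    {G₀ G : 𝔄.Hom b d} {F₀ F : 𝔄.Hom a b} {H₀ : 𝔄.Hom a d} {L : 𝔅.Hom (T.obj b) (T.obj d)}
    {M : 𝔅.Hom (T.obj a) (T.obj b)} {N : 𝔅.Hom (T.obj a) (T.obj d)} (zG : L ≅ T.map₁ G₀)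
    (zF : M ≅ T.map₁ F₀) (zH : N ≅ T.map₁ H₀) {p q : ZMod 2} {tG : G₀ ⟶ G} {tF : F₀ ⟶ F}
    (hG : HasParity k q zG.hom) (hF : HasParity k p tF) (c₀ : 𝔄.comp G₀ F₀ ⟶ H₀)
    (tH : H₀ ⟶ 𝔄.comp G F) (h : c₀ ≫ tH = 𝔄.hcomp tG tF) :
    (sgn (p * q) • (𝔅.hcomp zG.hom zF.hom ≫ ((T.c G₀ F₀).hom ≫ T.map₂ c₀) ≫ zH.inv)) ≫
        zH.hom ≫ T.map₂ tH =
      𝔅.hcomp (zG.hom ≫ T.map₂ tG) (zF.hom ≫ T.map₂ tF) ≫ (T.c G F).hom := by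
  have h1 := 𝔅.interchange zG.hom (T.map₂ tG) zF.hom (T.map₂ tF) (T.map₂_mem hF) hG
  have h2 : 𝔅.hcomp (zG.hom ≫ T.map₂ tG) (zF.hom ≫ T.map₂ tF) =
      sgn (p * q) • (𝔅.hcomp zG.hom zF.hom ≫ 𝔅.hcomp (T.map₂ tG) (T.map₂ tF)) := by
    rw [h1, smul_smul, sgn_mul_self, one_smul]
  simp only [h2, Preadditive.zsmul_comp, Category.assoc, Iso.inv_hom_id_assoc]
  rw [T.c_naturality, ← T.map₂_comp, h]

theorem comp_inv_eq_inv_comp {C : Type u} [Category.{v} C] {F G F' G' : C} (f : F ≅ G)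
    (f' : F' ≅ G') {r : F ⟶ F'} {s : G ⟶ G'} (h : r ≫ f'.hom = f.hom ≫ s) :
    s ≫ f'.inv = f.inv ≫ r := by
  rw [Iso.eq_inv_comp, ← Category.assoc, Iso.comp_inv_eq, h]

theorem comp_inv_eq_hcomp_inv_comp {a b c : 𝔅.Obj} {G G' : 𝔅.Hom b c} {F F' : 𝔅.Hom a b}
    {H H' : 𝔅.Hom a c} (g : G ≅ G') (f : F ≅ F') (h : H ≅ H') (hg : HasParity k 0 g.hom)
    {r : 𝔅.comp G F ⟶ H} {s : 𝔅.comp G' F' ⟶ H'}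
    (e : r ≫ h.hom = 𝔅.hcomp g.hom f.hom ≫ s) :
    s ≫ h.inv = 𝔅.hcomp g.inv f.inv ≫ r := by
  rw [Iso.comp_inv_eq, Category.assoc, e, ← Category.assoc,
    hcomp_comp_even_left _ _ _ _ (HasParity.inv _ hg), Iso.inv_hom_id, Iso.inv_hom_id,
    𝔅.hcomp_id, Category.id_comp]

end Conjugation

/-! ### Essential surjectivity -/

section EssentialSurjectivity

variable {k : Type t} [CommRing k] {𝔄 : TwoSupercategory.{t, u₁, v₁, w₁} k}
  {𝔅 : PiTwoSupercategory.{t, u₂, v₂, w₂} k}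

/-- The even 2-isomorphism `T((1_F)_0^p) ∘ ζ^p : π^p (T Π^0 F) ≅ T Π^p F`. -/
noncomputable def canonicalIso (T : TwoSuperfunctor 𝔄.env 𝔅.toTwoSupercategory) {a b : 𝔄.Obj}
    (F : Env (𝔄.Hom a b)) :
    (T.comp (inclusion 𝔄)).tilde.map₁ F ≅ T.map₁ F :=
  𝔅.zpow F.deg (T.map₁ (⟨0, F.base⟩ : Env (𝔄.Hom a b))) ≪≫ T.mapIso (Env.toZero F).symm

variable (T : TwoSuperfunctor 𝔄.env 𝔅.toTwoSupercategory)

theorem toZero_inv_mem {a b : 𝔄.Obj} (F : Env (𝔄.Hom a b)) :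
    HasParity k F.deg (Env.toZero F).inv := by
  refine (Env.hasParity_iff _ _).2 (HasParity.congr (HasParity.id F.base) ?_)
  change 0 = F.deg + 0 + F.deg
  generalize F.deg = p
  revert p
  decide

theorem canonicalIso_mem {a b : 𝔄.Obj} (F : Env (𝔄.Hom a b)) :
    HasParity k 0 (canonicalIso T F).hom := by
  refine ((𝔅.zpow_mem F.deg _).comp (T.map₂_mem (toZero_inv_mem F))).congr ?_
  generalize F.deg = p
  revert p
  decide

theorem canonicalIso_naturality {a b : 𝔄.Obj} {F G : Env (𝔄.Hom a b)} (f : F ⟶ G) :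
    (T.comp (inclusion 𝔄)).tilde.map₂ f ≫ (canonicalIso T G).hom =
      (canonicalIso T F).hom ≫ T.map₂ f :=
  T.conj_naturality (𝔅.zpow F.deg _) (𝔅.zpow G.deg _) (Env.toZero F).inv (Env.toZero G).inv
    (Env.mor 0 0 (Env.un f)) f ((Category.comp_id (Env.un f)).trans (Category.id_comp _).symm)

theorem canonicalIso_comp {a b d : 𝔄.Obj} (G : Env (𝔄.Hom b d)) (F : Env (𝔄.Hom a b)) :
    ((T.comp (inclusion 𝔄)).tilde.c G F).hom ≫ (canonicalIso T (𝔄.env.comp G F)).hom =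
      𝔅.hcomp (canonicalIso T G).hom (canonicalIso T F).hom ≫ (T.c G F).hom := by
  have e : 𝔄.env.hcomp (Env.toZero G).inv (Env.toZero F).inv = 𝟙 (𝔄.comp G.base F.base) :=
    (envHcomp_even_left (G := ⟨0, G.base⟩) (K := G) (F := ⟨0, F.base⟩) (H := F)
      (y := (Env.toZero G).inv) (Env.toZero F).inv (HasParity.id _) rfl).trans (𝔄.hcomp_id _ _)
  exact T.conj_comp (𝔅.zpow G.deg _) (𝔅.zpow F.deg _) (𝔅.zpow (F.deg + G.deg) _)
    (𝔅.zpow_mem G.deg _) (toZero_inv_mem F) ((inclusion 𝔄).c G.base F.base).hom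
    (Env.toZero (⟨F.deg + G.deg, 𝔄.comp G.base F.base⟩ : Env (𝔄.Hom a d))).inv
    ((Category.comp_id (𝟙 (𝔄.comp G.base F.base))).trans e.symm)

theorem canonicalIso_unit (a : 𝔄.Obj) :
    ((T.comp (inclusion 𝔄)).tilde.i a).hom ≫ (canonicalIso T (𝔄.env.one a)).hom =
      (T.i a).hom :=
  T.comp_map₂_id_comp_id (T.i a).hom

/-- The 2-natural transformation `(T 𝕁)~ ⇒ T` with identity 1-morphisms and components
`canonicalIso`. -/
noncomputable def canonical : TwoNatTrans (T.comp (inclusion 𝔄)).tilde T where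
  X := fun a : 𝔄.Obj => 𝔅.one (T.obj a)
  x {a b : 𝔄.Obj} (F : Env (𝔄.Hom a b)) := iconX (canonicalIso T F).hom
  x_mem {a b : 𝔄.Obj} (F : Env (𝔄.Hom a b)) := iconX_mem (canonicalIso_mem T F)
  x_naturality {a b : 𝔄.Obj} {F G : Env (𝔄.Hom a b)} f :=
    iconX_naturality (canonicalIso_naturality T f)
  x_comp {a b d : 𝔄.Obj} (G : Env (𝔄.Hom b d)) (F : Env (𝔄.Hom a b)) :=
    iconX_comp ((T.comp (inclusion 𝔄)).tilde.c_mem G F) (T.c_mem G F) (canonicalIso_mem T F)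
      (canonicalIso_mem T G) (canonicalIso_mem T _) (canonicalIso_comp T G F)
  x_unit := fun a : 𝔄.Obj =>
    iconX_unit ((T.comp (inclusion 𝔄)).tilde.i_mem a) (T.i_mem a) (canonicalIso_mem T _)
      (canonicalIso_unit T a)

/-- The 2-natural transformation `T ⇒ (T 𝕁)~` with identity 1-morphisms and components the inverses
of `canonicalIso`. -/
noncomputable def canonicalInv : TwoNatTrans T (T.comp (inclusion 𝔄)).tilde where
  X := fun a : 𝔄.Obj => 𝔅.one (T.obj a)
  x {a b : 𝔄.Obj} (F : Env (𝔄.Hom a b)) := iconX (canonicalIso T F).inv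
  x_mem {a b : 𝔄.Obj} (F : Env (𝔄.Hom a b)) := iconX_mem (HasParity.inv _ (canonicalIso_mem T F))
  x_naturality {a b : 𝔄.Obj} {F G : Env (𝔄.Hom a b)} f := by
    exact iconX_naturality
      (comp_inv_eq_inv_comp (canonicalIso T F) (canonicalIso T G) (canonicalIso_naturality T f))
  x_comp {a b d : 𝔄.Obj} (G : Env (𝔄.Hom b d)) (F : Env (𝔄.Hom a b)) := by
    refine iconX_comp (T.c_mem G F) ((T.comp (inclusion 𝔄)).tilde.c_mem G F)
      (HasParity.inv _ (canonicalIso_mem T F)) (HasParity.inv _ (canonicalIso_mem T G))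
      (HasParity.inv _ (canonicalIso_mem T _)) ?_
    exact comp_inv_eq_hcomp_inv_comp (canonicalIso T G) (canonicalIso T F) (canonicalIso T _)
      (canonicalIso_mem T G) (canonicalIso_comp T G F)
  x_unit := fun a : 𝔄.Obj =>
    iconX_unit (T.i_mem a) ((T.comp (inclusion 𝔄)).tilde.i_mem a)
      (HasParity.inv _ (canonicalIso_mem T _))
      ((Iso.comp_inv_eq (canonicalIso T (𝔄.env.one a))).2 (canonicalIso_unit T a).symm)

/-- The unit isomorphism `1 1 ≅ 1` as an isomorphism `canonicalInv T ∘ canonical T ≅ 1`. -/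
noncomputable def canonicalInvComp : (canonicalInv T).comp (canonical T) ≅
    TwoNatTrans.id (T.comp (inclusion 𝔄)).tilde :=
  TwoNatTrans.mkIso (fun a : 𝔄.Obj => 𝔅.runit (𝔅.one (T.obj a)))
    fun {a b : 𝔄.Obj} (F : Env (𝔄.Hom a b)) =>
      iconX_iconX (canonicalIso_mem T F) (HasParity.inv _ (canonicalIso_mem T F))
        (canonicalIso T F).hom_inv_id

/-- The unit isomorphism `1 1 ≅ 1` as an isomorphism `canonical T ∘ canonicalInv T ≅ 1`. -/
noncomputable def canonicalCompInv : (canonical T).comp (canonicalInv T) ≅ TwoNatTrans.id T :=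
  TwoNatTrans.mkIso (fun a : 𝔄.Obj => 𝔅.runit (𝔅.one (T.obj a)))
    fun {a b : 𝔄.Obj} (F : Env (𝔄.Hom a b)) =>
      iconX_iconX (HasParity.inv _ (canonicalIso_mem T F)) (canonicalIso_mem T F)
        (canonicalIso T F).inv_hom_id

variable (𝔄 𝔅) in
theorem tildeTwo_isTwoSuperequivalence : (tildeTwo 𝔄 𝔅).IsTwoSuperequivalence :=
  ⟨extendFunctor_isSuperequivalence, fun T : TwoSuperfunctor 𝔄.env 𝔅.toTwoSupercategory =>
    ⟨T.comp (inclusion 𝔄), canonical T, canonicalInv T,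
      ⟨canonicalInvComp T, fun a : 𝔄.Obj => 𝔅.runit_mem (𝔅.one (T.obj a))⟩,
      ⟨canonicalCompInv T, fun a : 𝔄.Obj => 𝔅.runit_mem (𝔅.one (T.obj a))⟩⟩⟩

/-- In the strict case, the transformations `canonical T` and `canonicalInv T` are inverse to each
other. -/
noncomputable def canonicalStrictIso (h : 𝔅.toTwoSupercategory.IsStrict)
    (T : StrictHom 𝔄.env 𝔅.toTwoSupercategory h) :
    (tildeFunctor 𝔄 𝔅 h).obj ⟨T.of.comp (inclusion 𝔄)⟩ ≅ T where
  hom := canonical T.of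
  inv := canonicalInv T.of
  hom_inv_id := TwoNatTrans.eq_of_iso (canonicalInvComp T.of).hom
    (fun a : 𝔄.Obj => h.comp_one (𝔅.one (T.of.obj a)))
    (fun a : 𝔄.Obj => h.runit_eq (𝔅.one (T.of.obj a)))
  inv_hom_id := TwoNatTrans.eq_of_iso (canonicalCompInv T.of).hom
    (fun a : 𝔄.Obj => h.comp_one (𝔅.one (T.of.obj a)))
    (fun a : 𝔄.Obj => h.runit_eq (𝔅.one (T.of.obj a)))

theorem tildeFunctor_isEquivalence (h : 𝔅.toTwoSupercategory.IsStrict) :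
    (tildeFunctor 𝔄 𝔅 h).IsEquivalence where
  faithful := ⟨fun {R S} X Y e => (TwoNatTrans.tilde_bijective R.of S.of).1 e⟩
  full := ⟨fun {R S} Y => (TwoNatTrans.tilde_bijective R.of S.of).2 Y⟩
  essSurj := ⟨fun T => ⟨_, ⟨canonicalStrictIso h T⟩⟩⟩

end EssentialSurjectivity

/-! ### Naturality in the target -/

section Target

variable {k : Type t} [CommRing k] {𝔄 : TwoSupercategory.{t, u₁, v₁, w₁} k}
  {𝔅 : PiTwoSupercategory.{t, u₂, v₂, w₂} k} {ℭ : PiTwoSupercategory.{t, u₃, v₃, w₃} k}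

theorem comparisonIso_mem (Q : TwoSuperfunctor 𝔅.toTwoSupercategory ℭ.toTwoSupercategory)
    (p : ZMod 2) {a b : 𝔅.Obj} (F : 𝔅.toTwoSupercategory.Hom a b) :
    HasParity k 0 (comparisonIso Q p F).hom :=
  ((ℭ.zpow_mem p (Q.map₁ F)).comp
    (Q.map₂_mem (HasParity.inv _ (𝔅.zpow_mem p F)))).congr (by revert p; decide)

theorem comparison_isStrong (Q : TwoSuperfunctor 𝔅.toTwoSupercategory ℭ.toTwoSupercategory)
    (R : TwoSuperfunctor 𝔄 𝔅.toTwoSupercategory) : (comparison Q R).IsStrong :=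
  fun {a b : 𝔄.Obj} (F : Env (𝔄.Hom a b)) =>
    (ℭ.lunit (ℭ.pw F.deg (Q.map₁ (R.map₁ F.base))) ≪≫ comparisonIso Q F.deg (R.map₁ F.base) ≪≫
      (ℭ.runit (Q.map₁ (𝔅.pw F.deg (R.map₁ F.base)))).symm).isIso_hom

theorem TwoSuperfunctor.comp_assoc {𝔄₁ : TwoSupercategory.{t, u₁, v₁, w₁} k}
    {𝔄₂ : TwoSupercategory.{t, u₂, v₂, w₂} k} {𝔄₃ : TwoSupercategory.{t, u₃, v₃, w₃} k}
    {𝔄₄ : TwoSupercategory.{t, u₄, v₄, w₄} k} (Q : TwoSuperfunctor 𝔄₃ 𝔄₄)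
    (R : TwoSuperfunctor 𝔄₂ 𝔄₃) (P : TwoSuperfunctor 𝔄₁ 𝔄₂) :
    (Q.comp R).comp P = Q.comp (R.comp P) := by
  refine TwoSuperfunctor.ext_heq rfl HEq.rfl HEq.rfl (heq_of_eq ?_) (heq_of_eq ?_)
  · funext a b d G F
    exact Iso.ext (Q.comp_map₂_comp_map₂ (Q.c _ _).hom (R.c _ _).hom (R.map₂ (P.c G F).hom))
  · funext a
    exact Iso.ext (Q.comp_map₂_comp_map₂ (Q.i _).hom (R.i _).hom (R.map₂ (P.i a).hom))

theorem comp_tilde_comp_inclusion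
    (Q : TwoSuperfunctor 𝔅.toTwoSupercategory ℭ.toTwoSupercategory)
    (R : TwoSuperfunctor 𝔄 𝔅.toTwoSupercategory) :
    (Q.comp R.tilde).comp (inclusion 𝔄) = Q.comp R := by
  rw [TwoSuperfunctor.comp_assoc, TwoSuperfunctor.tilde_comp_inclusion]

/-- The comparison is the canonical transformation `(T 𝕁)~ ⇒ T` for `T = Q R̃`. -/
theorem comparison_heq (Q : TwoSuperfunctor 𝔅.toTwoSupercategory ℭ.toTwoSupercategory)
    (R : TwoSuperfunctor 𝔄 𝔅.toTwoSupercategory) :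
    HEq (canonical (Q.comp R.tilde)) (comparison Q R) := by
  refine TwoNatTrans.ext_heq (congrArg TwoSuperfunctor.tilde (comp_tilde_comp_inclusion Q R)) rfl
    HEq.rfl (heq_of_eq ?_)
  funext (a : 𝔄.Obj) (b : 𝔄.Obj) (F : Env (𝔄.Hom a b))
  refine congrArg iconX ?_
  change (ℭ.zpow F.deg (Q.map₁ (R.map₁ F.base))).hom ≫ Q.map₂ (𝟙 (R.map₁ F.base) ≫
      R.map₂ (𝟙 F.base) ≫ (𝔅.zpow F.deg (R.map₁ F.base)).inv) =
    (ℭ.zpow F.deg (Q.map₁ (R.map₁ F.base))).hom ≫ Q.map₂ (𝔅.zpow F.deg (R.map₁ F.base)).inv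
  rw [R.map₂_id, Category.id_comp, Category.id_comp]

theorem comparison_invertible
    (Q : TwoSuperfunctor 𝔅.toTwoSupercategory ℭ.toTwoSupercategory)
    (R : TwoSuperfunctor 𝔄 𝔅.toTwoSupercategory) :
    ∃ θ' : TwoNatTrans (Q.comp R.tilde) (TwoSuperfunctor.tilde (Q.comp R)),
        (∃ e : θ'.comp (comparison Q R) ≅ TwoNatTrans.id (TwoSuperfunctor.tilde (Q.comp R)),
          HasParity k 0 e.hom) ∧
        (∃ e : (comparison Q R).comp θ' ≅ TwoNatTrans.id (Q.comp R.tilde),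
          HasParity k 0 e.hom) := by
  -- The source of the comparison equals `(T 𝕁)~` for `T = Q R̃` only propositionally, so it is
  -- generalized to `U` before the equality is used.
  have key : ∀ (U : TwoSuperfunctor 𝔄 ℭ.toTwoSupercategory)
      (θ : TwoNatTrans U.tilde (Q.comp R.tilde)),
      (Q.comp R.tilde).comp (inclusion 𝔄) = U → HEq (canonical (Q.comp R.tilde)) θ →
      ∃ θ' : TwoNatTrans (Q.comp R.tilde) U.tilde,
        (∃ e : θ'.comp θ ≅ TwoNatTrans.id U.tilde, HasParity k 0 e.hom) ∧
        (∃ e : θ.comp θ' ≅ TwoNatTrans.id (Q.comp R.tilde), HasParity k 0 e.hom) := by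
    rintro U θ rfl h
    obtain rfl := eq_of_heq h
    exact ⟨canonicalInv _,
      ⟨canonicalInvComp _, fun a : 𝔄.Obj => ℭ.runit_mem (ℭ.one (Q.obj (R.obj a)))⟩,
      ⟨canonicalCompInv _, fun a : 𝔄.Obj => ℭ.runit_mem (ℭ.one (Q.obj (R.obj a)))⟩⟩
  exact key _ _ (comp_tilde_comp_inclusion Q R) (comparison_heq Q R)

theorem comparison_naturality_right
    (Q : TwoSuperfunctor 𝔅.toTwoSupercategory ℭ.toTwoSupercategory)
    {R S : TwoSuperfunctor 𝔄 𝔅.toTwoSupercategory} (X : TwoNatTrans R S) :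
    (fun a : 𝔄.Obj => (ℭ.runit (Q.map₁ (X.X a))).hom ≫ (ℭ.lunit (Q.map₁ (X.X a))).inv) ∈
      superModification ((TwoNatTrans.postcomp Q X.tilde).comp (comparison Q R))
        ((comparison Q S).comp (TwoNatTrans.tilde (TwoNatTrans.postcomp Q X))) := by
  intro (a : 𝔄.Obj) (b : 𝔄.Obj) (F : Env (𝔄.Hom a b))
  refine iconX_mod (comparisonIso_mem Q F.deg (R.map₁ F.base))
    (comparisonIso_mem Q F.deg (S.map₁ F.base))
    ((TwoNatTrans.tilde (TwoNatTrans.postcomp Q X)).x_mem F)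
    ((TwoNatTrans.postcomp Q X.tilde).x_mem F) ?_
  change ℭ.hcomp (𝟙 (Q.map₁ (X.X b))) ((ℭ.zpow F.deg (Q.map₁ (R.map₁ F.base))).hom ≫
        Q.map₂ (𝔅.zpow F.deg (R.map₁ F.base)).inv) ≫
      (Q.c (X.X b) (𝔅.pw F.deg (R.map₁ F.base))).hom ≫
      Q.map₂ (𝔅.hcomp (𝟙 (X.X b)) (𝔅.zpow F.deg (R.map₁ F.base)).hom ≫ X.x F.base ≫
        𝔅.hcomp (𝔅.zpow F.deg (S.map₁ F.base)).inv (𝟙 (X.X a))) ≫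
      (Q.c (𝔅.pw F.deg (S.map₁ F.base)) (X.X a)).inv =
    (ℭ.hcomp (𝟙 (Q.map₁ (X.X b))) (ℭ.zpow F.deg (Q.map₁ (R.map₁ F.base))).hom ≫
      ((Q.c (X.X b) (R.map₁ F.base)).hom ≫ Q.map₂ (X.x F.base) ≫
        (Q.c (S.map₁ F.base) (X.X a)).inv) ≫
      ℭ.hcomp (ℭ.zpow F.deg (Q.map₁ (S.map₁ F.base))).inv (𝟙 (Q.map₁ (X.X a)))) ≫
      ℭ.hcomp ((ℭ.zpow F.deg (Q.map₁ (S.map₁ F.base))).hom ≫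
        Q.map₂ (𝔅.zpow F.deg (S.map₁ F.base)).inv) (𝟙 (Q.map₁ (X.X a)))
  have h1 := Q.c_naturality (𝟙 (X.X b)) (𝔅.zpow F.deg (R.map₁ F.base)).inv
  have h2 := Q.c_naturality (𝔅.zpow F.deg (S.map₁ F.base)).inv (𝟙 (X.X a))
  rw [Q.map₂_id] at h1 h2
  have h3 : Q.map₂ (𝔅.hcomp (𝟙 (X.X b)) (𝔅.zpow F.deg (R.map₁ F.base)).inv) ≫
      Q.map₂ (𝔅.hcomp (𝟙 (X.X b)) (𝔅.zpow F.deg (R.map₁ F.base)).hom) = 𝟙 _ := by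
    rw [← Q.map₂_comp, ← whiskerL_comp, Iso.inv_hom_id, 𝔅.hcomp_id, Q.map₂_id]
  have h4 : ℭ.hcomp (ℭ.zpow F.deg (Q.map₁ (S.map₁ F.base))).inv (𝟙 (Q.map₁ (X.X a))) ≫
      ℭ.hcomp (ℭ.zpow F.deg (Q.map₁ (S.map₁ F.base))).hom (𝟙 (Q.map₁ (X.X a))) = 𝟙 _ := by
    rw [← whiskerR_comp, Iso.inv_hom_id, ℭ.hcomp_id]
  rw [← cancel_mono (Q.c (𝔅.pw F.deg (S.map₁ F.base)) (X.X a)).hom]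
  simp only [whiskerL_comp, whiskerR_comp, Category.assoc, Q.map₂_comp, Iso.inv_hom_id,
    Category.comp_id]
  rw [reassoc_of% h4, h2, Iso.inv_hom_id_assoc, reassoc_of% h1, reassoc_of% h3]

theorem comparison_naturality_left
    {Q Q' : TwoSuperfunctor 𝔅.toTwoSupercategory ℭ.toTwoSupercategory} (W : TwoNatTrans Q Q')
    (R : TwoSuperfunctor 𝔄 𝔅.toTwoSupercategory) :
    (fun a : 𝔄.Obj => (ℭ.runit (W.X (R.obj a))).hom ≫ (ℭ.lunit (W.X (R.obj a))).inv) ∈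
      superModification ((W.precomp R.tilde).comp (comparison Q R))
        ((comparison Q' R).comp (TwoNatTrans.tilde (W.precomp R))) := by
  intro (a : 𝔄.Obj) (b : 𝔄.Obj) (F : Env (𝔄.Hom a b))
  refine iconX_mod (comparisonIso_mem Q F.deg (R.map₁ F.base))
    (comparisonIso_mem Q' F.deg (R.map₁ F.base))
    ((TwoNatTrans.tilde (W.precomp R)).x_mem F)
    ((W.precomp R.tilde).x_mem F) ?_
  change ℭ.hcomp (𝟙 (W.X (R.obj b))) ((ℭ.zpow F.deg (Q.map₁ (R.map₁ F.base))).hom ≫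
        Q.map₂ (𝔅.zpow F.deg (R.map₁ F.base)).inv) ≫ W.x (𝔅.pw F.deg (R.map₁ F.base)) =
    (ℭ.hcomp (𝟙 (W.X (R.obj b))) (ℭ.zpow F.deg (Q.map₁ (R.map₁ F.base))).hom ≫
      W.x (R.map₁ F.base) ≫
      ℭ.hcomp (ℭ.zpow F.deg (Q'.map₁ (R.map₁ F.base))).inv (𝟙 (W.X (R.obj a)))) ≫
      ℭ.hcomp ((ℭ.zpow F.deg (Q'.map₁ (R.map₁ F.base))).hom ≫
        Q'.map₂ (𝔅.zpow F.deg (R.map₁ F.base)).inv) (𝟙 (W.X (R.obj a)))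
  have h4 : ℭ.hcomp (ℭ.zpow F.deg (Q'.map₁ (R.map₁ F.base))).inv (𝟙 (W.X (R.obj a))) ≫
      ℭ.hcomp (ℭ.zpow F.deg (Q'.map₁ (R.map₁ F.base))).hom (𝟙 (W.X (R.obj a))) = 𝟙 _ := by
    rw [← whiskerR_comp, Iso.inv_hom_id, ℭ.hcomp_id]
  simp only [whiskerL_comp, whiskerR_comp, Category.assoc]
  rw [reassoc_of% h4, W.x_naturality]

end Target

end TwoSuper

theorem mainTheorem6 {k : Type t} [CommRing k] (𝔄 : TwoSupercategory.{t, u₁, v₁, w₁} k)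
    (𝔅 : PiTwoSupercategory.{t, u₂, v₂, w₂} k) :
    -- `R̃` extends `R`, and `X̃` is the unique extension of `X`
    (∀ R : TwoSuperfunctor 𝔄 𝔅.toTwoSupercategory, R.tilde.comp (inclusion 𝔄) = R) ∧
    (∀ (R S : TwoSuperfunctor 𝔄 𝔅.toTwoSupercategory) (X : TwoNatTrans R S)
      (Y : TwoNatTrans R.tilde S.tilde), Y = X.tilde ↔
        (∀ a, Y.X a = X.X a) ∧
        ∀ {a b : 𝔄.Obj} (F : 𝔄.Hom a b), HEq (Y.x ((inclusion 𝔄).map₁ F)) (X.x F)) ∧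
    -- the equivalence
    (tildeTwo 𝔄 𝔅 : TwoSuperfunctor (HomTwo 𝔄 𝔅.toTwoSupercategory)
      (HomTwo (PiEnvelope 𝔄).toTwoSupercategory
        𝔅.toTwoSupercategory)).IsTwoSuperequivalence ∧
    (∀ R S : TwoSuperfunctor 𝔄 𝔅.toTwoSupercategory,
      Function.Bijective (TwoNatTrans.tilde : TwoNatTrans R S → TwoNatTrans R.tilde S.tilde)) ∧
    (∀ R : TwoSuperfunctor 𝔄 𝔅.toTwoSupercategory,
      (TwoNatTrans.id R).tilde = TwoNatTrans.id R.tilde) ∧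
    (∀ {R S T : TwoSuperfunctor 𝔄 𝔅.toTwoSupercategory} (Y : TwoNatTrans S T)
      (X : TwoNatTrans R S), (Y.comp X).tilde = Y.tilde.comp X.tilde) ∧
    (∀ h : 𝔅.toTwoSupercategory.IsStrict, (tildeFunctor 𝔄 𝔅 h).IsEquivalence) ∧
    -- the envelope is a strict 2-functor
    ((TwoSuperfunctor.id 𝔄).env = TwoSuperfunctor.id 𝔄.env) ∧
    (∀ (𝔄₁ : TwoSupercategory.{t, u₃, v₃, w₃} k) (𝔄₂ : TwoSupercategory.{t, u₄, v₄, w₄} k)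
      (P : TwoSuperfunctor 𝔄 𝔄₁) (Q : TwoSuperfunctor 𝔄₁ 𝔄₂),
      (Q.comp P).env = Q.env.comp P.env ∧
      (TwoNatTrans.id P).env = TwoNatTrans.id P.env ∧
      (∀ (P' P'' : TwoSuperfunctor 𝔄 𝔄₁) (X : TwoNatTrans P P') (Y : TwoNatTrans P' P''),
        (Y.comp X).env = Y.env.comp X.env) ∧
      (∀ (P' : TwoSuperfunctor 𝔄 𝔄₁) (X : TwoNatTrans P P'),
        (TwoNatTrans.postcomp Q X).env = TwoNatTrans.postcomp Q.env X.env) ∧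
      (∀ (Q' : TwoSuperfunctor 𝔄₁ 𝔄₂) (Y : TwoNatTrans Q Q'),
        (Y.precomp P).env = Y.env.precomp P.env)) ∧
    -- naturality in `𝔄`
    (∀ (𝔄₁ : TwoSupercategory.{t, u₃, v₃, w₃} k) (P : TwoSuperfunctor 𝔄₁ 𝔄)
      (R : TwoSuperfunctor 𝔄 𝔅.toTwoSupercategory),
      (TwoSuperfunctor.tilde (R.comp P)) = R.tilde.comp P.env ∧
      (∀ (S : TwoSuperfunctor 𝔄 𝔅.toTwoSupercategory) (X : TwoNatTrans R S),
        HEq (TwoNatTrans.tilde (X.precomp P)) (X.tilde.precomp P.env)) ∧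
      (∀ (P' : TwoSuperfunctor 𝔄₁ 𝔄) (Z : TwoNatTrans P P'),
        HEq (TwoNatTrans.tilde (TwoNatTrans.postcomp R Z))
          (TwoNatTrans.postcomp R.tilde Z.env))) ∧
    -- naturality in `𝔅`
    (∀ (ℭ : PiTwoSupercategory.{t, u₃, v₃, w₃} k)
      (Q : TwoSuperfunctor 𝔅.toTwoSupercategory ℭ.toTwoSupercategory)
      (R : TwoSuperfunctor 𝔄 𝔅.toTwoSupercategory),
      (comparison Q R).IsStrong ∧
      (∃ θ' : TwoNatTrans (Q.comp R.tilde) (TwoSuperfunctor.tilde (Q.comp R)),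
        (∃ e : θ'.comp (comparison Q R) ≅ TwoNatTrans.id (TwoSuperfunctor.tilde (Q.comp R)),
          HasParity k 0 e.hom) ∧
        (∃ e : (comparison Q R).comp θ' ≅ TwoNatTrans.id (Q.comp R.tilde),
          HasParity k 0 e.hom)) ∧
      (∀ (S : TwoSuperfunctor 𝔄 𝔅.toTwoSupercategory) (X : TwoNatTrans R S),
        (fun a : 𝔄.Obj => (ℭ.runit (Q.map₁ (X.X a))).hom ≫ (ℭ.lunit (Q.map₁ (X.X a))).inv) ∈
          superModification ((TwoNatTrans.postcomp Q X.tilde).comp (comparison Q R))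
            ((comparison Q S).comp (TwoNatTrans.tilde (TwoNatTrans.postcomp Q X)))) ∧
      (∀ (Q' : TwoSuperfunctor 𝔅.toTwoSupercategory ℭ.toTwoSupercategory) (W : TwoNatTrans Q Q'),
        (fun a : 𝔄.Obj => (ℭ.runit (W.X (R.obj a))).hom ≫ (ℭ.lunit (W.X (R.obj a))).inv) ∈
          superModification ((W.precomp R.tilde).comp (comparison Q R))
            ((comparison Q' R).comp (TwoNatTrans.tilde (W.precomp R))))) := by
  exact ⟨TwoSuperfunctor.tilde_comp_inclusion, fun _ _ => TwoNatTrans.eq_tilde_iff,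
    tildeTwo_isTwoSuperequivalence 𝔄 𝔅, TwoNatTrans.tilde_bijective,
    fun R => (TwoNatTrans.tilde_id R).symm, fun Y X => (TwoNatTrans.tilde_comp Y X).symm,
    tildeFunctor_isEquivalence, TwoSuperfunctor.env_id,
    fun _ _ P Q => ⟨Q.env_comp P, TwoNatTrans.env_id P, fun _ _ X Y => TwoNatTrans.env_comp Y X,
      fun _ X => TwoNatTrans.env_postcomp Q X, fun _ Y => TwoNatTrans.env_precomp Y P⟩,
    fun _ P R => ⟨R.tilde_comp P, fun _ X => X.tilde_precomp P,
      fun _ Z => TwoNatTrans.tilde_postcomp R Z⟩,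
    fun _ Q R => ⟨comparison_isStrong Q R, comparison_invertible Q R,
      fun _ X => comparison_naturality_right Q X, fun _ W => comparison_naturality_left W R⟩⟩
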